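/- **Conventions.** Let $\Bbbk$ be a commutative ring with $\mathbb{Q}\subseteq\Bbbk$. Chain complexes are $\mathbb{Z}$-graded (unbounded) complexes of $\Bbbk$-modules, $d$ has degree $-1$, and all signs follow the Koszul rule. A *contraction* $\mathscr{D}=(f,g,h)\colon A\rightleftarrows B$ consists of chain maps $f\colon A\to B$, $g\colon B\to A$ and a map $h\colon A\to A$ of degree $1$ with $$dh+hd=gf-1_A,\quad fg=1_B,\quad fh=0,\quad hh=0,\quad hg=0.$$ It is *filtered* if $A$ and $B$ carry bounded below exhaustive filtrations (by subcomplexes) that are preserved by $f,g,h$. A *thick map* $\mathbf f\colon A\to B$ is a sequence $f_n\colon A^{\otimes n}\to B^{\otimes n}$, $n\ge 0$, of maps of one degree; it is *symmetric* if each $f_n$ is $\Sigma_n$-equivariant, and a *morphism* if $f_n=f_1^{\otimes n}$ for all $n$. A thick map $\mathbf h\colon A\to A$ of degree $1$ is a *pseudo-derivation* if $(h_p\otimes 1-1\otimes h_q)h_{p+q}=-h_{p+q}(h_p\otimes 1-1\otimes h_q)=h_p\otimes h_q$ for all $p,q\ge 0$. A *thick contraction* $(\mathbf f,\mathbf g,\mathbf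 h)$ consists of thick maps such that $(f_n,g_n,h_n)\colon A^{\otimes n}\rightleftarrows B^{\otimes n}$ is a contraction for every $n\geq 0$; it *extends* $(f_1,g_1,h_1)$. For a symmetric sequence $\mathcal O=\{\mathcal O(n)\}_{n\ge0}$ of chain complexes let $\mathcal O[A]=\bigoplus_{n\ge 0}\mathcal O(n)\otimes_{\Sigma_n}A^{\otimes n}$, with *weight filtration* $F_p=\bigoplus_{n\le p}\mathcal O(n)\otimes_{\Sigma_n}A^{\otimes n}$. A symmetric thick map $\mathbf f\colon A\to B$ induces $\mathcal O[\mathbf f]=\bigoplus_n 1\otimes_{\Sigma_n} f_n$. Let $\mathcal C$ be a cooperad, i.e. a comonoid $(\mathcal C,\Delta,\varepsilon)$ for the composition product $(\mathcal O\circ \mathcal P)=\bigoplus_n \mathcal O(n)\otimes_{\Sigma_n}\mathcal P^{\otimes n}$ of symmetric sequences. A *$\mathcal C$-coalgebra* is a coalgebra $\Delta_A\colon A\to\mathcal C[A]$ over the comonad $\mathcal C[-]$; for every complex $A$, the complex $\mathcal C[A]$ is a (cofree-type) $\mathcal C$-coalgebra through $\mathcal C[A]\to(\mathcal C\circ\mathcal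 C)[A]\cong\mathcal C[\mathcal C[A]]$. A symmetric thick map $\mathbf f$ between $\mathcal C$-coalgebras is a *thick map of $\mathcal C$-coalgebras* if $\mathcal C[\mathbf f]\,\Delta_A=\Delta_B f_1$. A *thick contraction of $\mathcal C$-coalgebras* is a thick contraction between $\mathcal C$-coalgebras in which $\mathbf f,\mathbf g$ are morphisms, $\mathbf h$ is a pseudo-derivation, and $\mathbf f,\mathbf g,\mathbf h$ are thick maps of $\mathcal C$-coalgebras. A *filtered contraction of $\mathcal C$-coalgebras* is a filtered contraction that has an extension to a thick contraction of $\mathcal C$-coalgebras in which all $f_n,g_n,h_n$ preserve the induced filtrations on $A^{\otimes n}$ and $B^{\otimes n}$ (level $p$ is the sum of the images of the $F_{i_1}\otimes\cdots\otimes F_{i_n}$ with $i_1+\cdots+i_n=p$). The *symmetrized tensor trick homotopy* of a contraction $\mathscr D=(f,g,h)$ is the symmetric thick map $\mathbf h^\Sigma\colon A\to A$ given by $$h^\Sigma_n=\frac1{n!}\sum_{\sigma\in\Sigma_n}\sigma^{-1}\Big(\sum_{i+1+j=n}1^{\otimes i}\otimes h\otimes (gf)^{\otimes j}\Big)\sigma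 .$$ **Theorem ($\mathcal C$-coalgebra Tensor Trick).** Let $\Bbbk\supseteq\mathbb{Q}$, let $\mathcal C$ be a cooperad, and let $\mathscr D=(f,g,h)\colon A\rightleftarrows B$ be a contraction. Then, with respect to the weight filtrations on $\mathcal C[A]$ and $\mathcal C[B]$, there is a filtered contraction of $\mathcal C$-coalgebras $$\mathcal C[\mathscr D]=(F,G,H)\colon \mathcal C[A]\rightleftarrows\mathcal C[B],$$ where $\mathcal C[A]$ and $\mathcal C[B]$ carry the cofree-type $\mathcal C$-coalgebra structures, $F=\mathcal C[f]$ and $G=\mathcal C[g]$ are the maps induced by $f$ and $g$, and $H=\mathcal C[\mathbf h^\Sigma]=\bigoplus_n 1\otimes_{\Sigma_n}h^\Sigma_n$ is induced by the symmetrized tensor trick homotopy. -/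

import Mathlib

open scoped TensorProduct DirectSum

universe u

/-- A (possibly unbounded) chain complex of `k`-modules: a `ℤ`-graded `k`-module with a
differential `d` of degree `-1`. -/
structure DGMod (k : Type u) [CommRing k] where
  carrier : Type u
  [addCommGroup : AddCommGroup carrier]
  [module : Module k carrier]
  gr : ℤ → Submodule k carrier
  internal : DirectSum.IsInternal gr
  d : carrier →ₗ[k] carrier
  d_mem : ∀ {i : ℤ} {x : carrier}, x ∈ gr i → d x ∈ gr (i - 1)
  d_d : ∀ x : carrier, d (d x) = 0

instance {k : Type u} [CommRing k] : CoeSort (DGMod k) (Type u) := ⟨DGMod.carrier⟩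

attribute [instance] DGMod.addCommGroup DGMod.module

noncomputable section

/-- The scalar `(-1)^n`. -/
def sg (k : Type u) [CommRing k] (n : ℤ) : k := ((n.negOnePow : ℤ) : k)

section signs

variable (k : Type u) [CommRing k]

lemma sg_add (m n : ℤ) : sg k (m + n) = sg k m * sg k n := by
  simp [sg, Int.negOnePow_add]

lemma sg_congr {m n : ℤ} (h : (m : ZMod 2) = n) : sg k m = sg k n := by
  have : m.negOnePow = n.negOnePow := by
    rw [Int.negOnePow_eq_iff, ← ZMod.intCast_eq_zero_iff_even]
    push_cast
    rw [h, sub_self]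
  rw [sg, sg, this]

@[simp] lemma sg_zero : sg k 0 = 1 := by simp [sg]

lemma sg_one : sg k 1 = -1 := by simp [sg]

lemma sg_succ_add {m n : ℤ} (h : (m : ZMod 2) = n + 1) : sg k m + sg k n = 0 := by
  have : sg k m = sg k (n + 1) := sg_congr k (by push_cast; exact h)
  rw [this, sg_add, sg_one]; ring

end signs

namespace DGMod

variable {k : Type u} [CommRing k]

/-- Decomposition into homogeneous components. -/
def dec (A : DGMod k) : A ≃ₗ[k] ⨁ i, A.gr i :=
  (LinearEquiv.ofBijective (DirectSum.coeLinearMap A.gr) A.internal).symm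

lemma dec_mem (A : DGMod k) {i : ℤ} {x : A} (hx : x ∈ A.gr i) :
    A.dec x = DirectSum.lof k ℤ (fun i => A.gr i) i ⟨x, hx⟩ := by
  apply (LinearEquiv.symm_apply_eq _).2
  exact (DirectSum.coeLinearMap_lof A.gr i ⟨x, hx⟩).symm

/-- The endomorphism acting on elements of degree `i` as the scalar `c i`. -/
def tw (A : DGMod k) (c : ℤ → k) : A →ₗ[k] A :=
  (DirectSum.toModule k ℤ A fun i => c i • (A.gr i).subtype) ∘ₗ A.dec.toLinearMap

lemma tw_mem (A : DGMod k) (c : ℤ → k) {i : ℤ} {x : A} (hx : x ∈ A.gr i) :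
    A.tw c x = c i • x := by
  simp [tw, A.dec_mem hx, DirectSum.toModule_lof]

/-- The sign operator `x ↦ (-1)^(n|x|) x`. -/
def sgn (A : DGMod k) (n : ℤ) : A →ₗ[k] A := A.tw fun i => sg k (n * i)

/-- The projection to the homogeneous component of degree `n`. -/
def proj (A : DGMod k) (n : ℤ) : A →ₗ[k] A := A.tw fun i => if i = n then 1 else 0

lemma sgn_mem (A : DGMod k) (n : ℤ) {i : ℤ} {x : A} (hx : x ∈ A.gr i) :
    A.sgn n x = sg k (n * i) • x := A.tw_mem _ hx

lemma iSup_gr (A : DGMod k) : ⨆ i, A.gr i = ⊤ := A.internal.submodule_iSup_eq_top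

lemma hom_ext (A : DGMod k) {V : Type*} [AddCommGroup V] [Module k V] {f g : A →ₗ[k] V}
    (h : ∀ i, ∀ x ∈ A.gr i, f x = g x) : f = g := by
  have : (⊤ : Submodule k A) ≤ LinearMap.eqLocus f g := by
    rw [← A.iSup_gr]
    exact iSup_le fun i x hx => h i x hx
  ext x
  exact this trivial

/-- Criterion for a grading. -/
lemma internal_of_proj {V : Type u} [AddCommGroup V] [Module k V] (gr : ℤ → Submodule k V)
    (π : ℤ → V →ₗ[k] V) (h1 : ∀ i, ∀ x ∈ gr i, π i x = x)
    (h2 : ∀ i j, j ≠ i → ∀ x ∈ gr i, π j x = 0) (h3 : ⨆ i, gr i = ⊤) :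
    DirectSum.IsInternal gr := by
  rw [DirectSum.isInternal_submodule_iff_iSupIndep_and_iSup_eq_top]
  refine ⟨fun i => ?_, h3⟩
  rw [Submodule.disjoint_def]
  intro x hx hx'
  have : (⨆ j, ⨆ (_ : j ≠ i), gr j) ≤ LinearMap.ker (π i) :=
    iSup_le fun j => iSup_le fun hj y hy => h2 j i hj.symm y hy
  rw [← h1 i x hx]
  exact this hx'

/-- A linear map between complexes that is homogeneous of degree `n`. -/
def IsDeg {A B : DGMod k} (n : ℤ) (f : A →ₗ[k] B) : Prop :=
  ∀ i, ∀ x ∈ A.gr i, f x ∈ B.gr (i + n)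

/-- A morphism of chain complexes: a linear map of degree `0` commuting with `d`. -/
structure Mor (A B : DGMod k) where
  lin : A →ₗ[k] B
  mem : ∀ {i : ℤ} {x : A}, x ∈ A.gr i → lin x ∈ B.gr i
  comm : ∀ x : A, lin (A.d x) = B.d (lin x)

namespace Mor

variable {A B E : DGMod k}

def id (A : DGMod k) : Mor A A := ⟨LinearMap.id, fun h => h, fun _ => rfl⟩

def comp (g : Mor B E) (f : Mor A B) : Mor A E :=
  ⟨g.lin ∘ₗ f.lin, fun h => g.mem (f.mem h), fun x => by simp [f.comm, g.comm]⟩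

def sub (f g : Mor A B) : Mor A B :=
  ⟨f.lin - g.lin, fun h => Submodule.sub_mem _ (f.mem h) (g.mem h),
    fun x => by simp [f.comm, g.comm]⟩

lemma tw_comm (f : Mor A B) (c : ℤ → k) (x : A) : f.lin (A.tw c x) = B.tw c (f.lin x) := by
  have : f.lin ∘ₗ A.tw c = B.tw c ∘ₗ f.lin := by
    refine A.hom_ext fun i x hx => ?_
    simp [A.tw_mem c hx, B.tw_mem c (f.mem hx)]
  exact LinearMap.congr_fun this x

end Mor

/-- The direct sum of chain complexes. -/
@[reducible] def dsum {ι : Type} [DecidableEq ι] (M : ι → DGMod k) : DGMod k where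
  carrier := ⨁ i, M i
  gr n :=
    { carrier := {x | ∀ i, x i ∈ (M i).gr n}
      zero_mem' := fun i => (M i).gr n |>.zero_mem
      add_mem' := fun hx hy i => (M i).gr n |>.add_mem (hx i) (hy i)
      smul_mem' := fun c _ hx i => (M i).gr n |>.smul_mem c (hx i) }
  internal := by
    refine internal_of_proj _ (fun n => DirectSum.lmap fun i => (M i).proj n)
      ?_ ?_ ?_
    · intro n x hx
      ext i
      simpa [proj] using (M i).tw_mem (fun i => if i = n then 1 else 0) (hx i)
    · intro n j hj x hx
      ext i
      have := (M i).tw_mem (fun i => if i = j then 1 else 0) (hx i)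
      rw [if_neg hj.symm, zero_smul] at this
      simpa [proj] using this
    · rw [eq_top_iff]
      rintro x -
      induction x using DirectSum.induction_on with
      | zero => exact Submodule.zero_mem _
      | add x y hx hy => exact Submodule.add_mem _ hx hy
      | of i x =>
        have hx : x ∈ ⨆ n, (M i).gr n := by rw [iSup_gr]; trivial
        induction hx using Submodule.iSup_induction' with
        | zero => rw [map_zero]; exact Submodule.zero_mem _
        | add x y _ _ hx hy => rw [map_add]; exact Submodule.add_mem _ hx hy
        | mem n x hx =>
          refine Submodule.mem_iSup_of_mem n fun j => ?_
          by_cases h : i = j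
          · subst h
            simpa [DirectSum.of_eq_same] using hx
          · rw [DirectSum.of_eq_of_ne _ _ _ (Ne.symm h)]
            exact Submodule.zero_mem _
  d := DirectSum.lmap fun i => (M i).d
  d_mem := fun {n x} hx i => by simpa using (M i).d_mem (hx i)
  d_d := fun x => by
    ext i
    simp [d_d]

def dsumι {ι : Type} [DecidableEq ι] (M : ι → DGMod k) (i : ι) : Mor (M i) (dsum M) where
  lin := DirectSum.lof k ι (fun i => M i) i
  mem := fun {n x} hx j => by
    by_cases h : i = j
    · subst h
      simpa [DirectSum.lof_eq_of, DirectSum.of_eq_same] using hx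
    · rw [DirectSum.lof_eq_of, DirectSum.of_eq_of_ne _ _ _ (Ne.symm h)]
      exact Submodule.zero_mem _
  comm := fun x => (DirectSum.lmap_lof (fun i => (M i).d) i x).symm

/-- The relations imposed by a family of morphisms into `M`. -/
def relSub {J : Type} {N : J → DGMod k} {M : DGMod k} (φ : ∀ j, Mor (N j) M) : Submodule k M :=
  ⨆ j, LinearMap.range (φ j).lin

lemma relSub_le {J : Type} {N : J → DGMod k} {M : DGMod k} (φ : ∀ j, Mor (N j) M)
    {V : Type*} [AddCommGroup V] [Module k V] (f : M →ₗ[k] V)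
    (h : ∀ j x, f ((φ j).lin x) = 0) : relSub φ ≤ LinearMap.ker f := by
  refine iSup_le fun j => ?_
  rintro _ ⟨x, rfl⟩
  exact h j x

lemma mem_relSub {J : Type} {N : J → DGMod k} {M : DGMod k} (φ : ∀ j, Mor (N j) M) (j : J)
    (x : N j) : (φ j).lin x ∈ relSub φ :=
  Submodule.mem_iSup_of_mem j ⟨x, rfl⟩

lemma relSub_stable {J : Type} {N : J → DGMod k} {M : DGMod k} (φ : ∀ j, Mor (N j) M)
    (f : M →ₗ[k] M) (g : ∀ j, N j →ₗ[k] N j)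
    (h : ∀ j x, f ((φ j).lin x) = (φ j).lin (g j x)) : relSub φ ≤ (relSub φ).comap f := by
  refine iSup_le fun j => ?_
  rintro _ ⟨x, rfl⟩
  rw [Submodule.mem_comap, h]
  exact mem_relSub φ j _

/-- The quotient of the complex `M` by the sum of the images of a family of morphisms. -/
@[reducible] def quot {J : Type} {N : J → DGMod k} (M : DGMod k) (φ : ∀ j, Mor (N j) M) : DGMod k where
  carrier := M ⧸ relSub φ
  gr n := (M.gr n).map (relSub φ).mkQ
  internal := by
    have key : ∀ n : ℤ, relSub φ ≤ (relSub φ).comap (M.proj n) := fun n =>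
      relSub_stable φ _ (fun j => (N j).proj n) fun j x => ((φ j).tw_comm _ x).symm
    refine internal_of_proj _ (fun n => (relSub φ).mapQ (relSub φ) (M.proj n) (key n)) ?_ ?_ ?_
    · rintro n _ ⟨x, hx, rfl⟩
      have := M.tw_mem (fun i => if i = n then 1 else 0) hx
      simp [proj, this]
    · rintro n j hj _ ⟨x, hx, rfl⟩
      have := M.tw_mem (fun i => if i = j then 1 else 0) hx
      simp [proj, this, hj.symm]
    · rw [← Submodule.map_iSup, iSup_gr, Submodule.map_top, Submodule.range_mkQ]
  d := (relSub φ).mapQ (relSub φ) M.d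
    (relSub_stable φ _ (fun j => (N j).d) fun j x => ((φ j).comm x).symm)
  d_mem := by
    rintro n _ ⟨x, hx, rfl⟩
    exact ⟨M.d x, M.d_mem hx, by simp⟩
  d_d := by
    intro x
    obtain ⟨x, rfl⟩ := Submodule.mkQ_surjective _ x
    simp [M.d_d]

section quot

variable {J : Type} {N : J → DGMod k} {M : DGMod k} (φ : ∀ j, Mor (N j) M)

def quotπ : Mor M (quot M φ) where
  lin := (relSub φ).mkQ
  mem := fun hx => ⟨_, hx, rfl⟩
  comm := fun _ => rfl

lemma quotπ_surj : Function.Surjective (quotπ φ).lin := Submodule.mkQ_surjective _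

lemma quotπ_rel (j : J) (x : N j) : (quotπ φ).lin ((φ j).lin x) = 0 := by
  exact (Submodule.Quotient.mk_eq_zero _).2 (mem_relSub φ j x)

/-- Linear maps out of the quotient. -/
def quotLift {V : Type*} [AddCommGroup V] [Module k V] (f : M →ₗ[k] V)
    (h : ∀ j x, f ((φ j).lin x) = 0) : quot M φ →ₗ[k] V :=
  (relSub φ).liftQ f (relSub_le φ f h)

@[simp] lemma quotLift_π {V : Type*} [AddCommGroup V] [Module k V] (f : M →ₗ[k] V)
    (h : ∀ j x, f ((φ j).lin x) = 0) (x : M) : quotLift φ f h ((quotπ φ).lin x) = f x := rfl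

lemma quot_ext {V : Type*} [AddCommGroup V] [Module k V] {f g : quot M φ →ₗ[k] V}
    (h : ∀ x, f ((quotπ φ).lin x) = g ((quotπ φ).lin x)) : f = g := by
  refine LinearMap.ext fun y => ?_
  obtain ⟨x, rfl⟩ := quotπ_surj φ y
  exact h x

end quot

/-! ### Tensor products -/

section tens2

variable (A B : DGMod k)

def tw2Aux (c : ℤ → ℤ → k) :
    (⨁ p : ℤ × ℤ, A.gr p.1 ⊗[k] B.gr p.2) →ₗ[k] A ⊗[k] B :=
  DirectSum.toModule k _ _ fun p =>
    c p.1 p.2 • TensorProduct.map (A.gr p.1).subtype (B.gr p.2).subtype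

/-- Multiply the component of bidegree `(i, j)` of `A ⊗ B` by the scalar `c i j`. -/
def tw2 (c : ℤ → ℤ → k) : A ⊗[k] B →ₗ[k] A ⊗[k] B :=
  tw2Aux A B c ∘ₗ
    (TensorProduct.directSum k k (fun i => A.gr i) (fun i => B.gr i)).toLinearMap ∘ₗ
      TensorProduct.map A.dec.toLinearMap B.dec.toLinearMap

lemma tw2_mem (c : ℤ → ℤ → k) {i j : ℤ} {a : A} {b : B} (ha : a ∈ A.gr i) (hb : b ∈ B.gr j) :
    tw2 A B c (a ⊗ₜ b) = c i j • a ⊗ₜ b := by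
  have := TensorProduct.directSum_lof_tmul_lof (R := k) (S := k) (M₁ := fun i => A.gr i)
    (M₂ := fun i => B.gr i) i ⟨a, ha⟩ j ⟨b, hb⟩
  simp only [tw2, LinearMap.comp_apply, TensorProduct.map_tmul, LinearEquiv.coe_coe,
    A.dec_mem ha, B.dec_mem hb]
  erw [this]
  simp [tw2Aux, DirectSum.toModule_lof]

lemma tens2_ext {V : Type*} [AddCommGroup V] [Module k V] {f g : A ⊗[k] B →ₗ[k] V}
    (h : ∀ i j, ∀ a ∈ A.gr i, ∀ b ∈ B.gr j, f (a ⊗ₜ b) = g (a ⊗ₜ b)) : f = g := by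
  refine TensorProduct.ext (A.hom_ext fun i a ha => B.hom_ext fun j b hb => ?_)
  exact h i j a ha b hb

/-- The degree `n` part of `A ⊗ B`. -/
def tens2gr (n : ℤ) : Submodule k (A ⊗[k] B) :=
  Submodule.span k {z | ∃ i j, ∃ a ∈ A.gr i, ∃ b ∈ B.gr j, i + j = n ∧ a ⊗ₜ b = z}

lemma tmul_mem {n i j : ℤ} {a : A} {b : B} (ha : a ∈ A.gr i) (hb : b ∈ B.gr j)
    (h : i + j = n) : a ⊗ₜ b ∈ tens2gr A B n :=
  Submodule.subset_span ⟨i, j, a, ha, b, hb, h, rfl⟩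

lemma tens2gr_le {n : ℤ} {S : Submodule k (A ⊗[k] B)}
    (h : ∀ i j, i + j = n → ∀ a ∈ A.gr i, ∀ b ∈ B.gr j, a ⊗ₜ b ∈ S) : tens2gr A B n ≤ S := by
  refine Submodule.span_le.2 ?_
  rintro _ ⟨i, j, a, ha, b, hb, hij, rfl⟩
  exact h i j hij a ha b hb

/-- The differential `d ⊗ 1 + 1 ⊗ d` of `A ⊗ B`, with the Koszul sign in the second term. -/
def tens2d : A ⊗[k] B →ₗ[k] A ⊗[k] B :=
  TensorProduct.map A.d LinearMap.id + TensorProduct.map (A.sgn 1) B.d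

/-- The tensor product of two complexes. -/
@[reducible] def tens2 : DGMod k where
  carrier := A ⊗[k] B
  gr := tens2gr A B
  internal := by
    refine internal_of_proj _ (fun n => tw2 A B fun i j => if i + j = n then 1 else 0) ?_ ?_ ?_
    · intro n x hx
      have : tens2gr A B n ≤ LinearMap.eqLocus
          (tw2 A B fun i j => if i + j = n then 1 else 0) LinearMap.id := by
        refine tens2gr_le A B fun i j h a ha b hb => ?_
        simp [LinearMap.mem_eqLocus, tw2_mem A B _ ha hb, h]
      exact this hx
    · intro n m hm x hx
      have : tens2gr A B n ≤ LinearMap.ker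
          (tw2 A B fun i j => if i + j = m then 1 else 0) := by
        refine tens2gr_le A B fun i j h a ha b hb => ?_
        rw [LinearMap.mem_ker, tw2_mem A B _ ha hb, if_neg (by omega), zero_smul]
      exact this hx
    · rw [← Submodule.ker_mkQ (⨆ n, tens2gr A B n), LinearMap.ker_eq_top]
      refine tens2_ext A B fun i j a ha b hb => ?_
      simp only [Submodule.mkQ_apply, LinearMap.zero_apply, Submodule.Quotient.mk_eq_zero]
      exact Submodule.mem_iSup_of_mem (i + j) (tmul_mem A B ha hb rfl)
  d := tens2d A B
  d_mem := by
    intro n x hx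
    have : tens2gr A B n ≤ (tens2gr A B (n - 1)).comap (tens2d A B) := by
      refine tens2gr_le A B fun i j h a ha b hb => ?_
      simp only [Submodule.mem_comap, tens2d, LinearMap.add_apply, TensorProduct.map_tmul,
        A.sgn_mem 1 ha, LinearMap.id_apply]
      refine Submodule.add_mem _ (tmul_mem A B (A.d_mem ha) hb (by omega)) ?_
      exact tmul_mem A B (Submodule.smul_mem _ _ ha) (B.d_mem hb) (by omega)
    exact this hx
  d_d := by
    have : tens2d A B ∘ₗ tens2d A B = 0 := by
      refine tens2_ext A B fun i j a ha b hb => ?_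
      simp only [tens2d, LinearMap.comp_apply, LinearMap.add_apply, TensorProduct.map_tmul,
        A.sgn_mem 1 ha, LinearMap.id_apply, map_add, A.d_d, B.d_d, map_smul,
        A.sgn_mem 1 (A.d_mem ha), TensorProduct.zero_tmul, TensorProduct.tmul_zero,
        LinearMap.zero_apply, zero_add, add_zero]
      rw [← TensorProduct.add_tmul, ← add_smul, sg_succ_add, zero_smul, TensorProduct.zero_tmul]
      have e2 : (2 : ZMod 2) = 0 := rfl
      push_cast
      linear_combination -e2
    exact LinearMap.congr_fun this

variable {A B}

def tens2Map {A' B' : DGMod k} (f : Mor A A') (g : Mor B B') : Mor (tens2 A B) (tens2 A' B') where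
  lin := TensorProduct.map f.lin g.lin
  mem := by
    intro n x hx
    have : tens2gr A B n ≤ (tens2gr A' B' n).comap (TensorProduct.map f.lin g.lin) :=
      tens2gr_le A B fun i j h a ha b hb => tmul_mem _ _ (f.mem ha) (g.mem hb) h
    exact this hx
  comm := by
    have : TensorProduct.map f.lin g.lin ∘ₗ tens2d A B
        = tens2d A' B' ∘ₗ TensorProduct.map f.lin g.lin := by
      refine tens2_ext A B fun i j a ha b hb => ?_
      simp [tens2d, f.comm, g.comm, A.sgn_mem 1 ha, A'.sgn_mem 1 (f.mem ha)]
    exact LinearMap.congr_fun this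

end tens2

/-! ### Koszul signs -/

section koszul

/-- The exponent of the Koszul sign for rearranging homogeneous elements of degrees `p i`,
`i : ι`, from the order given by the keys `a` to the order given by the keys `b`: the sum of
`p i * p j` over all pairs `i, j` that occur in opposite orders. -/
def kos {ι : Type} [Fintype ι] {α β : Type} [LinearOrder α] [LinearOrder β]
    (a : ι → α) (b : ι → β) (p : ι → ℤ) : ℤ :=
  ∑ i, ∑ j, if a i < a j ∧ b j < b i then p i * p j else 0

variable {ι : Type} [Fintype ι] {α β γ : Type} [LinearOrder α] [LinearOrder β] [LinearOrder γ]

lemma kos_trans {a : ι → α} {b : ι → β} {c : ι → γ} (ha : a.Injective) (hb : b.Injective)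
    (hc : c.Injective) (p : ι → ℤ) :
    ((kos a b p + kos b c p : ℤ) : ZMod 2) = (kos a c p : ℤ) := by
  rw [← sub_eq_zero, ← Int.cast_sub]
  simp only [kos, ← Finset.sum_add_distrib, ← Finset.sum_sub_distrib]
  rw [← Fintype.sum_prod_type']
  rw [Int.cast_sum]
  refine Finset.sum_involution (fun x _ => x.swap) ?_ ?_ (by simp) (by simp)
  · rintro ⟨i, j⟩ -
    rcases eq_or_ne i j with rfl | hij
    · simp
    have h1 := lt_or_gt_of_ne (ha.ne hij)
    have h2 := lt_or_gt_of_ne (hb.ne hij)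
    have h3 := lt_or_gt_of_ne (hc.ne hij)
    have e2 : (2 : ZMod 2) = 0 := rfl
    rcases h1 with h1 | h1 <;> rcases h2 with h2 | h2 <;> rcases h3 with h3 | h3 <;>
      simp [h1, h2, h3, h1.not_gt, h2.not_gt, h3.not_gt] <;> ring_nf <;> simp [e2]
  · rintro ⟨i, j⟩ - h h'
    obtain rfl : j = i := (Prod.ext_iff.1 h').1
    simp at h

lemma kos_equiv {ι' : Type} [Fintype ι'] (φ : ι' ≃ ι) (a : ι → α) (b : ι → β) (p : ι → ℤ) :
    kos (a ∘ φ) (b ∘ φ) (p ∘ φ) = kos a b p := by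
  simp only [kos, Function.comp]
  rw [← Equiv.sum_comp φ]
  refine Finset.sum_congr rfl fun i _ => ?_
  rw [← Equiv.sum_comp φ]

lemma kos_self (a : ι → α) (p : ι → ℤ) : kos a a p = 0 := by
  refine Finset.sum_eq_zero fun i _ => Finset.sum_eq_zero fun j _ => if_neg fun h => ?_
  exact lt_asymm h.1 h.2

lemma kos_congr {α' β' : Type} [LinearOrder α'] [LinearOrder β'] {a : ι → α} {b : ι → β}
    {a' : ι → α'} {b' : ι → β'} (ha : ∀ i j, a i < a j ↔ a' i < a' j)
    (hb : ∀ i j, b i < b j ↔ b' i < b' j) (p : ι → ℤ) : kos a b p = kos a' b' p := by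
  simp only [kos, ha, hb]

/-- Lowering one degree by one changes the sign by the number of odd degrees moved past. -/
lemma kos_update [DecidableEq ι] {a : ι → α} {b : ι → β} (ha : a.Injective) (hb : b.Injective)
    (p : ι → ℤ) (i : ι) :
    ((kos a b p + ∑ j, (if b j < b i then p j else 0) : ℤ) : ZMod 2) =
      ((∑ j, (if a j < a i then p j else 0)) + kos a b (Function.update p i (p i - 1)) : ℤ) := by
  have key : kos a b p - kos a b (Function.update p i (p i - 1)) =
      ∑ j, ((if a i < a j ∧ b j < b i then p j else 0) +
        (if a j < a i ∧ b i < b j then p j else 0)) := by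
    have : ∀ x y, ((if a x < a y ∧ b y < b x then p x * p y else 0) -
        (if a x < a y ∧ b y < b x then Function.update p i (p i - 1) x *
          Function.update p i (p i - 1) y else 0)) =
        (if x = i then (if a i < a y ∧ b y < b i then p y else 0) else 0) +
        (if y = i then (if a x < a i ∧ b i < b x then p x else 0) else 0) := by
      intro x y
      by_cases hx : x = i
      · subst hx
        by_cases hy : y = x
        · subst hy
          simp
        · simp only [hy, Function.update_self, Function.update_of_ne hy, if_true, if_false,
            add_zero]
          split_ifs <;> ring
      · by_cases hy : y = i
        · subst hy
          simp only [hx, Function.update_self, Function.update_of_ne hx, if_true, if_false,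
            zero_add]
          split_ifs <;> ring
        · simp [hx, hy]
    simp only [kos, ← Finset.sum_sub_distrib, this]
    simp only [Finset.sum_add_distrib, Finset.sum_ite_eq', Finset.mem_univ, if_true]
    congr 1
    rw [Finset.sum_comm]
    simp
  have key2 : ((kos a b p - kos a b (Function.update p i (p i - 1)) : ℤ) : ZMod 2) =
      ((∑ j, (if a j < a i then p j else 0)) + ∑ j, (if b j < b i then p j else 0) : ℤ) := by
    rw [key, ← Finset.sum_add_distrib, Int.cast_sum, Int.cast_sum]
    refine Finset.sum_congr rfl fun j _ => ?_
    have e2 : (2 : ZMod 2) = 0 := rfl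
    rcases eq_or_ne i j with rfl | hij
    · simp
    rcases lt_or_gt_of_ne (ha.ne hij) with h1 | h1 <;>
      rcases lt_or_gt_of_ne (hb.ne hij) with h2 | h2 <;>
      simp [h1, h2, h1.not_gt, h2.not_gt] <;> ring_nf <;> simp [e2]
  have e2 : (2 : ZMod 2) = 0 := rfl
  push_cast at key2 ⊢
  linear_combination key2 + (∑ j, (if b j < b i then (p j : ZMod 2) else 0)) * e2

end koszul

/-! ### Tensor products of finite families -/

section tens

open PiTensorProduct

section flat

variable {ι : Type} [Fintype ι] (M : ι → DGMod k)

/-- Multiply the component of multidegree `α` of `⨂ i, M i` by the scalar `c α`. -/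
def tensTw (c : (ι → ℤ) → k) : (⨂[k] i, M i) →ₗ[k] ⨂[k] i, M i :=
  letI : DecidableEq (ι → ℤ) := Classical.decEq _
  (DirectSum.toModule k (ι → ℤ) (⨂[k] i, M i) fun α =>
      c α • PiTensorProduct.map fun i => ((M i).gr (α i)).subtype) ∘ₗ
    (ofDirectSumEquiv (R := k) (M := fun i j => (M i).gr j)).toLinearMap ∘ₗ
      PiTensorProduct.map fun i => (M i).dec.toLinearMap

variable {M}

lemma tensTw_mem (c : (ι → ℤ) → k) {α : ι → ℤ} {x : ∀ i, M i} (hx : ∀ i, x i ∈ (M i).gr (α i)) :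
    tensTw M c (tprod k x) = c α • tprod k x := by
  let : DecidableEq (ι → ℤ) := Classical.decEq _
  have h1 : (fun i => (M i).dec (x i)) =
      fun i => DirectSum.lof k ℤ (fun j => (M i).gr j) (α i) ⟨x i, hx i⟩ := by
    funext i
    exact (M i).dec_mem (hx i)
  have h2 := ofDirectSumEquiv_tprod_lof (R := k) (M := fun i j => (M i).gr j) α
    (fun i => ⟨x i, hx i⟩)
  simp only [tensTw, LinearMap.comp_apply, PiTensorProduct.map_tprod, LinearEquiv.coe_coe, h1]
  erw [h2, DirectSum.toModule_lof]
  simp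

lemma tens_ext {V : Type*} [AddCommGroup V] [Module k V] {f g : (⨂[k] i, M i) →ₗ[k] V}
    (h : ∀ (α : ι → ℤ) (x : ∀ i, M i), (∀ i, x i ∈ (M i).gr (α i)) →
      f (tprod k x) = g (tprod k x)) : f = g := by
  refine PiTensorProduct.ext_of_span_eq_top (γ := fun i => Σ j : ℤ, (M i).gr j)
    (g := fun i z => (z.2 : M i)) (fun i => ?_) (fun j => h (fun i => (j i).1) _ fun i => (j i).2.2)
  rw [eq_top_iff, ← (M i).iSup_gr]
  exact iSup_le fun j x hx => Submodule.subset_span ⟨⟨j, x, hx⟩, rfl⟩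

end flat

variable {n : ℕ} (M : Fin n → DGMod k)

/-- The degree `m` part of a tensor product. -/
def tensGr (m : ℤ) : Submodule k (⨂[k] i, M i) :=
  Submodule.span k {z | ∃ (α : Fin n → ℤ) (x : ∀ i, M i),
    (∀ i, x i ∈ (M i).gr (α i)) ∧ ∑ i, α i = m ∧ tprod k x = z}

/-- The differential `∑ i, 1 ⊗ ⋯ ⊗ d ⊗ ⋯ ⊗ 1`, with Koszul signs. -/
def tensD : (⨂[k] i, M i) →ₗ[k] ⨂[k] i, M i :=
  ∑ i, PiTensorProduct.map fun j =>
    if j < i then (M j).sgn 1 else if j = i then (M j).d else LinearMap.id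

variable {M}

lemma tprod_mem {m : ℤ} {α : Fin n → ℤ} {x : ∀ i, M i} (hx : ∀ i, x i ∈ (M i).gr (α i))
    (h : ∑ i, α i = m) : tprod k x ∈ tensGr M m :=
  Submodule.subset_span ⟨α, x, hx, h, rfl⟩

lemma tensGr_le {m : ℤ} {S : Submodule k (⨂[k] i, M i)}
    (h : ∀ (α : Fin n → ℤ) (x : ∀ i, M i), (∀ i, x i ∈ (M i).gr (α i)) → ∑ i, α i = m →
      tprod k x ∈ S) : tensGr M m ≤ S := by
  refine Submodule.span_le.2 ?_
  rintro _ ⟨α, x, hx, hm, rfl⟩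
  exact h α x hx hm

lemma tensD_tprod {α : Fin n → ℤ} {x : ∀ i, M i} (hx : ∀ i, x i ∈ (M i).gr (α i)) :
    tensD M (tprod k x) = ∑ i, sg k (∑ j, if j < i then α j else 0) •
      tprod k (Function.update x i ((M i).d (x i))) := by
  rw [tensD, LinearMap.sum_apply]
  refine Finset.sum_congr rfl fun i _ => ?_
  rw [PiTensorProduct.map_tprod]
  have : (fun j => (if j < i then (M j).sgn 1 else if j = i then (M j).d else LinearMap.id)
      (x j)) = fun j => (if j < i then sg k (α j) else 1) •
        Function.update x i ((M i).d (x i)) j := by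
    funext j
    by_cases h1 : j < i
    · simp [h1, Function.update_of_ne h1.ne, (M j).sgn_mem 1 (hx j)]
    · by_cases h2 : j = i
      · subst h2
        simp
      · simp [h1, h2]
  rw [this, MultilinearMap.map_smul_univ]
  congr 1
  have hp : ∀ s : Finset (Fin n), sg k (∑ j ∈ s, if j < i then α j else 0) =
      ∏ j ∈ s, if j < i then sg k (α j) else 1 := by
    intro s
    induction s using Finset.cons_induction with
    | empty => simp
    | cons a s ha ih =>
      rw [Finset.sum_cons, Finset.prod_cons, sg_add, ih]
      split_ifs <;> simp
  exact (hp _).symm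

lemma update_mem {α : Fin n → ℤ} {x : ∀ i, M i} (hx : ∀ i, x i ∈ (M i).gr (α i)) (i : Fin n)
    (j : Fin n) : Function.update x i ((M i).d (x i)) j ∈
      (M j).gr (Function.update α i (α i - 1) j) := by
  by_cases h : j = i
  · subst h
    simpa using (M j).d_mem (hx j)
  · simpa [h] using hx j

variable (M) in
/-- The tensor product of a finite sequence of complexes. -/
@[reducible] def tens : DGMod k where
  carrier := ⨂[k] i, M i
  gr := tensGr M
  internal := by
    refine internal_of_proj _ (fun m => tensTw M fun α => if ∑ i, α i = m then 1 else 0) ?_ ?_ ?_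
    · intro m z hz
      have : tensGr M m ≤ LinearMap.eqLocus
          (tensTw M fun α => if ∑ i, α i = m then 1 else 0) LinearMap.id := by
        refine tensGr_le fun α x hx h => ?_
        simp [LinearMap.mem_eqLocus, tensTw_mem _ hx, h]
      exact this hz
    · intro m l hl z hz
      have : tensGr M m ≤ LinearMap.ker
          (tensTw M fun α => if ∑ i, α i = l then 1 else 0) := by
        refine tensGr_le fun α x hx h => ?_
        rw [LinearMap.mem_ker, tensTw_mem _ hx, if_neg (by omega), zero_smul]
      exact this hz
    · rw [← Submodule.ker_mkQ (⨆ m, tensGr M m), LinearMap.ker_eq_top]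
      refine tens_ext fun α x hx => ?_
      simp only [Submodule.mkQ_apply, LinearMap.zero_apply, Submodule.Quotient.mk_eq_zero]
      exact Submodule.mem_iSup_of_mem (∑ i, α i) (tprod_mem hx rfl)
  d := tensD M
  d_mem := by
    intro m z hz
    have : tensGr M m ≤ (tensGr M (m - 1)).comap (tensD M) := by
      refine tensGr_le fun α x hx h => ?_
      rw [Submodule.mem_comap, tensD_tprod hx]
      refine Submodule.sum_mem _ fun i _ => Submodule.smul_mem _ _ ?_
      refine tprod_mem (update_mem hx i) ?_
      rw [Finset.sum_update_of_mem (Finset.mem_univ i), ← h,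
        ← Finset.sum_sdiff (Finset.subset_univ {i})]
      simp
    exact this hz
  d_d := by
    have : tensD M ∘ₗ tensD M = 0 := by
      refine tens_ext fun α x hx => ?_
      rw [LinearMap.comp_apply, tensD_tprod hx, map_sum, LinearMap.zero_apply]
      simp only [map_smul, tensD_tprod (update_mem hx _), Finset.smul_sum]
      rw [← Fintype.sum_prod_type']
      refine Finset.sum_involution (fun x _ => x.swap) ?_ ?_ (by simp) (by simp)
      · rintro ⟨i, j⟩ -
        rcases eq_or_ne i j with rfl | hij
        · simp only [Prod.swap, Function.update_self, d_d, Function.update_idem]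
          rw [MultilinearMap.map_update_zero]
          simp
        · simp only [Prod.swap, Function.update_of_ne hij, Function.update_of_ne hij.symm]
          rw [Function.update_comm hij, smul_smul, smul_smul, ← add_smul, ← sg_add, ← sg_add,
            sg_succ_add, zero_smul]
          have hA : ∀ i j : Fin n, (∑ l, if l < j then Function.update α i (α i - 1) l else 0) =
              (∑ l, if l < j then α l else 0) - if i < j then 1 else 0 := by
            intro i j
            rw [eq_sub_iff_add_eq, ← Finset.sum_erase_add _ _ (Finset.mem_univ i),
              ← Finset.sum_erase_add (Finset.univ) (fun l => if l < j then α l else 0)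
                (Finset.mem_univ i), add_assoc]
            congr 1
            · refine Finset.sum_congr rfl fun l hl => ?_
              rw [Function.update_of_ne (Finset.ne_of_mem_erase hl)]
            · split_ifs <;> simp
          have e2 : (2 : ZMod 2) = 0 := rfl
          rw [hA, hA]
          rcases lt_or_gt_of_ne hij with h | h <;> simp [h, h.not_gt]
          · linear_combination -e2
          · ring
      · rintro ⟨i, j⟩ - h h'
        obtain rfl : j = i := (Prod.ext_iff.1 h').1
        simp only [Function.update_self, d_d, Function.update_idem] at h
        rw [MultilinearMap.map_update_zero] at h
        simp at h
    exact LinearMap.congr_fun this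

/-- Tensor product of morphisms. -/
def tensMap {N : Fin n → DGMod k} (f : ∀ i, Mor (M i) (N i)) : Mor (tens M) (tens N) where
  lin := PiTensorProduct.map fun i => (f i).lin
  mem := by
    intro m z hz
    have : tensGr M m ≤ (tensGr N m).comap (PiTensorProduct.map fun i => (f i).lin) := by
      refine tensGr_le fun α x hx h => ?_
      rw [Submodule.mem_comap, PiTensorProduct.map_tprod]
      exact tprod_mem (fun i => (f i).mem (hx i)) h
    exact this hz
  comm := by
    have : (PiTensorProduct.map fun i => (f i).lin) ∘ₗ tensD M =
        tensD N ∘ₗ PiTensorProduct.map fun i => (f i).lin := by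
      refine tens_ext fun α x hx => ?_
      simp only [LinearMap.comp_apply, tensD_tprod hx, map_sum, map_smul,
        PiTensorProduct.map_tprod, tensD_tprod (fun i => (f i).mem (hx i))]
      refine Finset.sum_congr rfl fun i _ => ?_
      congr 2
      funext j
      by_cases h : j = i
      · subst h
        simp [(f j).comm]
      · simp [h]
    exact LinearMap.congr_fun this

/-- The left action of a permutation on tensors, with Koszul signs:
`σ (x₁ ⊗ ⋯ ⊗ xₙ) = ± x_{σ⁻¹ 1} ⊗ ⋯ ⊗ x_{σ⁻¹ n}`. -/
def permLin (M : Fin n → DGMod k) (σ : Equiv.Perm (Fin n)) :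
    (⨂[k] i, M i) →ₗ[k] ⨂[k] i, M (σ.symm i) :=
  (reindex k (fun i => M i) σ).toLinearMap ∘ₗ tensTw M fun α => sg k (kos id σ α)

lemma permLin_tprod {α : Fin n → ℤ} {x : ∀ i, M i} (hx : ∀ i, x i ∈ (M i).gr (α i))
    (σ : Equiv.Perm (Fin n)) :
    permLin M σ (tprod k x) = sg k (kos id σ α) • tprod k fun i => x (σ.symm i) := by
  simp [permLin, tensTw_mem _ hx]

/-- The action of a permutation on tensors, as a morphism of complexes. -/
def perm (M : Fin n → DGMod k) (σ : Equiv.Perm (Fin n)) :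
    Mor (tens M) (tens fun i => M (σ.symm i)) where
  lin := permLin M σ
  mem := by
    intro m z hz
    have : tensGr M m ≤ (tensGr (fun i => M (σ.symm i)) m).comap (permLin M σ) := by
      refine tensGr_le fun α x hx h => ?_
      rw [Submodule.mem_comap, permLin_tprod hx]
      refine Submodule.smul_mem _ _ (tprod_mem (α := fun i => α (σ.symm i))
        (fun i => hx (σ.symm i)) ?_)
      rw [Equiv.sum_comp σ.symm α, h]
    exact this hz
  comm := by
    have : permLin M σ ∘ₗ tensD M = tensD (fun i => M (σ.symm i)) ∘ₗ permLin M σ := by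
      refine tens_ext fun α x hx => ?_
      rw [LinearMap.comp_apply, LinearMap.comp_apply, permLin_tprod hx, map_smul,
        tensD_tprod (M := fun i => M (σ.symm i)) (α := fun i => α (σ.symm i))
          (fun i => hx (σ.symm i)), tensD_tprod hx, map_sum, Finset.smul_sum]
      refine (Fintype.sum_equiv σ.symm _ _ fun i => ?_).symm
      rw [map_smul, permLin_tprod (update_mem hx _), smul_smul, smul_smul]
      congr 1
      · rw [← sg_add, ← sg_add]
        refine sg_congr k ?_
        have := kos_update Function.injective_id σ.injective α (σ.symm i)
        rw [← Equiv.sum_comp σ.symm] at this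
        simpa using this
      · congr 1
        funext j
        by_cases h : j = i
        · subst h
          simp
        · rw [Function.update_of_ne h, Function.update_of_ne (σ.symm.injective.ne h)]
    exact LinearMap.congr_fun this

end tens

/-! ### Morphisms out of sums and quotients -/

def dsumDesc {ι : Type} [DecidableEq ι] {M : ι → DGMod k} {B : DGMod k}
    (f : ∀ i, Mor (M i) B) : Mor (dsum M) B where
  lin := DirectSum.toModule k ι B fun i => (f i).lin
  mem := by
    classical
    intro n x hx
    rw [← DirectSum.sum_support_of x, map_sum]
    refine Submodule.sum_mem _ fun i _ => ?_
    rw [← DirectSum.lof_eq_of k, DirectSum.toModule_lof]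
    exact (f i).mem (hx i)
  comm := by
    have : (DirectSum.toModule k ι B fun i => (f i).lin) ∘ₗ (DirectSum.lmap fun i => (M i).d) =
        B.d ∘ₗ (DirectSum.toModule k ι B fun i => (f i).lin) := by
      refine DirectSum.linearMap_ext _ fun i => LinearMap.ext fun x => ?_
      simp [(f i).comm]
    exact LinearMap.congr_fun this

@[simp] lemma dsumDesc_ι {ι : Type} [DecidableEq ι] {M : ι → DGMod k} {B : DGMod k}
    (f : ∀ i, Mor (M i) B) (i : ι) (x : M i) :
    (dsumDesc f).lin ((dsumι M i).lin x) = (f i).lin x :=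
  DirectSum.toModule_lof ..

/-- Linear maps out of a direct sum. -/
def dsumLift {ι : Type} [DecidableEq ι] (M : ι → DGMod k) {V : Type*} [AddCommGroup V]
    [Module k V] (f : ∀ i, M i →ₗ[k] V) : dsum M →ₗ[k] V :=
  DirectSum.toModule k ι V f

@[simp] lemma dsumLift_ι {ι : Type} [DecidableEq ι] (M : ι → DGMod k) {V : Type*}
    [AddCommGroup V] [Module k V] (f : ∀ i, M i →ₗ[k] V) (i : ι) (x : M i) :
    dsumLift M f ((dsumι M i).lin x) = f i x :=
  DirectSum.toModule_lof ..

lemma dsum_ext {ι : Type} [DecidableEq ι] {M : ι → DGMod k} {V : Type*} [AddCommGroup V]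
    [Module k V] {f g : dsum M →ₗ[k] V}
    (h : ∀ i x, f ((dsumι M i).lin x) = g ((dsumι M i).lin x)) : f = g :=
  DirectSum.linearMap_ext _ fun i => LinearMap.ext fun x => h i x

def quotDesc {J : Type} {N : J → DGMod k} {M B : DGMod k} (φ : ∀ j, Mor (N j) M)
    (f : Mor M B) (h : ∀ j x, f.lin ((φ j).lin x) = 0) : Mor (quot M φ) B where
  lin := quotLift φ f.lin h
  mem := by
    rintro n _ ⟨x, hx, rfl⟩
    exact f.mem hx
  comm := by
    intro x
    obtain ⟨x, rfl⟩ := quotπ_surj φ x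
    rw [← (quotπ φ).comm, quotLift_π, quotLift_π, f.comm]

/-! ### Sums modulo relations -/

section glue

variable {ι J : Type} [DecidableEq ι] (M : ι → DGMod k) {N : J → DGMod k} {s t : J → ι}
  (a : ∀ j, Mor (N j) (M (s j))) (b : ∀ j, Mor (N j) (M (t j)))

/-- The direct sum of the complexes `M i` modulo the relations `a j x = b j x`. -/
def glue : DGMod k :=
  quot (dsum M) fun j => ((dsumι M (s j)).comp (a j)).sub ((dsumι M (t j)).comp (b j))

/-- The canonical map of a summand. -/
def glueι (i : ι) : Mor (M i) (glue M a b) := (quotπ _).comp (dsumι M i)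

lemma glue_rel (j : J) (x : N j) :
    (glueι M a b (s j)).lin ((a j).lin x) = (glueι M a b (t j)).lin ((b j).lin x) := by
  have := quotπ_rel (fun j => ((dsumι M (s j)).comp (a j)).sub ((dsumι M (t j)).comp (b j))) j x
  simp only [Mor.sub, LinearMap.sub_apply] at this
  exact sub_eq_zero.1 this

def glueLift {V : Type*} [AddCommGroup V] [Module k V] (f : ∀ i, M i →ₗ[k] V)
    (h : ∀ j x, f (s j) ((a j).lin x) = f (t j) ((b j).lin x)) : glue M a b →ₗ[k] V :=
  quotLift _ (dsumLift M f) (by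
    intro j x
    refine (map_sub _ _ _).trans (sub_eq_zero.2 ?_)
    exact (dsumLift_ι M f _ _).trans ((h j x).trans (dsumLift_ι M f _ _).symm))

lemma glueLift_ι {V : Type*} [AddCommGroup V] [Module k V] (f : ∀ i, M i →ₗ[k] V) (h)
    (i : ι) (x : M i) : glueLift M a b f h ((glueι M a b i).lin x) = f i x := by
  have : glueLift M a b f h ((glueι M a b i).lin x) = dsumLift M f ((dsumι M i).lin x) := rfl
  rw [this, dsumLift_ι]

variable {M a b} in
lemma glue_ext {V : Type*} [AddCommGroup V] [Module k V] {f g : glue M a b →ₗ[k] V}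
    (h : ∀ i x, f ((glueι M a b i).lin x) = g ((glueι M a b i).lin x)) : f = g := by
  refine quot_ext _ fun x => ?_
  have : f ∘ₗ (quotπ _).lin = g ∘ₗ (quotπ _).lin := dsum_ext h
  exact LinearMap.congr_fun this x

def glueDesc {B : DGMod k} (f : ∀ i, Mor (M i) B)
    (h : ∀ j x, (f (s j)).lin ((a j).lin x) = (f (t j)).lin ((b j).lin x)) :
    Mor (glue M a b) B :=
  quotDesc _ (dsumDesc f) (by
    intro j x
    refine (map_sub _ _ _).trans (sub_eq_zero.2 ?_)
    exact (dsumDesc_ι f _ _).trans ((h j x).trans (dsumDesc_ι f _ _).symm))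

lemma glueDesc_ι {B : DGMod k} (f : ∀ i, Mor (M i) B) (h) (i : ι) (x : M i) :
    (glueDesc M a b f h).lin ((glueι M a b i).lin x) = (f i).lin x := by
  have : (glueDesc M a b f h).lin ((glueι M a b i).lin x) =
    (dsumDesc f).lin ((dsumι M i).lin x) := rfl
  rw [this, dsumDesc_ι]

end glue

/-! ### More on permutations of tensors -/

section perm

open PiTensorProduct

variable {n : ℕ}

lemma perm_tprod {M : Fin n → DGMod k} {α : Fin n → ℤ} {x : ∀ i, M i}
    (hx : ∀ i, x i ∈ (M i).gr (α i)) (σ : Equiv.Perm (Fin n)) :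
    (perm M σ).lin (tprod k x) = sg k (kos id σ α) • tprod k fun i => x (σ.symm i) :=
  permLin_tprod hx σ

lemma perm_tensMap {M N : Fin n → DGMod k} (f : ∀ i, Mor (M i) (N i)) (σ : Equiv.Perm (Fin n))
    (x : ⨂[k] i, M i) : (perm N σ).lin ((tensMap f).lin x) =
      (tensMap fun i => f (σ.symm i)).lin ((perm M σ).lin x) := by
  have : (perm N σ).lin ∘ₗ (tensMap f).lin =
      (tensMap fun i => f (σ.symm i)).lin ∘ₗ (perm M σ).lin := by
    refine tens_ext fun α x hx => ?_
    simp only [LinearMap.comp_apply, perm_tprod hx, map_smul]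
    simp only [tensMap, PiTensorProduct.map_tprod]
    rw [perm_tprod fun i => (f i).mem (hx i)]
  exact LinearMap.congr_fun this x

/-- The tensor power `A^{⊗n}`. -/
@[reducible] def tpow (A : DGMod k) (n : ℕ) : DGMod k := tens fun _ : Fin n => A

lemma perm_mul (A : DGMod k) (σ τ : Equiv.Perm (Fin n)) (x : tpow A n) :
    (perm (fun _ => A) (σ * τ)).lin x =
      (perm (fun _ => A) σ).lin ((perm (fun _ => A) τ).lin x) := by
  have : (perm (fun _ => A) (σ * τ)).lin =
      (perm (fun _ => A) σ).lin ∘ₗ (perm (fun _ => A) τ).lin := by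
    refine tens_ext fun α x hx => ?_
    simp only [LinearMap.comp_apply, perm_tprod hx, map_smul]
    rw [perm_tprod (M := fun _ => A) (α := fun i => α (τ.symm i)) fun i => hx (τ.symm i),
      smul_smul, ← sg_add]
    congr 1
    refine sg_congr k ?_
    rw [← kos_trans Function.injective_id τ.injective (σ * τ).injective,
      ← kos_equiv τ id σ (fun i => α (τ.symm i))]
    simp [Function.comp_def]
  exact LinearMap.congr_fun this x

lemma perm_one (A : DGMod k) (x : tpow A n) :
    (perm (fun _ => A) (1 : Equiv.Perm (Fin n))).lin x = x := by
  have : (perm (fun _ => A) (1 : Equiv.Perm (Fin n))).lin = LinearMap.id := by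
    refine tens_ext fun α x hx => ?_
    rw [perm_tprod hx, Equiv.Perm.coe_one, kos_self, sg_zero, one_smul]
    rfl
  exact LinearMap.congr_fun this x

end perm

end DGMod

open DGMod

/-! ### Symmetric sequences and Schur functors -/

variable {k : Type u} [CommRing k]

/-- A symmetric sequence: chain complexes `O(n)` with a right action of the symmetric group. -/
structure SymSeq (k : Type u) [CommRing k] where
  obj : ℕ → DGMod k
  act : ∀ {n : ℕ}, Equiv.Perm (Fin n) → Mor (obj n) (obj n)
  act_one : ∀ {n : ℕ} (x : obj n), (act 1).lin x = x
  act_mul : ∀ {n : ℕ} (σ τ : Equiv.Perm (Fin n)) (x : obj n),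
    (act (σ * τ)).lin x = (act τ).lin ((act σ).lin x)

namespace SymSeq

/-- A morphism of symmetric sequences. -/
structure Hom (O P : SymSeq k) where
  app : ∀ n, Mor (O.obj n) (P.obj n)
  equivariant : ∀ {n : ℕ} (σ : Equiv.Perm (Fin n)) (x : O.obj n),
    (app n).lin ((O.act σ).lin x) = (P.act σ).lin ((app n).lin x)

def Hom.id (O : SymSeq k) : Hom O O := ⟨fun _ => Mor.id _, fun _ _ => rfl⟩

section schur

variable (O : SymSeq k) (A : DGMod k)

/-- The summand `O(n) ⊗ A^{⊗n}`. -/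
@[reducible] def schurM (n : ℕ) : DGMod k := tens2 (O.obj n) (tpow A n)

def schurRelL (j : Σ n, Equiv.Perm (Fin n)) : Mor (schurM O A j.1) (schurM O A j.1) :=
  tens2Map (O.act j.2) (Mor.id (tpow A j.1))

def schurRelR (j : Σ n, Equiv.Perm (Fin n)) : Mor (schurM O A j.1) (schurM O A j.1) :=
  tens2Map (Mor.id (O.obj j.1)) (perm (fun _ => A) j.2)

/-- The Schur functor `O[A] = ⨁ n, O(n) ⊗_{Σₙ} A^{⊗n}`: the direct sum of the complexes
`O(n) ⊗ A^{⊗n}` modulo the relations `oσ ⊗ x = o ⊗ σx`. -/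
def schur : DGMod k := glue (schurM O A) (schurRelL O A) (schurRelR O A)

/-- The canonical map `O(n) ⊗ A^{⊗n} → O[A]`. -/
def schurι (n : ℕ) : Mor (schurM O A n) (schur O A) :=
  glueι (schurM O A) (schurRelL O A) (schurRelR O A) n

variable {O A}

lemma schurι_rel {n : ℕ} (σ : Equiv.Perm (Fin n)) (o : O.obj n) (x : tpow A n) :
    (schurι O A n).lin ((O.act σ).lin o ⊗ₜ x) =
      (schurι O A n).lin (o ⊗ₜ (perm (fun _ => A) σ).lin x) :=
  glue_rel (schurM O A) (schurRelL O A) (schurRelR O A) ⟨n, σ⟩ (o ⊗ₜ x)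

/-- Linear maps out of `O[A]`. -/
def schurLift {V : Type*} [AddCommGroup V] [Module k V]
    (f : ∀ n, O.obj n ⊗[k] tpow A n →ₗ[k] V)
    (h : ∀ n (σ : Equiv.Perm (Fin n)) (o : O.obj n) (x : tpow A n),
      f n ((O.act σ).lin o ⊗ₜ x) = f n (o ⊗ₜ (perm (fun _ => A) σ).lin x)) :
    schur O A →ₗ[k] V :=
  glueLift (schurM O A) (schurRelL O A) (schurRelR O A) f (by
    rintro ⟨n, σ⟩ x
    have : f n ∘ₗ TensorProduct.map (O.act σ).lin LinearMap.id =
        f n ∘ₗ TensorProduct.map LinearMap.id (perm (fun _ => A) σ).lin :=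
      TensorProduct.ext' fun o x => h n σ o x
    exact LinearMap.congr_fun this x)

lemma schurLift_ι {V : Type*} [AddCommGroup V] [Module k V]
    (f : ∀ n, O.obj n ⊗[k] tpow A n →ₗ[k] V) (h) (n : ℕ) (x : O.obj n ⊗[k] tpow A n) :
    schurLift f h ((schurι O A n).lin x) = f n x :=
  glueLift_ι (schurM O A) (schurRelL O A) (schurRelR O A) f _ n x

end schur

/-- The effect `⨁ 1 ⊗ fₙ` of the extended Schur functor on a sequence of equivariant maps
`fₙ : A^{⊗n} → B^{⊗n}` of degree `deg`, with the Koszul sign `(-1)^(deg * |o|)`. -/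
def schurThick (O : SymSeq k) {A B : DGMod k} (deg : ℤ) (f : ∀ n, tpow A n →ₗ[k] tpow B n)
    (hf : ∀ n (σ : Equiv.Perm (Fin n)) (x : tpow A n),
      f n ((perm (fun _ => A) σ).lin x) = (perm (fun _ => B) σ).lin (f n x)) :
    schur O A →ₗ[k] schur O B :=
  schurLift (fun n => (schurι O B n).lin ∘ₗ TensorProduct.map ((O.obj n).sgn deg) (f n)) (by
    intro n σ o x
    have := (O.act σ).tw_comm (fun i => sg k (deg * i)) o
    simp only [LinearMap.comp_apply, TensorProduct.map_tmul, hf, sgn, ← this]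
    exact schurι_rel _ _ _)

/-- The Schur functor on morphisms of complexes. -/
def schurMap (O : SymSeq k) {A B : DGMod k} (f : Mor A B) : schur O A →ₗ[k] schur O B :=
  schurThick O 0 (fun n => (tensMap fun _ : Fin n => f).lin)
    fun _ σ x => (perm_tensMap (fun _ => f) σ x).symm

/-- The Schur functor on morphisms of symmetric sequences. -/
def schurSeq {O P : SymSeq k} (φ : Hom O P) (A : DGMod k) : schur O A →ₗ[k] schur P A :=
  schurLift (fun n => (schurι P A n).lin ∘ₗ TensorProduct.map (φ.app n).lin LinearMap.id) (by
    intro n σ o x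
    simp only [LinearMap.comp_apply, TensorProduct.map_tmul, φ.equivariant, LinearMap.id_apply]
    exact schurι_rel _ _ _)

end SymSeq

/-! ### The composition product of symmetric sequences -/

namespace SymSeq

/-- The index set for the summands of `(O ∘ P)(m)`: a number `n`, arities `r i` for `i : Fin n`,
and a labelling of the `r 1 + ⋯ + r n` inputs by `Fin m`. -/
structure CompIdx (m : ℕ) where
  n : ℕ
  r : Fin n → ℕ
  e : (Σ i, Fin (r i)) ≃ Fin m

instance (m : ℕ) : DecidableEq (CompIdx m) := Classical.decEq _

namespace CompIdx

variable {m : ℕ}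

/-- Permuting the `n` blocks. -/
@[reducible] def slide (c : CompIdx m) (τ : Equiv.Perm (Fin c.n)) : CompIdx m where
  n := c.n
  r i := c.r (τ.symm i)
  e := (Equiv.sigmaCongrLeft (β := fun i => Fin (c.r i)) τ.symm).trans c.e

/-- Permuting the inputs within each block. -/
@[reducible] def block (c : CompIdx m) (τ : ∀ i, Equiv.Perm (Fin (c.r i))) : CompIdx m where
  n := c.n
  r := c.r
  e := (Equiv.sigmaCongrRight fun i => (τ i).symm).trans c.e

/-- Renaming the labels. -/
@[reducible] def relabel {m' : ℕ} (c : CompIdx m) (σ : Fin m ≃ Fin m') : CompIdx m' where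
  n := c.n
  r := c.r
  e := c.e.trans σ

end CompIdx

section comp

variable (O P : SymSeq k) (m : ℕ)

/-- The summand `O(n) ⊗ P(r₁) ⊗ ⋯ ⊗ P(rₙ)`. -/
@[reducible] def compM {m : ℕ} (c : CompIdx m) : DGMod k :=
  tens2 (O.obj c.n) (tens fun i => P.obj (c.r i))

/-- The index set of the relations: permutations of the blocks and permutations within the
blocks. -/
abbrev CompRel : Type :=
  (Σ c : CompIdx m, Equiv.Perm (Fin c.n)) ⊕ (Σ c : CompIdx m, ∀ i, Equiv.Perm (Fin (c.r i)))

@[reducible] def compSrc : CompRel m → CompIdx m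
  | .inl j => j.1
  | .inr j => j.1

@[reducible] def compTgt : CompRel m → CompIdx m
  | .inl j => j.1.slide j.2
  | .inr j => j.1.block j.2

/-- The left hand sides `oτ ⊗ x` and `o ⊗ (x₁τ₁ ⊗ ⋯ ⊗ xₙτₙ)` of the relations. -/
def compRelL : ∀ j : CompRel m, Mor (compM O P (compSrc m j)) (compM O P (compSrc m j))
  | .inl j => tens2Map (O.act j.2) (Mor.id _)
  | .inr j => tens2Map (Mor.id _) (tensMap fun i => P.act (j.2 i))

/-- The right hand sides `o ⊗ τx` and `o ⊗ x` of the relations. -/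
def compRelR : ∀ j : CompRel m, Mor (compM O P (compSrc m j)) (compM O P (compTgt m j))
  | .inl j => tens2Map (Mor.id _) (perm _ j.2)
  | .inr j => Mor.id (compM O P j.1)

/-- The complex `(O ∘ P)(m) = ⨁ n, O(n) ⊗_{Σₙ} P^{⊗n}(m)`, where `P^{⊗n}(m)` is the sum over
`r : Fin n → ℕ` of the representations induced from `Σ_{r₁} × ⋯ × Σ_{rₙ}` to `Σₘ` by
`P(r₁) ⊗ ⋯ ⊗ P(rₙ)`. The induced representation is written as the sum over all bijections
`e : (Σ i, Fin (r i)) ≃ Fin m` modulo the action of `Σ_{r₁} × ⋯ × Σ_{rₙ}`; such bijections exist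
only if `r₁ + ⋯ + rₙ = m`. -/
def compObj : DGMod k := glue (compM O P (m := m)) (compRelL O P m) (compRelR O P m)

variable {m}

/-- The canonical map of the summand with index `c`. -/
def compι (c : CompIdx m) : Mor (compM O P c) (compObj O P m) :=
  glueι (compM O P (m := m)) (compRelL O P m) (compRelR O P m) c

variable {O P}

lemma compι_slide (c : CompIdx m) (τ : Equiv.Perm (Fin c.n)) (o : O.obj c.n)
    (x : ⨂[k] i, P.obj (c.r i)) :
    (compι O P c).lin ((O.act τ).lin o ⊗ₜ x) =
      (compι O P (c.slide τ)).lin (o ⊗ₜ (perm (fun i => P.obj (c.r i)) τ).lin x) :=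
  glue_rel (compM O P (m := m)) (compRelL O P m) (compRelR O P m) (.inl ⟨c, τ⟩) (o ⊗ₜ x)

lemma compι_block (c : CompIdx m) (τ : ∀ i, Equiv.Perm (Fin (c.r i))) (o : O.obj c.n)
    (x : ⨂[k] i, P.obj (c.r i)) :
    (compι O P c).lin (o ⊗ₜ (tensMap fun i => P.act (τ i)).lin x) =
      (compι O P (c.block τ)).lin (o ⊗ₜ x) :=
  glue_rel (compM O P (m := m)) (compRelL O P m) (compRelR O P m) (.inr ⟨c, τ⟩) (o ⊗ₜ x)

/-- Linear maps out of `(O ∘ P)(m)`. -/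
def compLift {V : Type*} [AddCommGroup V] [Module k V]
    (f : ∀ c : CompIdx m, O.obj c.n ⊗[k] (⨂[k] i, P.obj (c.r i)) →ₗ[k] V)
    (h1 : ∀ (c : CompIdx m) (τ : Equiv.Perm (Fin c.n)) (o : O.obj c.n)
      (x : ⨂[k] i, P.obj (c.r i)), f c ((O.act τ).lin o ⊗ₜ x) =
        f (c.slide τ) (o ⊗ₜ (perm (fun i => P.obj (c.r i)) τ).lin x))
    (h2 : ∀ (c : CompIdx m) (τ : ∀ i, Equiv.Perm (Fin (c.r i))) (o : O.obj c.n)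
      (x : ⨂[k] i, P.obj (c.r i)), f c (o ⊗ₜ (tensMap fun i => P.act (τ i)).lin x) =
        f (c.block τ) (o ⊗ₜ x)) :
    compObj O P m →ₗ[k] V :=
  glueLift (compM O P (m := m)) (compRelL O P m) (compRelR O P m) f (by
    rintro (⟨c, τ⟩ | ⟨c, τ⟩) x
    · have : f c ∘ₗ TensorProduct.map (O.act τ).lin LinearMap.id =
          f (c.slide τ) ∘ₗ TensorProduct.map LinearMap.id
            (perm (fun i => P.obj (c.r i)) τ).lin :=
        TensorProduct.ext' fun o x => h1 c τ o x
      exact LinearMap.congr_fun this x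
    · have : f c ∘ₗ TensorProduct.map LinearMap.id (tensMap fun i => P.act (τ i)).lin =
          f (c.block τ) :=
        TensorProduct.ext' fun o x => h2 c τ o x
      exact LinearMap.congr_fun this x)

lemma compLift_ι {V : Type*} [AddCommGroup V] [Module k V]
    (f : ∀ c : CompIdx m, O.obj c.n ⊗[k] (⨂[k] i, P.obj (c.r i)) →ₗ[k] V) (h1) (h2)
    (c : CompIdx m) (x : O.obj c.n ⊗[k] (⨂[k] i, P.obj (c.r i))) :
    compLift f h1 h2 ((compι O P c).lin x) = f c x :=
  glueLift_ι (compM O P (m := m)) (compRelL O P m) (compRelR O P m) f _ c x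

lemma comp_ext {V : Type*} [AddCommGroup V] [Module k V] {f g : compObj O P m →ₗ[k] V}
    (h : ∀ c (o : O.obj c.n) (x : ⨂[k] i, P.obj (c.r i)),
      f ((compι O P c).lin (o ⊗ₜ x)) = g ((compι O P c).lin (o ⊗ₜ x))) : f = g := by
  refine glue_ext fun c x => ?_
  have : f ∘ₗ (compι O P c).lin = g ∘ₗ (compι O P c).lin := TensorProduct.ext' fun o x => h c o x
  exact LinearMap.congr_fun this x

variable (O P) in
/-- The right action of a bijection of labels on `O ∘ P`. -/
def compTr {m' : ℕ} (σ : Fin m' ≃ Fin m) : Mor (compObj O P m) (compObj O P m') :=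
  glueDesc (compM O P (m := m)) (compRelL O P m) (compRelR O P m)
    (fun c => compι O P (c.relabel σ.symm)) (by
      rintro (⟨c, τ⟩ | ⟨c, τ⟩) x
      · exact glue_rel (compM O P (m := m')) (compRelL O P m') (compRelR O P m')
          (.inl ⟨c.relabel σ.symm, τ⟩) x
      · exact glue_rel (compM O P (m := m')) (compRelL O P m') (compRelR O P m')
          (.inr ⟨c.relabel σ.symm, τ⟩) x)

lemma compTr_ι {m' : ℕ} (σ : Fin m' ≃ Fin m) (c : CompIdx m) (x : compM O P c) :
    (compTr O P σ).lin ((compι O P c).lin x) = (compι O P (c.relabel σ.symm)).lin x :=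
  glueDesc_ι (compM O P (m := m)) (compRelL O P m) (compRelR O P m) _ _ c x

variable (O P) in
/-- The composition product `O ∘ P` of symmetric sequences. -/
def comp : SymSeq k where
  obj m := compObj O P m
  act σ := compTr O P σ
  act_one := by
    intro m x
    have : (compTr O P (1 : Equiv.Perm (Fin m))).lin = LinearMap.id :=
      comp_ext fun c o x => compTr_ι _ _ _
    exact LinearMap.congr_fun this x
  act_mul := by
    intro m σ τ x
    have : (compTr O P (σ * τ)).lin = (compTr O P τ).lin ∘ₗ (compTr O P σ).lin := by
      refine comp_ext fun c o x => ?_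
      rw [LinearMap.comp_apply, compTr_ι, compTr_ι, compTr_ι]
      rfl
    exact LinearMap.congr_fun this x

/-- The map `φ ∘ ψ : O ∘ P → O' ∘ P'` induced by morphisms `φ : O → O'` and `ψ : P → P'`. -/
def compMap {O' P' : SymSeq k} (φ : Hom O O') (ψ : Hom P P') (m : ℕ) :
    compObj O P m →ₗ[k] compObj O' P' m :=
  compLift (fun c => (compι O' P' c).lin ∘ₗ TensorProduct.map (φ.app c.n).lin
      (tensMap fun i => ψ.app (c.r i)).lin)
    (by
      intro c τ o x
      simp only [LinearMap.comp_apply, TensorProduct.map_tmul, φ.equivariant]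
      rw [compι_slide, perm_tensMap])
    (by
      intro c τ o x
      simp only [LinearMap.comp_apply, TensorProduct.map_tmul]
      rw [← compι_block]
      congr 2
      have : (tensMap fun i => ψ.app (c.r i)).lin ∘ₗ (tensMap fun i => P.act (τ i)).lin =
          (tensMap fun i => P'.act (τ i)).lin ∘ₗ (tensMap fun i => ψ.app (c.r i)).lin := by
        refine tens_ext fun α x hx => ?_
        simp [tensMap, PiTensorProduct.map_tprod, ψ.equivariant]
      exact LinearMap.congr_fun this x)

end comp

end SymSeq

/-! ### Distributing tensor factors over blocks -/

section blocks

variable {n : ℕ} {κ : Fin n → Type} [∀ i, Fintype (κ i)]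

lemma kos_block_out {α β : Type} [LinearOrder α] [LinearOrder β] {a : Fin n → α} {b : Fin n → β}
    (ha : a.Injective) (hb : b.Injective) (c : (Σ i, κ i) → ℕ) (p : (Σ i, κ i) → ℤ) :
    kos (fun x => toLex (a x.1, c x)) (fun x => toLex (b x.1, c x)) p =
      kos a b fun i => ∑ j, p ⟨i, j⟩ := by
  simp only [kos, Fintype.sum_sigma]
  refine Finset.sum_congr rfl fun i _ => ?_
  rw [Finset.sum_comm]
  refine Finset.sum_congr rfl fun i' _ => ?_
  have key : ∀ (j : κ i) (j' : κ i'), (toLex (a i, c ⟨i, j⟩) < toLex (a i', c ⟨i', j'⟩) ∧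
      toLex (b i', c ⟨i', j'⟩) < toLex (b i, c ⟨i, j⟩)) ↔ (a i < a i' ∧ b i' < b i) := by
    intro j j'
    simp only [Prod.Lex.toLex_lt_toLex]
    rcases eq_or_ne i i' with rfl | h
    · simp only [lt_irrefl, false_or, true_and, false_and, iff_false, not_and]
      exact fun h1 h2 => lt_asymm h1 h2
    · simp [ha.ne h, (hb.ne h).symm]
  simp only [key]
  by_cases h : a i < a i' ∧ b i' < b i
  · simp only [if_pos h, Finset.sum_mul_sum]
  · simp [if_neg h]

lemma kos_block_in {α : Type} [LinearOrder α] {a : Fin n → α} (ha : a.Injective)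
    (c c' : (Σ i, κ i) → ℕ) (p : (Σ i, κ i) → ℤ) :
    kos (fun x => toLex (a x.1, c x)) (fun x => toLex (a x.1, c' x)) p =
      ∑ i, kos (fun j => c ⟨i, j⟩) (fun j => c' ⟨i, j⟩) fun j => p ⟨i, j⟩ := by
  simp only [kos, Fintype.sum_sigma]
  refine Finset.sum_congr rfl fun i _ => Finset.sum_congr rfl fun j _ => ?_
  rw [Finset.sum_eq_single i]
  · refine Finset.sum_congr rfl fun j' _ => ?_
    simp [Prod.Lex.toLex_lt_toLex]
  · intro i' _ hi
    refine Finset.sum_eq_zero fun j' _ => if_neg ?_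
    have := ha.ne hi
    simp only [Prod.Lex.toLex_lt_toLex]
    rintro ⟨h1 | h1, h2 | h2⟩
    · exact lt_asymm h1 h2
    · exact this h2.1
    · exact this h1.1.symm
    · exact this h2.1
  · simp

end blocks

section distr

open PiTensorProduct

variable {n m : ℕ} {r : Fin n → ℕ}

/-- The order in which the factors `x₁, …, xₙ, y₁, …, yₘ` are given. -/
def srcKey (z : Fin n ⊕ Fin m) : Fin n ⊕ₗ Fin m := toLex z

/-- The order in which `yₗ` is moved to position `j` of block `i`, where `l = e (i, j)`, and `xᵢ`
is moved to the beginning of block `i`. -/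
def tgtKey (e : (Σ i, Fin (r i)) ≃ Fin m) : Fin n ⊕ Fin m → Fin n ×ₗ ℕ
  | .inl i => toLex (i, 0)
  | .inr l => toLex ((e.symm l).1, (e.symm l).2.val + 1)

/-- The family consisting of the `X i` and the `Y l`. -/
@[reducible] def joinFam (X : Fin n → DGMod k) (Y : Fin m → DGMod k) : Fin n ⊕ Fin m → DGMod k
  | .inl i => X i
  | .inr l => Y l

/-- Group the factors of a tensor product according to `e`. -/
def regroup (Y : Fin m → DGMod k) (e : (Σ i, Fin (r i)) ≃ Fin m) :
    (⨂[k] l, Y l) →ₗ[k] ⨂[k] i, ⨂[k] j, Y (e ⟨i, j⟩) :=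
  PiTensorProduct.lift ((PiTensorProduct.tprod k).compMultilinearMap fun i =>
      PiTensorProduct.tprod k (s := fun j : Fin (r i) => Y (e ⟨i, j⟩))) ∘ₗ
    (reindex k (fun l => Y l) e.symm).toLinearMap

lemma regroup_tprod (Y : Fin m → DGMod k) (e : (Σ i, Fin (r i)) ≃ Fin m) (y : ∀ l, Y l) :
    regroup Y e (PiTensorProduct.tprod k y) = PiTensorProduct.tprod k fun i => PiTensorProduct.tprod k fun j => y (e ⟨i, j⟩) := by
  simp only [regroup, LinearMap.comp_apply, LinearEquiv.coe_coe, reindex_tprod, lift.tprod]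
  rfl

variable {X : Fin n → DGMod k} {Y : Fin m → DGMod k} {Z : Fin n → DGMod k}

/-- The map `x₁ ⊗ ⋯ ⊗ xₙ, y₁ ⊗ ⋯ ⊗ yₘ ↦ ± g₁(x₁, y_{e(1,1)} ⊗ y_{e(1,2)} ⊗ ⋯) ⊗ ⋯`, where the
sign is the Koszul sign for moving the factors to their new positions. -/
def distr (X : Fin n → DGMod k) (Y : Fin m → DGMod k) (e : (Σ i, Fin (r i)) ≃ Fin m)
    (g : ∀ i, X i →ₗ[k] (⨂[k] j, Y (e ⟨i, j⟩)) →ₗ[k] Z i) :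
    (⨂[k] i, X i) →ₗ[k] (⨂[k] l, Y l) →ₗ[k] ⨂[k] i, Z i :=
  TensorProduct.curry (TensorProduct.lift ((map₂ g).compl₂ (regroup Y e)) ∘ₗ
    (tmulEquivDep k fun z => joinFam X Y z).symm.toLinearMap ∘ₗ
      tensTw (joinFam X Y) (fun α => sg k (kos srcKey (tgtKey e) α)) ∘ₗ
        (tmulEquivDep k fun z => joinFam X Y z).toLinearMap)

lemma distr_tprod (e : (Σ i, Fin (r i)) ≃ Fin m)
    (g : ∀ i, X i →ₗ[k] (⨂[k] j, Y (e ⟨i, j⟩)) →ₗ[k] Z i) {α : Fin n → ℤ} {β : Fin m → ℤ}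
    {x : ∀ i, X i} {y : ∀ l, Y l} (hx : ∀ i, x i ∈ (X i).gr (α i))
    (hy : ∀ l, y l ∈ (Y l).gr (β l)) :
    distr X Y e g (PiTensorProduct.tprod k x) (PiTensorProduct.tprod k y) =
      sg k (kos srcKey (tgtKey e) (Sum.elim α β)) •
        PiTensorProduct.tprod k fun i => g i (x i) (PiTensorProduct.tprod k fun j => y (e ⟨i, j⟩)) := by
  have h1 := tmulEquivDep_apply (R := k) (fun z => (joinFam X Y z : Type u)) x y
  have h2 := tensTw_mem (M := joinFam X Y) (fun α => sg k (kos srcKey (tgtKey e) α))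
    (α := Sum.elim α β) (x := fun z => Sum.rec x y z) (by
      rintro (i | l)
      · exact hx i
      · exact hy l)
  have h3 := tmulEquivDep_symm_apply (R := k) (fun z => (joinFam X Y z : Type u))
    (fun z => Sum.rec x y z)
  have h4 : distr X Y e g (PiTensorProduct.tprod k x) (PiTensorProduct.tprod k y) =
      TensorProduct.lift ((map₂ g).compl₂ (regroup Y e))
        ((tmulEquivDep k fun z => (joinFam X Y z : Type u)).symm
          (tensTw (joinFam X Y) (fun α => sg k (kos srcKey (tgtKey e) α))
            (tmulEquivDep k (fun z => (joinFam X Y z : Type u))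
              (PiTensorProduct.tprod k x ⊗ₜ PiTensorProduct.tprod k y)))) := rfl
  refine h4.trans ?_
  refine (congrArg (fun z => TensorProduct.lift ((map₂ g).compl₂ (regroup Y e))
        ((tmulEquivDep k fun z => (joinFam X Y z : Type u)).symm
          (tensTw (joinFam X Y) (fun α => sg k (kos srcKey (tgtKey e) α)) z))) h1).trans ?_
  refine (congrArg (fun z => TensorProduct.lift ((map₂ g).compl₂ (regroup Y e))
        ((tmulEquivDep k fun z => (joinFam X Y z : Type u)).symm z)) h2).trans ?_
  refine (congrArg (TensorProduct.lift ((map₂ g).compl₂ (regroup Y e)))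
    (map_smul _ _ _)).trans ((map_smul _ _ _).trans (congrArg _ ?_))
  refine (congrArg (TensorProduct.lift ((map₂ g).compl₂ (regroup Y e))) h3).trans ?_
  simp only [TensorProduct.lift.tmul, LinearMap.compl₂_apply, regroup_tprod]
  exact map₂_tprod_tprod _ _ _


lemma distr_ext {V : Type*} [AddCommGroup V] [Module k V]
    {f f' : (⨂[k] i, X i) →ₗ[k] (⨂[k] l, Y l) →ₗ[k] V}
    (h : ∀ (α : Fin n → ℤ) (β : Fin m → ℤ) (x : ∀ i, X i) (y : ∀ l, Y l),
      (∀ i, x i ∈ (X i).gr (α i)) → (∀ l, y l ∈ (Y l).gr (β l)) →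
        f (PiTensorProduct.tprod k x) (PiTensorProduct.tprod k y) = f' (PiTensorProduct.tprod k x) (PiTensorProduct.tprod k y)) : f = f' :=
  tens_ext fun α x hx => tens_ext fun β y hy => h α β x y hx hy

lemma srcKey_inj : Function.Injective (srcKey : Fin n ⊕ Fin m → _) := toLex.injective

/-- The blocks of the target order. -/
def flatE (e : (Σ i, Fin (r i)) ≃ Fin m) : (Σ i, Option (Fin (r i))) ≃ Fin n ⊕ Fin m where
  toFun z := match z with
    | ⟨i, none⟩ => .inl i
    | ⟨i, some j⟩ => .inr (e ⟨i, j⟩)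
  invFun z := match z with
    | .inl i => ⟨i, none⟩
    | .inr l => ⟨(e.symm l).1, some (e.symm l).2⟩
  left_inv := by
    rintro ⟨i, _ | j⟩
    · rfl
    · show (⟨(e.symm (e ⟨i, j⟩)).1, some (e.symm (e ⟨i, j⟩)).2⟩ : Σ i, Option (Fin (r i))) = _
      rw [Equiv.symm_apply_apply]
  right_inv := by
    rintro (i | l) <;> simp

def optKey {N : ℕ} : Option (Fin N) → ℕ
  | none => 0
  | some j => j.val + 1

lemma tgtKey_flatE (e : (Σ i, Fin (r i)) ≃ Fin m) (z : Σ i, Option (Fin (r i))) :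
    tgtKey e (flatE e z) = toLex (z.1, optKey z.2) := by
  rcases z with ⟨i, _ | j⟩
  · rfl
  · show toLex ((e.symm (e ⟨i, j⟩)).1, ((e.symm (e ⟨i, j⟩)).2 : ℕ) + 1) = toLex (i, (j : ℕ) + 1)
    rw [Equiv.symm_apply_apply]

lemma tgtKey_inj (e : (Σ i, Fin (r i)) ≃ Fin m) : Function.Injective (tgtKey e) := by
  have : Function.Injective (tgtKey e ∘ flatE e) := by
    rintro ⟨i, a⟩ ⟨i', a'⟩ h
    simp only [Function.comp, tgtKey_flatE, EmbeddingLike.apply_eq_iff_eq, Prod.mk.injEq] at h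
    obtain ⟨rfl, h⟩ := h
    rcases a with _ | a <;> rcases a' with _ | a' <;> simp [optKey] at h ⊢
    omega
  exact (Function.Injective.of_comp_iff' _ (flatE e).bijective).1 this

lemma kos_src_perm (σ : Equiv.Perm (Fin m)) (α : Fin n → ℤ) (β : Fin m → ℤ) :
    kos srcKey (srcKey ∘ Sum.map id σ) (Sum.elim α β) = kos id σ β := by
  simp [kos, srcKey, Fintype.sum_sum_type]
  exact kos_self id α

lemma kos_src_perm' (σ : Equiv.Perm (Fin n)) (α : Fin n → ℤ) (β : Fin m → ℤ) :
    kos srcKey (srcKey ∘ Sum.map σ id) (Sum.elim α β) = kos id σ α := by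
  simp [kos, srcKey, Fintype.sum_sum_type]
  exact kos_self id β

lemma sgn_relabel (e : (Σ i, Fin (r i)) ≃ Fin m) (σ : Equiv.Perm (Fin m))
    (α : Fin n → ℤ) (β : Fin m → ℤ) :
    ((kos srcKey (tgtKey (e.trans σ.symm)) (Sum.elim α β) : ℤ) : ZMod 2) =
      (kos id σ β + kos srcKey (tgtKey e) (Sum.elim α fun l => β (σ.symm l)) : ℤ) := by
  have h := kos_equiv (Equiv.sumCongr (Equiv.refl (Fin n)) σ) srcKey (tgtKey e)
    (Sum.elim α fun l => β (σ.symm l))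
  have h1 : Sum.elim α (fun l => β (σ.symm l)) ∘ Equiv.sumCongr (Equiv.refl (Fin n)) σ =
      Sum.elim α β := by
    funext z; rcases z with i | l <;> simp
  have h2 : tgtKey e ∘ Equiv.sumCongr (Equiv.refl (Fin n)) σ = tgtKey (e.trans σ.symm) := by
    funext z; rcases z with i | l <;> rfl
  rw [h1, h2] at h
  rw [← h, ← kos_src_perm σ α β]
  refine (kos_trans srcKey_inj ?_ (tgtKey_inj _) _).symm
  exact srcKey_inj.comp (Equiv.sumCongr (Equiv.refl (Fin n)) σ).injective

lemma sgn_slide (e : (Σ i, Fin (r i)) ≃ Fin m) (τ : Equiv.Perm (Fin n))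
    (α : Fin n → ℤ) (β : Fin m → ℤ) :
    ((kos srcKey (tgtKey e) (Sum.elim α β) +
        kos id τ (fun i => α i + ∑ j, β (e ⟨i, j⟩)) : ℤ) : ZMod 2) =
      (kos id τ α + kos srcKey
        (tgtKey ((Equiv.sigmaCongrLeft (β := fun i => Fin (r i)) τ.symm).trans e))
        (Sum.elim (fun i => α (τ.symm i)) β) : ℤ) := by
  set e' := (Equiv.sigmaCongrLeft (β := fun i => Fin (r i)) τ.symm).trans e with he'
  have h := kos_equiv (Equiv.sumCongr τ (Equiv.refl (Fin m))) srcKey (tgtKey e')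
    (Sum.elim (fun i => α (τ.symm i)) β)
  have h1 : Sum.elim (fun i => α (τ.symm i)) β ∘ Equiv.sumCongr τ (Equiv.refl (Fin m)) =
      Sum.elim α β := by
    funext z; rcases z with i | l <;> simp
  rw [h1] at h
  have h3 : kos (tgtKey e) (tgtKey e' ∘ Equiv.sumCongr τ (Equiv.refl (Fin m))) (Sum.elim α β) =
      kos id τ (fun i => α i + ∑ j, β (e ⟨i, j⟩)) := by
    rw [← kos_equiv (flatE e)]
    have := kos_block_out (n := n) (κ := fun i => Option (Fin (r i))) (a := id) (b := τ)
      Function.injective_id τ.injective (fun z => optKey z.2) (Sum.elim α β ∘ flatE e)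
    refine Eq.trans ?_ (this.trans ?_)
    · congr 1
      · funext z
        exact tgtKey_flatE e z
      · funext z
        rcases z with ⟨i, _ | j⟩
        · rfl
        · obtain ⟨⟨i', j'⟩, hw⟩ : ∃ w, e' w = e ⟨i, j⟩ := ⟨e'.symm (e ⟨i, j⟩), by simp⟩
          have hw' : (⟨τ.symm i', j'⟩ : Σ i, Fin (r i)) = ⟨i, j⟩ := e.injective hw
          have h5 := tgtKey_flatE e' ⟨i', some j'⟩
          cases hw'
          refine h5.trans ?_
          show toLex (i', optKey (some j')) = toLex (τ (τ.symm i'), optKey (some j'))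
          rw [Equiv.apply_symm_apply]
    · congr 1
      funext i
      rw [Fintype.sum_option]
      rfl
  rw [← h, ← kos_src_perm' τ α β, ← h3]
  have t1 := kos_trans srcKey_inj (tgtKey_inj e)
    ((tgtKey_inj e').comp (Equiv.sumCongr τ (Equiv.refl (Fin m))).injective) (Sum.elim α β)
  have t2 := kos_trans srcKey_inj
    (srcKey_inj.comp (Equiv.sumCongr τ (Equiv.refl (Fin m))).injective)
    ((tgtKey_inj e').comp (Equiv.sumCongr τ (Equiv.refl (Fin m))).injective) (Sum.elim α β)
  exact t1.trans t2.symm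

lemma sg_sum {ι : Type} (s : Finset ι) (f : ι → ℤ) : sg k (∑ i ∈ s, f i) = ∏ i ∈ s, sg k (f i) := by
  induction s using Finset.cons_induction with
  | empty => simp
  | cons a s ha ih => rw [Finset.sum_cons, Finset.prod_cons, sg_add, ih]

lemma sgn_block (e : (Σ i, Fin (r i)) ≃ Fin m) (τ : ∀ i, Equiv.Perm (Fin (r i)))
    (α : Fin n → ℤ) (β : Fin m → ℤ) :
    ((kos srcKey (tgtKey e) (Sum.elim α β) +
        ∑ i, kos id (τ i) (fun j => β (e ⟨i, j⟩)) : ℤ) : ZMod 2) =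
      (kos srcKey (tgtKey ((Equiv.sigmaCongrRight fun i => (τ i).symm).trans e))
        (Sum.elim α β) : ℤ) := by
  set e' := (Equiv.sigmaCongrRight fun i => (τ i).symm).trans e with he'
  have h3 : kos (tgtKey e) (tgtKey e') (Sum.elim α β) =
      ∑ i, kos id (τ i) (fun j => β (e ⟨i, j⟩)) := by
    rw [← kos_equiv (flatE e)]
    have := kos_block_in (n := n) (κ := fun i => Option (Fin (r i))) (a := id)
      Function.injective_id (fun z => optKey z.2) (fun z => optKey (z.2.map (τ z.1)))
      (Sum.elim α β ∘ flatE e)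
    refine Eq.trans ?_ (this.trans ?_)
    · congr 1
      · funext z
        exact tgtKey_flatE e z
      · funext z
        rcases z with ⟨i, _ | j⟩
        · rfl
        · have h5 := tgtKey_flatE e' ⟨i, some (τ i j)⟩
          refine Eq.trans (congrArg (fun l => tgtKey e' (.inr l)) ?_) h5
          show e ⟨i, j⟩ = e ⟨i, (τ i).symm (τ i j)⟩
          rw [Equiv.symm_apply_apply]
    · refine Finset.sum_congr rfl fun i _ => ?_
      simp only [kos, Fintype.sum_option]
      simp [optKey, flatE]
  rw [← h3]
  exact kos_trans srcKey_inj (tgtKey_inj e) (tgtKey_inj e') _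

/-- Relabelling. -/
lemma distr_relabel (e : (Σ i, Fin (r i)) ≃ Fin m) (σ : Equiv.Perm (Fin m))
    (g : ∀ i, X i →ₗ[k] (⨂[k] j, Y (σ.symm (e ⟨i, j⟩))) →ₗ[k] Z i)
    (x : ⨂[k] i, X i) (y : ⨂[k] l, Y l) :
    distr X Y (e.trans σ.symm) g x y =
      distr X (fun l => Y (σ.symm l)) e g x ((perm Y σ).lin y) := by
  have : distr X Y (e.trans σ.symm) g =
      (distr X (fun l => Y (σ.symm l)) e g).compl₂ (perm Y σ).lin := by
    refine distr_ext fun α β x y hx hy => ?_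
    refine (distr_tprod (e.trans σ.symm) g hx hy).trans ?_
    have h := distr_tprod (Y := fun l => Y (σ.symm l)) e g hx (β := fun l => β (σ.symm l))
        (fun l => hy (σ.symm l))
    rw [LinearMap.compl₂_apply, perm_tprod hy, map_smul]
    refine Eq.trans ?_ (congrArg (sg k (kos id σ β) • ·) h).symm
    rw [sg_congr k (sgn_relabel e σ α β), sg_add, ← smul_smul]
    rfl
  exact LinearMap.congr_fun₂ this x y

/-- Permuting the blocks. -/
lemma distr_slide (e : (Σ i, Fin (r i)) ≃ Fin m) (τ : Equiv.Perm (Fin n))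
    (g : ∀ i, X i →ₗ[k] (⨂[k] j, Y (e ⟨i, j⟩)) →ₗ[k] Z i)
    (hg : ∀ i (a : ℤ) (b : Fin (r i) → ℤ) (x : X i) (y : ∀ j, Y (e ⟨i, j⟩)), x ∈ (X i).gr a →
      (∀ j, y j ∈ (Y (e ⟨i, j⟩)).gr (b j)) → g i x (PiTensorProduct.tprod k y) ∈ (Z i).gr (a + ∑ j, b j))
    (x : ⨂[k] i, X i) (y : ⨂[k] l, Y l) :
    (perm Z τ).lin (distr X Y e g x y) =
      distr (fun i => X (τ.symm i)) Y
        ((Equiv.sigmaCongrLeft (β := fun i => Fin (r i)) τ.symm).trans e)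
        (fun i => g (τ.symm i)) ((perm X τ).lin x) y := by
  have : (distr X Y e g).compr₂ (perm Z τ).lin =
      (distr (Z := fun i => Z (τ.symm i)) (fun i => X (τ.symm i)) Y
        ((Equiv.sigmaCongrLeft (β := fun i => Fin (r i)) τ.symm).trans e)
        (fun i => g (τ.symm i))) ∘ₗ (perm X τ).lin := by
    refine distr_ext fun α β x y hx hy => ?_
    rw [LinearMap.compr₂_apply, distr_tprod _ _ hx hy, LinearMap.comp_apply, perm_tprod hx,
      map_smul, map_smul, LinearMap.smul_apply,
      distr_tprod (X := fun i => X (τ.symm i)) (Z := fun i => Z (τ.symm i))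
        ((Equiv.sigmaCongrLeft (β := fun i => Fin (r i)) τ.symm).trans e)
        (fun i => g (τ.symm i)) (α := fun i => α (τ.symm i)) (fun i => hx (τ.symm i)) hy,
      perm_tprod fun i => hg i _ _ _ _ (hx i) fun j => hy (e ⟨i, j⟩), smul_smul, smul_smul,
      ← sg_add, ← sg_add]
    exact congrArg (· • _) (sg_congr k (sgn_slide e τ α β))
  exact LinearMap.congr_fun₂ this x y

/-- Permuting the factors within each block. -/
lemma distr_block (e : (Σ i, Fin (r i)) ≃ Fin m) (τ : ∀ i, Equiv.Perm (Fin (r i)))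
    {Z' : Fin n → DGMod k} (ρ : ∀ i, Mor (X i) (X i)) (φ : ∀ i, Z' i →ₗ[k] Z i)
    (g : ∀ i, X i →ₗ[k] (⨂[k] j, Y (e ⟨i, j⟩)) →ₗ[k] Z i)
    (g' : ∀ i, X i →ₗ[k] (⨂[k] j, Y (e ⟨i, (τ i).symm j⟩)) →ₗ[k] Z' i)
    (h : ∀ i x y, g i ((ρ i).lin x) y =
      φ i (g' i x ((perm (fun j => Y (e ⟨i, j⟩)) (τ i)).lin y)))
    (x : ⨂[k] i, X i) (y : ⨂[k] l, Y l) :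
    distr X Y e g ((tensMap ρ).lin x) y = PiTensorProduct.map φ
      (distr X Y ((Equiv.sigmaCongrRight fun i => (τ i).symm).trans e) g' x y) := by
  have : distr X Y e g ∘ₗ (tensMap ρ).lin = (distr X Y
      ((Equiv.sigmaCongrRight fun i => (τ i).symm).trans e) g').compr₂
        (PiTensorProduct.map φ) := by
    refine distr_ext fun α β x y hx hy => ?_
    have h1 := distr_tprod ((Equiv.sigmaCongrRight fun i => (τ i).symm).trans e) g' hx hy
    rw [LinearMap.comp_apply, LinearMap.compr₂_apply]
    refine Eq.trans ?_ (congrArg (PiTensorProduct.map φ) h1).symm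
    simp only [tensMap, PiTensorProduct.map_tprod, map_smul]
    rw [distr_tprod _ _ (fun i => (ρ i).mem (hx i)) hy]
    have h2 : (fun i => g i ((ρ i).lin (x i)) (PiTensorProduct.tprod k fun j => y (e ⟨i, j⟩))) =
        fun i => sg k (kos id (τ i) fun j => β (e ⟨i, j⟩)) •
          φ i (g' i (x i) (PiTensorProduct.tprod k fun j => y (e ⟨i, (τ i).symm j⟩))) := by
      funext i
      rw [h, perm_tprod (fun j => hy (e ⟨i, j⟩)), map_smul, map_smul]
    rw [h2, MultilinearMap.map_smul_univ, smul_smul, ← sg_sum, ← sg_add]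
    exact congrArg (· • _) (sg_congr k (sgn_block e τ α β))
  exact LinearMap.congr_fun₂ this x y

/-- Applying morphisms to the factors `y`. -/
lemma distr_map (e : (Σ i, Fin (r i)) ≃ Fin m) {Y' : Fin m → DGMod k} {Z' : Fin n → DGMod k}
    (ρ : ∀ l, Mor (Y' l) (Y l)) (φ : ∀ i, Z' i →ₗ[k] Z i)
    (g : ∀ i, X i →ₗ[k] (⨂[k] j, Y (e ⟨i, j⟩)) →ₗ[k] Z i)
    (g' : ∀ i, X i →ₗ[k] (⨂[k] j, Y' (e ⟨i, j⟩)) →ₗ[k] Z' i)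
    (h : ∀ i x y, g i x ((tensMap fun j => ρ (e ⟨i, j⟩)).lin y) = φ i (g' i x y))
    (x : ⨂[k] i, X i) (y : ⨂[k] l, Y' l) :
    distr X Y e g x ((tensMap ρ).lin y) = PiTensorProduct.map φ (distr X Y' e g' x y) := by
  have : (distr X Y e g).compl₂ (tensMap ρ).lin =
      (distr X Y' e g').compr₂ (PiTensorProduct.map φ) := by
    refine distr_ext fun α β x y hx hy => ?_
    rw [LinearMap.compl₂_apply, LinearMap.compr₂_apply, distr_tprod _ _ hx hy]
    simp only [tensMap, PiTensorProduct.map_tprod, map_smul]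
    rw [distr_tprod _ _ hx fun l => (ρ l).mem (hy l)]
    congr 2
    funext i
    rw [← h]
    simp only [tensMap, PiTensorProduct.map_tprod]
  exact LinearMap.congr_fun₂ this x y

end distr

namespace SymSeq

/-! ### The comparison map `(O ∘ P)[A] → O[P[A]]` -/

/-- `o ⊗ x ↦ (y ↦ F (o ⊗ D x y))`. -/
def distrInto {M X Y W V : Type*} [AddCommGroup M] [Module k M] [AddCommGroup X] [Module k X]
    [AddCommGroup Y] [Module k Y] [AddCommGroup W] [Module k W] [AddCommGroup V] [Module k V]
    (F : M ⊗[k] W →ₗ[k] V) (D : X →ₗ[k] Y →ₗ[k] W) : M ⊗[k] X →ₗ[k] Y →ₗ[k] V :=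
  TensorProduct.curry (F ∘ₗ TensorProduct.map LinearMap.id (TensorProduct.lift D) ∘ₗ
    (TensorProduct.assoc k M X Y).toLinearMap)

lemma distrInto_apply {M X Y W V : Type*} [AddCommGroup M] [Module k M] [AddCommGroup X]
    [Module k X] [AddCommGroup Y] [Module k Y] [AddCommGroup W] [Module k W] [AddCommGroup V]
    [Module k V] (F : M ⊗[k] W →ₗ[k] V) (D : X →ₗ[k] Y →ₗ[k] W) (o : M) (x : X) (y : Y) :
    distrInto F D (o ⊗ₜ x) y = F (o ⊗ₜ D x y) := rfl

section schurComp

variable (O P : SymSeq k) (A : DGMod k) {m : ℕ}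

/-- The map `P(r₁) ⊗ ⋯ ⊗ P(rₙ), A^{⊗m} → P[A]^{⊗n}` that distributes the factors in `A` over the
blocks. -/
def schurDistr (c : CompIdx m) :
    (⨂[k] i, P.obj (c.r i)) →ₗ[k] tpow A m →ₗ[k] tpow (schur P A) c.n :=
  distr (Z := fun _ => schur P A) (fun i => P.obj (c.r i)) (fun _ => A) c.e
    fun i => TensorProduct.curry (schurι P A (c.r i)).lin

/-- The effect of the comparison map on the summand with index `c`. -/
def schurCompAux (c : CompIdx m) :
    O.obj c.n ⊗[k] (⨂[k] i, P.obj (c.r i)) →ₗ[k] tpow A m →ₗ[k] schur O (schur P A) :=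
  distrInto (schurι O (schur P A) c.n).lin (schurDistr P A c)

variable {O P A}

lemma schurCompAux_slide (c : CompIdx m) (τ : Equiv.Perm (Fin c.n)) (o : O.obj c.n)
    (x : ⨂[k] i, P.obj (c.r i)) : schurCompAux O P A c ((O.act τ).lin o ⊗ₜ x) =
      schurCompAux O P A (c.slide τ) (o ⊗ₜ (perm (fun i => P.obj (c.r i)) τ).lin x) := by
  refine LinearMap.ext fun y => ?_
  refine (schurι_rel τ o (schurDistr P A c x y)).trans ?_
  refine congrArg (fun z => (schurι O (schur P A) c.n).lin (o ⊗ₜ z)) ?_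
  refine distr_slide (Z := fun _ => schur P A) c.e τ _ ?_ x y
  intro i a b x y hx hy
  exact (schurι P A (c.r i)).mem (tmul_mem _ _ hx (tprod_mem hy rfl) rfl)

lemma schurCompAux_block (c : CompIdx m) (τ : ∀ i, Equiv.Perm (Fin (c.r i))) (o : O.obj c.n)
    (x : ⨂[k] i, P.obj (c.r i)) :
    schurCompAux O P A c (o ⊗ₜ (tensMap fun i => P.act (τ i)).lin x) =
      schurCompAux O P A (c.block τ) (o ⊗ₜ x) := by
  refine LinearMap.ext fun y => ?_
  refine congrArg (fun z => (schurι O (schur P A) c.n).lin (o ⊗ₜ z)) ?_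
  have := distr_block (Z := fun _ => schur P A) (Z' := fun _ => schur P A) (Y := fun _ => A)
    c.e τ (fun i => P.act (τ i)) (fun _ => LinearMap.id)
    (fun i => TensorProduct.curry (schurι P A (c.r i)).lin)
    (fun i => TensorProduct.curry (schurι P A (c.r i)).lin)
    (fun i x y => schurι_rel (τ i) x y) x y
  refine this.trans ?_
  rw [PiTensorProduct.map_id]
  rfl

lemma schurCompAux_relabel (c : CompIdx m) (σ : Equiv.Perm (Fin m)) (o : O.obj c.n)
    (x : ⨂[k] i, P.obj (c.r i)) (y : tpow A m) :
    schurCompAux O P A (c.relabel σ.symm) (o ⊗ₜ x) y =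
      schurCompAux O P A c (o ⊗ₜ x) ((perm (fun _ => A) σ).lin y) :=
  congrArg (fun z => (schurι O (schur P A) c.n).lin (o ⊗ₜ z))
    (distr_relabel (Y := fun _ => A) (Z := fun _ => schur P A) c.e σ
      (fun i => TensorProduct.curry (schurι P A (c.r i)).lin) x y)

variable (O P A) in
/-- The canonical isomorphism `(O ∘ P)[A] → O[P[A]]`. -/
def schurComp : schur (comp O P) A →ₗ[k] schur O (schur P A) :=
  schurLift (O := comp O P) (fun _ => TensorProduct.lift
    (compLift (schurCompAux O P A) schurCompAux_slide schurCompAux_block)) (by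
    intro m σ z y
    have : compLift (schurCompAux O P A) schurCompAux_slide schurCompAux_block ∘ₗ
        (compTr O P σ).lin = (compLift (schurCompAux O P A) schurCompAux_slide
          schurCompAux_block).compl₂ (perm (fun _ => A) σ).lin := by
      refine comp_ext fun c o x => LinearMap.ext fun y => ?_
      have h1 := congrArg (compLift (schurCompAux O P A) schurCompAux_slide schurCompAux_block)
        (compTr_ι σ c (o ⊗ₜ x))
      rw [LinearMap.comp_apply, LinearMap.compl₂_apply]
      refine (LinearMap.congr_fun h1 y).trans ?_
      rw [compLift_ι, compLift_ι]
      exact schurCompAux_relabel c σ o x y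
    exact LinearMap.congr_fun₂ this z y)

end schurComp

/-! ### The associator `(O ∘ P) ∘ Q → O ∘ (P ∘ Q)` -/

section assoc

variable (O P Q : SymSeq k) {N : ℕ}

namespace CompIdx

/-- The arity of the `i`-th block after composing. -/
@[reducible] def inR (d : CompIdx N) (c : CompIdx d.n) (i : Fin c.n) : ℕ :=
  ∑ j, d.r (c.e ⟨i, j⟩)

/-- The index of the outer composition after reassociating. -/
@[reducible] def outer (d : CompIdx N) (c : CompIdx d.n) : CompIdx N where
  n := c.n
  r := d.inR c
  e := ((((Equiv.sigmaCongrRight fun _ => finSigmaFinEquiv.symm).trans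
    (Equiv.sigmaAssoc fun i j => Fin (d.r (c.e ⟨i, j⟩))).symm).trans
      (Equiv.sigmaCongrLeft (β := fun l => Fin (d.r l)) c.e)).trans d.e)

/-- The index of the `i`-th inner composition after reassociating. -/
@[reducible] def inner (d : CompIdx N) (c : CompIdx d.n) (i : Fin c.n) : CompIdx (d.inR c i) where
  n := c.r i
  r j := d.r (c.e ⟨i, j⟩)
  e := finSigmaFinEquiv

end CompIdx

/-- `P(rᵢ) ⊗ Q(s₁) ⊗ ⋯ ⊗ Q(sₘ) → ⨂ᵢ (P ∘ Q)(tᵢ)`. -/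
def assocDistr (d : CompIdx N) (c : CompIdx d.n) :
    (⨂[k] i, P.obj (c.r i)) →ₗ[k] (⨂[k] l, Q.obj (d.r l)) →ₗ[k]
      ⨂[k] i, compObj P Q (d.inR c i) :=
  distr (Z := fun i => compObj P Q (d.inR c i)) (fun i => P.obj (c.r i)) (fun l => Q.obj (d.r l))
    c.e fun i => TensorProduct.curry (compι P Q (d.inner c i)).lin

def assocAux (d : CompIdx N) (c : CompIdx d.n) :
    O.obj c.n ⊗[k] (⨂[k] i, P.obj (c.r i)) →ₗ[k] (⨂[k] l, Q.obj (d.r l)) →ₗ[k]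
      compObj O (comp P Q) N :=
  distrInto (compι O (comp P Q) (d.outer c)).lin (assocDistr P Q d c)

variable {O P Q}

lemma compι_congr {c : CompIdx N} {e' : (Σ i, Fin (c.r i)) ≃ Fin N} (h : ∀ z, c.e z = e' z)
    (x : compM O P c) :
    (compι O P c).lin x = (compι O P ⟨c.n, c.r, e'⟩).lin x := by
  obtain rfl : c.e = e' := Equiv.ext h
  rfl

/-- The relation `compι_block` for the composition product `P ∘ Q`, with bijections in place of
permutations. -/
lemma compι_block_equiv {n : ℕ} {r r' : Fin n → ℕ} (e : (Σ i, Fin (r i)) ≃ Fin N)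
    (σ : ∀ i, Fin (r i) ≃ Fin (r' i)) (o : O.obj n) (x : ⨂[k] i, compObj P Q (r' i)) :
    (compι O (comp P Q) ⟨n, r, e⟩).lin
        (o ⊗ₜ PiTensorProduct.map (fun i => (compTr P Q (σ i)).lin) x) =
      (compι O (comp P Q) ⟨n, r', (Equiv.sigmaCongrRight fun i => (σ i).symm).trans e⟩).lin
        (o ⊗ₜ x) := by
  obtain rfl : r = r' := funext fun i => Fin.equiv_iff_eq.1 ⟨σ i⟩
  exact compι_block (P := comp P Q) ⟨n, r, e⟩ σ o x

lemma assocAux_slide (d : CompIdx N) (c : CompIdx d.n) (τ : Equiv.Perm (Fin c.n)) (o : O.obj c.n)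
    (x : ⨂[k] i, P.obj (c.r i)) : assocAux O P Q d c ((O.act τ).lin o ⊗ₜ x) =
      assocAux O P Q d (c.slide τ) (o ⊗ₜ (perm (fun i => P.obj (c.r i)) τ).lin x) := by
  refine LinearMap.ext fun y => ?_
  refine (compι_slide (P := comp P Q) (d.outer c) τ o (assocDistr P Q d c x y)).trans ?_
  refine (congrArg (fun z => (compι O (comp P Q) ((d.outer c).slide τ)).lin (o ⊗ₜ z))
    (distr_slide (Z := fun i => compObj P Q (d.inR c i)) c.e τ _ ?_ x y)).trans ?_
  · intro i a b x y hx hy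
    exact (compι P Q (d.inner c i)).mem (tmul_mem _ _ hx (tprod_mem hy rfl) rfl)
  · exact compι_congr (c := (d.outer c).slide τ) (e' := (d.outer (c.slide τ)).e)
      (fun z => rfl) _

lemma assocAux_block (d : CompIdx N) (c : CompIdx d.n) (τ : ∀ i, Equiv.Perm (Fin (c.r i)))
    (o : O.obj c.n) (x : ⨂[k] i, P.obj (c.r i)) :
    assocAux O P Q d c (o ⊗ₜ (tensMap fun i => P.act (τ i)).lin x) =
      assocAux O P Q d (c.block τ) (o ⊗ₜ x) := by
  refine LinearMap.ext fun y => ?_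
  let σ : ∀ i, Fin (d.inR c i) ≃ Fin (d.inR (c.block τ) i) := fun i =>
    (finSigmaFinEquiv.symm.trans ((Equiv.sigmaCongrLeft
      (β := fun j => Fin (d.r (c.e ⟨i, j⟩))) (τ i).symm).symm)).trans finSigmaFinEquiv
  have := distr_block (Z := fun i => compObj P Q (d.inR c i))
    (Z' := fun i => compObj P Q (d.inR (c.block τ) i)) (Y := fun l => Q.obj (d.r l))
    c.e τ (fun i => P.act (τ i)) (fun i => (compTr P Q (σ i)).lin)
    (fun i => TensorProduct.curry (compι P Q (d.inner c i)).lin)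
    (fun i => TensorProduct.curry (compι P Q (d.inner (c.block τ) i)).lin)
    (by
      intro i x y
      refine (compι_slide (d.inner c i) (τ i) x y).trans ?_
      refine Eq.trans ?_ (compTr_ι (σ i) (d.inner (c.block τ) i)
        (x ⊗ₜ (perm (fun j => Q.obj (d.r (c.e ⟨i, j⟩))) (τ i)).lin y)).symm
      refine compι_congr (c := (d.inner c i).slide (τ i)) (fun z => ?_) _
      exact congrArg (fun w => finSigmaFinEquiv ((Equiv.sigmaCongrLeft
        (β := fun j => Fin (d.r (c.e ⟨i, j⟩))) (τ i).symm) w))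
          (Equiv.symm_apply_apply _ z).symm) x y
  refine (congrArg (fun z => (compι O (comp P Q) (d.outer c)).lin (o ⊗ₜ z)) this).trans ?_
  refine (compι_block_equiv (d.outer c).e σ o _).trans ?_
  refine compι_congr (O := O) (P := comp P Q) (c := ⟨c.n, d.inR (c.block τ),
    (Equiv.sigmaCongrRight fun i => (σ i).symm).trans (d.outer c).e⟩)
    (e' := (d.outer (c.block τ)).e) (fun z => ?_) _
  obtain ⟨i, z⟩ := z
  exact congrArg (fun w => d.e ((Equiv.sigmaCongrLeft (β := fun l => Fin (d.r l)) c.e)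
    ((Equiv.sigmaAssoc fun i j => Fin (d.r (c.e ⟨i, j⟩))).symm ⟨i, w⟩)))
    (Equiv.symm_apply_apply finSigmaFinEquiv _)

lemma assocAux_relabel (d : CompIdx N) (c : CompIdx d.n) (σ : Equiv.Perm (Fin d.n))
    (o : O.obj c.n) (x : ⨂[k] i, P.obj (c.r i)) (y : ⨂[k] l, Q.obj (d.r l)) :
    assocAux O P Q d (c.relabel σ.symm) (o ⊗ₜ x) y =
      assocAux O P Q (d.slide σ) c (o ⊗ₜ x) ((perm (fun l => Q.obj (d.r l)) σ).lin y) := by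
  have := distr_relabel (Z := fun i => compObj P Q (d.inR (c.relabel σ.symm) i)) c.e σ
    (fun i => TensorProduct.curry (compι P Q (d.inner (c.relabel σ.symm) i)).lin) x y
  refine (congrArg (fun z => (compι O (comp P Q) (d.outer (c.relabel σ.symm))).lin (o ⊗ₜ z))
    this).trans ?_
  exact compι_congr (c := d.outer (c.relabel σ.symm)) (e' := ((d.slide σ).outer c).e)
    (fun z => rfl) _

lemma assocAux_map (d : CompIdx N) (c : CompIdx d.n) (ρ : ∀ l, Equiv.Perm (Fin (d.r l)))
    (o : O.obj c.n) (x : ⨂[k] i, P.obj (c.r i)) (y : ⨂[k] l, Q.obj (d.r l)) :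
    assocAux O P Q d c (o ⊗ₜ x) ((tensMap fun l => Q.act (ρ l)).lin y) =
      assocAux O P Q (d.block ρ) c (o ⊗ₜ x) y := by
  let σ : ∀ i, Equiv.Perm (Fin (d.inR c i)) := fun i =>
    (finSigmaFinEquiv.symm.trans (Equiv.sigmaCongrRight fun j => ρ (c.e ⟨i, j⟩))).trans
      finSigmaFinEquiv
  have := distr_map (Z := fun i => compObj P Q (d.inR c i))
    (Z' := fun i => compObj P Q (d.inR c i)) (Y := fun l => Q.obj (d.r l)) c.e
    (fun l => Q.act (ρ l)) (fun i => (compTr P Q (σ i)).lin)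
    (fun i => TensorProduct.curry (compι P Q (d.inner c i)).lin)
    (fun i => TensorProduct.curry (compι P Q (d.inner c i)).lin)
    (by
      intro i x y
      refine (compι_block (d.inner c i) (fun j => ρ (c.e ⟨i, j⟩)) x y).trans ?_
      refine Eq.trans ?_ (compTr_ι (σ i) (d.inner c i) (x ⊗ₜ y)).symm
      refine compι_congr (c := (d.inner c i).block fun j => ρ (c.e ⟨i, j⟩)) (fun z => ?_) _
      exact congrArg (fun w => finSigmaFinEquiv ((Equiv.sigmaCongrRight
        fun j => (ρ (c.e ⟨i, j⟩)).symm) w)) (Equiv.symm_apply_apply _ z).symm) x y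
  refine (congrArg (fun z => (compι O (comp P Q) (d.outer c)).lin (o ⊗ₜ z)) this).trans ?_
  refine (compι_block (P := comp P Q) (d.outer c) σ o _).trans ?_
  refine compι_congr (O := O) (P := comp P Q) (c := (d.outer c).block σ)
    (e' := ((d.block ρ).outer c).e) (fun z => ?_) _
  obtain ⟨i, z⟩ := z
  exact congrArg (fun w => d.e ((Equiv.sigmaCongrLeft (β := fun l => Fin (d.r l)) c.e)
    ((Equiv.sigmaAssoc fun i j => Fin (d.r (c.e ⟨i, j⟩))).symm ⟨i, w⟩)))
    (Equiv.symm_apply_apply finSigmaFinEquiv _)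

variable (O P Q N) in
/-- The associator `(O ∘ P) ∘ Q → O ∘ (P ∘ Q)`. -/
def assoc : compObj (comp O P) Q N →ₗ[k] compObj O (comp P Q) N :=
  compLift (O := comp O P)
    (fun d => TensorProduct.lift (compLift (assocAux O P Q d) (assocAux_slide d)
      (assocAux_block d)))
    (by
      intro d σ z y
      have : compLift (assocAux O P Q d) (assocAux_slide d) (assocAux_block d) ∘ₗ
          (compTr O P σ).lin = (compLift (assocAux O P Q (d.slide σ)) (assocAux_slide _)
            (assocAux_block _)).compl₂ (perm (fun l => Q.obj (d.r l)) σ).lin := by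
        refine comp_ext fun c o x => LinearMap.ext fun y => ?_
        have h1 := congrArg (compLift (assocAux O P Q d) (assocAux_slide d) (assocAux_block d))
          (compTr_ι σ c (o ⊗ₜ x))
        rw [LinearMap.comp_apply, LinearMap.compl₂_apply]
        refine (LinearMap.congr_fun h1 y).trans ?_
        rw [compLift_ι, compLift_ι]
        exact assocAux_relabel d c σ o x y
      exact LinearMap.congr_fun₂ this z y)
    (by
      intro d ρ z y
      have : (compLift (assocAux O P Q d) (assocAux_slide d) (assocAux_block d)).compl₂
          (tensMap fun l => Q.act (ρ l)).lin =
            compLift (assocAux O P Q (d.block ρ)) (assocAux_slide _) (assocAux_block _) := by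
        refine comp_ext fun c o x => LinearMap.ext fun y => ?_
        rw [LinearMap.compl₂_apply]
        rw [compLift_ι, compLift_ι]
        exact assocAux_map d c ρ o x y
      exact LinearMap.congr_fun₂ this z y)

end assoc

end SymSeq

/-! ### Cooperads and their coalgebras -/

/-- The complex `k`, concentrated in degree `0`. -/
def oneDG (k : Type u) [CommRing k] : DGMod k where
  carrier := k
  gr i := if i = 0 then ⊤ else ⊥
  internal := by
    refine internal_of_proj _ (fun n => if n = 0 then LinearMap.id else 0) ?_ ?_ ?_
    · intro i x hx
      by_cases h : i = 0 <;> simp_all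
    · intro i j hj x hx
      by_cases h : j = 0
      · subst h
        simp_all [Ne.symm hj]
      · simp [h]
    · exact eq_top_iff.2 fun x _ => Submodule.mem_iSup_of_mem 0 (by simp)
  d := 0
  d_mem := fun _ => Submodule.zero_mem _
  d_d := fun _ => rfl

/-- The zero complex. -/
def zeroDG (k : Type u) [CommRing k] : DGMod k where
  carrier := PUnit
  gr _ := ⊤
  internal := internal_of_proj _ (fun _ => 0) (fun _ _ _ => rfl) (fun _ _ _ _ _ => rfl)
    (Subsingleton.elim _ _)
  d := 0
  d_mem := fun _ => trivial
  d_d := fun _ => rfl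

namespace SymSeq

def unitObj (k : Type u) [CommRing k] : ℕ → DGMod k
  | 1 => oneDG k
  | _ => zeroDG k

/-- The unit for the composition product: `k` in arity `1` and `0` in all other arities. -/
def unit (k : Type u) [CommRing k] : SymSeq k where
  obj := unitObj k
  act _ := Mor.id _
  act_one _ := rfl
  act_mul _ _ _ := rfl

/-- The generator of `I(1) = k`. -/
def unitOne (k : Type u) [CommRing k] : (unit k).obj 1 := (1 : k)

/-- The inverse `P → I ∘ P` of the left unit isomorphism. -/
def unitorL (P : SymSeq k) (m : ℕ) (c : P.obj m) : compObj (unit k) P m :=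
  (compι (unit k) P ⟨1, fun _ => m, Equiv.uniqueSigma fun _ : Fin 1 => Fin m⟩).lin
    (unitOne k ⊗ₜ PiTensorProduct.tprod k fun _ => c)

/-- The inverse `P → P ∘ I` of the right unit isomorphism. -/
def unitorR (P : SymSeq k) (m : ℕ) (c : P.obj m) : compObj P (unit k) m :=
  (compι P (unit k) ⟨m, fun _ => 1, Equiv.sigmaUnique (Fin m) fun _ => Fin 1⟩).lin
    (c ⊗ₜ PiTensorProduct.tprod k fun _ => unitOne k)

/-- The inverse `A → I[A]` of the isomorphism `I[A] ≅ A`. -/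
def schurUnit (A : DGMod k) (x : A) : schur (unit k) A :=
  (schurι (unit k) A 1).lin (unitOne k ⊗ₜ PiTensorProduct.tprod k fun _ => x)

end SymSeq

open SymSeq

/-- A cooperad: a comonoid in the category of symmetric sequences with the composition product.
The counit laws `(ε ∘ 1) Δ = 1` and `(1 ∘ ε) Δ = 1` are written with the inverses of the unit
isomorphisms `I ∘ C ≅ C ≅ C ∘ I`. -/
structure Cooperad (k : Type u) [CommRing k] extends SymSeq k where
  Δ : Hom toSymSeq (comp toSymSeq toSymSeq)
  ε : Hom toSymSeq (unit k)
  coassoc : ∀ m (c : obj m),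
    assoc toSymSeq toSymSeq toSymSeq m
        (compMap (P := toSymSeq) (P' := toSymSeq) Δ (Hom.id toSymSeq) m ((Δ.app m).lin c)) =
      compMap (O := toSymSeq) (O' := toSymSeq) (Hom.id toSymSeq) Δ m ((Δ.app m).lin c)
  counit_left : ∀ m (c : obj m),
    compMap (P := toSymSeq) (P' := toSymSeq) ε (Hom.id toSymSeq) m ((Δ.app m).lin c) =
      unitorL toSymSeq m c
  counit_right : ∀ m (c : obj m),
    compMap (O := toSymSeq) (O' := toSymSeq) (Hom.id toSymSeq) ε m ((Δ.app m).lin c) =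
      unitorR toSymSeq m c

namespace Cooperad

variable (C : Cooperad k)

/-- The comultiplication `C[A] → (C ∘ C)[A] → C[C[A]]` of the comonad `C[-]`. It is the structure
map of the cofree-type `C`-coalgebra `C[A]`. -/
def cofree (A : DGMod k) : schur C.toSymSeq A →ₗ[k] schur C.toSymSeq (schur C.toSymSeq A) :=
  schurComp C.toSymSeq C.toSymSeq A ∘ₗ schurSeq C.Δ A

/-- `δ : X → C[X]` makes `X` a coalgebra over the comonad `C[-]`: it is a morphism of complexes
that is coassociative and counital. The counit law is written with the inverse of `I[X] ≅ X`. -/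
structure IsCoalgebra (X : DGMod k) (δ : X →ₗ[k] schur C.toSymSeq X) : Prop where
  mem : ∀ {i : ℤ} {x : X}, x ∈ X.gr i → δ x ∈ (schur C.toSymSeq X).gr i
  comm : ∀ x : X, δ (X.d x) = (schur C.toSymSeq X).d (δ x)
  coassoc : ∀ x : X, schurMap C.toSymSeq (⟨δ, mem, comm⟩ : Mor X (schur C.toSymSeq X)) (δ x) =
    C.cofree X (δ x)
  counit : ∀ x : X, schurSeq C.ε X (δ x) = schurUnit X x

end Cooperad

/-! ### Thick maps and contractions -/

/-- A contraction `A ⇄ B`. -/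
structure Contraction (A B : DGMod k) where
  f : Mor A B
  g : Mor B A
  h : A →ₗ[k] A
  h_deg : IsDeg 1 h
  homotopy : ∀ x, A.d (h x) + h (A.d x) = g.lin (f.lin x) - x
  fg : ∀ y, f.lin (g.lin y) = y
  fh : ∀ x, f.lin (h x) = 0
  hh : ∀ x, h (h x) = 0
  hg : ∀ y, h (g.lin y) = 0

/-- A sequence of maps `A^{⊗n} → B^{⊗n}`, `n ≥ 0`. -/
abbrev Thick (A B : DGMod k) : Type u := ∀ n, tpow A n →ₗ[k] tpow B n

namespace Thick

variable {A B : DGMod k}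

/-- The map `f₁ : A → B`. -/
def one (f : Thick A B) : A →ₗ[k] B :=
  (PiTensorProduct.subsingletonEquiv (R := k) (s := fun _ : Fin 1 => B) 0).toLinearMap ∘ₗ f 1 ∘ₗ
    (PiTensorProduct.subsingletonEquiv (R := k) (s := fun _ : Fin 1 => A) 0).symm.toLinearMap

/-- `fₙ = f₁^{⊗n}` for all `n` (for maps of degree `0`). -/
def IsMorphism (f : Thick A B) : Prop := ∀ n, f n = PiTensorProduct.map fun _ => f.one

/-- All `fₙ` are equivariant. -/
def IsSymmetric (f : Thick A B) : Prop :=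
  ∀ n (σ : Equiv.Perm (Fin n)) (x : tpow A n),
    f n ((perm (fun _ => A) σ).lin x) = (perm (fun _ => B) σ).lin (f n x)

/-- The isomorphism `A^{⊗p} ⊗ A^{⊗q} ≅ A^{⊗(p+q)}`. -/
def mulEquiv (A : DGMod k) (p q : ℕ) : tpow A p ⊗[k] tpow A q ≃ₗ[k] tpow A (p + q) :=
  TensorPower.mulEquiv

/-- `h_p ⊗ 1 - 1 ⊗ h_q`, with the Koszul sign for maps of degree `1`. -/
def commutator (h : Thick A A) (p q : ℕ) : tpow A p ⊗[k] tpow A q →ₗ[k] tpow A p ⊗[k] tpow A q :=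
  TensorProduct.map (h p) LinearMap.id - TensorProduct.map ((tpow A p).sgn 1) (h q)

/-- `h_p ⊗ h_q`, with the Koszul sign for maps of degree `1`. -/
def tensor (h : Thick A A) (p q : ℕ) : tpow A p ⊗[k] tpow A q →ₗ[k] tpow A p ⊗[k] tpow A q :=
  TensorProduct.map (h p ∘ₗ (tpow A p).sgn 1) (h q)

/-- `h_{p+q}` as an endomorphism of `A^{⊗p} ⊗ A^{⊗q}`. -/
def restrict (h : Thick A A) (p q : ℕ) : tpow A p ⊗[k] tpow A q →ₗ[k] tpow A p ⊗[k] tpow A q :=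
  (mulEquiv A p q).symm.toLinearMap ∘ₗ h (p + q) ∘ₗ (mulEquiv A p q).toLinearMap

/-- A thick map `h` of degree `1` is a pseudo-derivation if
`(h_p ⊗ 1 - 1 ⊗ h_q) h_{p+q} = - h_{p+q} (h_p ⊗ 1 - 1 ⊗ h_q) = h_p ⊗ h_q` for all `p, q ≥ 0`. -/
def IsPseudoDerivation (h : Thick A A) : Prop :=
  ∀ p q, h.commutator p q ∘ₗ h.restrict p q = h.tensor p q ∧
    -(h.restrict p q ∘ₗ h.commutator p q) = h.tensor p q

/-- A symmetric thick map `f : X → Y` of degree `deg` between coalgebras over a cooperad `C` is a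
thick map of `C`-coalgebras if `C[f] δ_X = δ_Y f₁`. -/
def IsCoalgebraMap (C : Cooperad k) {X Y : DGMod k} (δX : X →ₗ[k] schur C.toSymSeq X)
    (δY : Y →ₗ[k] schur C.toSymSeq Y) (deg : ℤ) (f : Thick X Y) : Prop :=
  (∀ n, IsDeg deg (f n)) ∧ ∃ hf : f.IsSymmetric,
    ∀ x, schurThick C.toSymSeq deg f hf (δX x) = δY (f.one x)

end Thick

/-- A thick contraction, i.e. a contraction in the dg-category of thick maps: the compositions and
differentials of thick maps are defined levelwise. -/
structure ThickContraction (A B : DGMod k) where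
  level : ∀ n, Contraction (tpow A n) (tpow B n)

namespace ThickContraction

variable {A B : DGMod k} (T : ThickContraction A B)

def f : Thick A B := fun n => (T.level n).f.lin

def g : Thick B A := fun n => (T.level n).g.lin

def h : Thick A A := fun n => (T.level n).h

/-- A thick contraction of `C`-coalgebras. -/
structure IsCoalgebraContraction (C : Cooperad k) (δA : A →ₗ[k] schur C.toSymSeq A)
    (δB : B →ₗ[k] schur C.toSymSeq B) : Prop where
  f_morphism : T.f.IsMorphism
  g_morphism : T.g.IsMorphism
  h_pseudoDerivation : T.h.IsPseudoDerivation
  f_coalgebra : T.f.IsCoalgebraMap C δA δB 0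
  g_coalgebra : T.g.IsCoalgebraMap C δB δA 0
  h_coalgebra : T.h.IsCoalgebraMap C δA δA 1

end ThickContraction

/-! ### Filtrations -/

/-- A bounded below exhaustive increasing filtration of a complex by subcomplexes. -/
structure IsDGFiltration (A : DGMod k) (F : ℤ → Submodule k A) : Prop where
  mono : Monotone F
  graded : ∀ p n, ∀ x ∈ F p, A.proj n x ∈ F p
  d_mem : ∀ p, ∀ x ∈ F p, A.d x ∈ F p
  bounded_below : ∃ p, F p = ⊥
  exhaustive : ⨆ p, F p = ⊤

/-- A linear map preserves filtrations. -/
def Preserves {V W : Type u} [AddCommGroup V] [Module k V] [AddCommGroup W] [Module k W]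
    (F : ℤ → Submodule k V) (G : ℤ → Submodule k W) (f : V →ₗ[k] W) : Prop :=
  ∀ p, ∀ x ∈ F p, f x ∈ G p

/-- The induced filtration on `A^{⊗n}`: level `p` is the sum of the images of all
`F_{i₁} ⊗ ⋯ ⊗ F_{iₙ}` with `i₁ + ⋯ + iₙ = p`. -/
def inducedFil {A : DGMod k} (F : ℤ → Submodule k A) (n : ℕ) (p : ℤ) : Submodule k (tpow A n) :=
  Submodule.span k {z | ∃ (i : Fin n → ℤ) (a : Fin n → A),
    (∀ j, a j ∈ F (i j)) ∧ ∑ j, i j = p ∧ PiTensorProduct.tprod k a = z}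

/-- The weight filtration `F_p = ⨁_{n ≤ p} O(n) ⊗_{Σₙ} A^{⊗n}` of `O[A]`. -/
def weightFil (O : SymSeq k) (A : DGMod k) (p : ℤ) : Submodule k (schur O A) :=
  ⨆ (n : ℕ) (_ : (n : ℤ) ≤ p), LinearMap.range (schurι O A n).lin

/-- A filtered contraction: the filtrations are bounded below and exhaustive, and they are
preserved by `f`, `g` and `h`. -/
structure IsFilteredContraction {A B : DGMod k} (D : Contraction A B) (F : ℤ → Submodule k A)
    (G : ℤ → Submodule k B) : Prop where
  left : IsDGFiltration A F
  right : IsDGFiltration B G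
  f_mem : Preserves F G D.f.lin
  g_mem : Preserves G F D.g.lin
  h_mem : Preserves F F D.h

/-- A filtered contraction of `C`-coalgebras: a filtered contraction between `C`-coalgebras that
has an extension to a thick contraction of `C`-coalgebras in which all `fₙ`, `gₙ`, `hₙ` preserve
the induced filtrations. -/
structure IsFilteredCoalgebraContraction (C : Cooperad k) {A B : DGMod k}
    (δA : A →ₗ[k] schur C.toSymSeq A) (δB : B →ₗ[k] schur C.toSymSeq B)
    (F : ℤ → Submodule k A) (G : ℤ → Submodule k B) (D : Contraction A B) : Prop where
  coalgebra_left : C.IsCoalgebra A δA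
  coalgebra_right : C.IsCoalgebra B δB
  filtered : IsFilteredContraction D F G
  extension : ∃ T : ThickContraction A B,
    T.f.one = D.f.lin ∧ T.g.one = D.g.lin ∧ T.h.one = D.h ∧
    T.IsCoalgebraContraction C δA δB ∧
    ∀ n, Preserves (inducedFil F n) (inducedFil G n) (T.f n) ∧
      Preserves (inducedFil G n) (inducedFil F n) (T.g n) ∧
      Preserves (inducedFil F n) (inducedFil F n) (T.h n)

/-! ### The symmetrized tensor trick homotopy -/

namespace Contraction

variable {A B : DGMod k} (D : Contraction A B)

/-- `hₙ = ∑ 1^{⊗i} ⊗ h ⊗ (gf)^{⊗j}`, the sum over all `i + 1 + j = n`, with Koszul signs. -/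
def trick (n : ℕ) : tpow A n →ₗ[k] tpow A n :=
  ∑ i : Fin n, PiTensorProduct.map fun j =>
    if j < i then A.sgn 1 else if j = i then D.h else D.g.lin ∘ₗ D.f.lin

/-- The symmetrization `(1 / n!) ∑ σ⁻¹ hₙ σ` of `hₙ`. -/
def symTrick [Algebra ℚ k] : Thick A A := fun n =>
  algebraMap ℚ k ((n.factorial : ℚ)⁻¹) • ∑ σ : Equiv.Perm (Fin n),
    (perm (fun _ => A) σ⁻¹).lin ∘ₗ D.trick n ∘ₗ (perm (fun _ => A) σ).lin

lemma symTrick_symmetric [Algebra ℚ k] : D.symTrick.IsSymmetric := by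
  intro n τ x
  simp only [symTrick, LinearMap.smul_apply, LinearMap.sum_apply, LinearMap.comp_apply, map_smul,
    map_sum]
  congr 1
  refine Fintype.sum_equiv (Equiv.mulRight τ) _ _ fun σ => ?_
  have h1 := perm_mul A σ τ x
  have h2 := perm_mul A τ (σ * τ)⁻¹ (D.trick n ((perm (fun _ => A) (σ * τ)).lin x))
  have h3 : τ * (σ * τ)⁻¹ = σ⁻¹ := by group
  rw [h3] at h2
  refine Eq.trans ?_ h2
  exact congrArg (fun z => (perm (fun _ => A) σ⁻¹).lin (D.trick n z)) h1.symm

end Contraction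

end

/-! Extend h and 1 - gf to A^{⊗n} as derivations: D = ∑ 1⊗h⊗1 of degree 1 and N = ∑ 1⊗(1-gf)⊗1 of
degree 0. A graded commutator of derivations is a derivation, so dD + Dd = -N; moreover D² = 0, and
D commutes with N. Since gf is idempotent, A is spanned by vectors fixed by gf and vectors killed by
gf. A tensor of such vectors with exactly m killed factors is an eigenvector of N with eigenvalue m.

The decisive observation is that the symmetrized tensor trick homotopy is D divided by N: on
m-eigenvectors it is (1/m) D, with 1/0 read as 0 (`Contraction.symTrick_eq`). Indeed, for a tensor
whose killed factors form the set S, the summand of σ⁻¹ hₙ σ that applies h in a position i ∈ S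
survives exactly when σ i is the largest element of σ(S), and this happens for n!/|S| permutations
(`card_perm_max`).

The averaged homotopy obeys no simple Leibniz rule, but D and N do. The proof therefore works with
data (f, g, D, N), called `NumberContraction`, and divides by N only at the end
(`NumberContraction.toContraction`). Such data pass to tensor powers and to Schur functors:
eigenvalues add up, and a sum of natural numbers is zero only if every summand is. On O[A] the
eigenvalues may be unbounded, so the inverse of N need not be a polynomial in N, but on each single
element it agrees with one (`IsNumberOp.inv`). Hence it preserves all N-stable submodules
(`IsNumberOp.inv_mem`) and commutes with every map that intertwines the operators N
(`IsNumberOp.map_inv`). Every compatibility of the homotopy thereby reduces to one of D and N.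

For the coalgebra structure, the comultiplication of C[A] commutes with Leibniz extensions
(`SymSeq.schurComp_der`, resting on the sign computation `distr_der`), hence with the homotopies
(`NumberContraction.cofree_h`). For the pseudo-derivation property, evaluation on x ⊗ y with
eigenvalues a and b leaves the identity (1/(a+b))(1/a + 1/b) = 1/(ab). The filtrations are preserved
because D and N preserve weight. That C[A] is a coalgebra follows from the cooperad axioms once the
comparison maps (O ∘ P)[A] → O[P[A]] are known to be natural and associative; the latter is the sign
identity `kos_assoc`. -/

noncomputable section

/-! ### Operators spanned by eigenvectors with natural eigenvalues -/

section numberOp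

variable {k : Type*} [CommRing k] {V W : Type*} [AddCommGroup V] [Module k V]
  [AddCommGroup W] [Module k W]

/-- The module is spanned by eigenvectors of `N` with eigenvalues in `ℕ`. -/
def IsNumberOp (N : V →ₗ[k] V) : Prop :=
  Submodule.span k {x | ∃ m : ℕ, N x = (m : k) • x} = ⊤

lemma aeval_apply_eigenvector {N : V →ₗ[k] V} {a : k} {x : V} (h : N x = a • x)
    (p : Polynomial k) : Polynomial.aeval N p x = p.eval a • x := by
  induction p using Polynomial.induction_on' with
  | add p q hp hq => simp [hp, hq, add_smul]
  | monomial n c =>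
    have : ∀ n, (N ^ n) x = a ^ n • x := by
      intro n
      induction n with
      | zero => simp
      | succ n ih => rw [pow_succ', Module.End.mul_apply, ih, map_smul, h, smul_smul, pow_succ]
    simp [Polynomial.aeval_monomial, this, smul_smul, mul_comm]

lemma aeval_apply_mem {N : V →ₗ[k] V} {S : Submodule k V} (h : ∀ x ∈ S, N x ∈ S)
    (p : Polynomial k) {x : V} (hx : x ∈ S) : Polynomial.aeval N p x ∈ S := by
  induction p using Polynomial.induction_on' with
  | add p q hp hq => simpa using S.add_mem hp hq
  | monomial n c =>
    have : ∀ n, (N ^ n) x ∈ S := by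
      intro n
      induction n with
      | zero => simpa
      | succ n ih => rw [pow_succ', Module.End.mul_apply]; exact h _ ih
    simpa [Polynomial.aeval_monomial] using S.smul_mem c (this n)

lemma IsNumberOp.ext {N : V →ₗ[k] V} (hN : IsNumberOp N) {f g : V →ₗ[k] W}
    (h : ∀ (m : ℕ) x, N x = (m : k) • x → f x = g x) : f = g :=
  LinearMap.ext_on hN fun x ⟨m, hx⟩ => h m x hx

/-- A polynomial with the value `m⁻¹` at each `m < M`. -/
def invPoly (k : Type*) [CommRing k] [Algebra ℚ k] (M : ℕ) : Polynomial k :=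
  (Lagrange.interpolate (Finset.range M) (fun m : ℕ => (m : ℚ)) fun m => (m : ℚ)⁻¹).map
    (algebraMap ℚ k)

/-- The scalar `1 / m`, which is `0` for `m = 0`. -/
def invNat (k : Type*) [CommRing k] [Algebra ℚ k] (m : ℕ) : k := algebraMap ℚ k (m : ℚ)⁻¹

lemma natCast_eq_algebraMap [Algebra ℚ k] (m : ℕ) : (m : k) = algebraMap ℚ k m := by simp

lemma invNat_mul [Algebra ℚ k] {m : ℕ} (h : m ≠ 0) : invNat k m * m = 1 := by
  rw [natCast_eq_algebraMap, invNat, ← map_mul, inv_mul_cancel₀ (by exact_mod_cast h), map_one]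

lemma eval_invPoly [Algebra ℚ k] {m M : ℕ} (h : m < M) :
    (invPoly k M).eval (m : k) = invNat k m := by
  rw [invPoly, natCast_eq_algebraMap, Polynomial.eval_map, Polynomial.eval₂_at_apply,
    Lagrange.eval_interpolate_at_node _ (fun _ _ _ _ h => by exact_mod_cast h) (by simpa using h)]
  rfl

variable [Algebra ℚ k]

namespace IsNumberOp

variable {N : V →ₗ[k] V}

/-- An element is a finite combination of eigenvectors, and on each of these the interpolating
polynomials take the value 1/m as soon as M exceeds the eigenvalue. No single M need work for all
elements, since the eigenvalues may be unbounded. -/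
lemma exists_eventually (hN : IsNumberOp N) (x : V) :
    ∃ y, ∀ᶠ M in Filter.atTop, Polynomial.aeval N (invPoly k M) x = y := by
  have hx : x ∈ Submodule.span k {x | ∃ m : ℕ, N x = (m : k) • x} := by
    rw [show Submodule.span k _ = ⊤ from hN]; trivial
  induction hx using Submodule.span_induction with
  | mem x hx =>
    obtain ⟨m, hx⟩ := hx
    refine ⟨invNat k m • x, (Filter.eventually_gt_atTop m).mono fun M hM => ?_⟩
    rw [aeval_apply_eigenvector hx, eval_invPoly hM]
  | zero => exact ⟨0, by simp⟩
  | add x y _ _ hx hy =>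
    obtain ⟨x', hx⟩ := hx
    obtain ⟨y', hy⟩ := hy
    exact ⟨x' + y', (hx.and hy).mono fun M h => by rw [map_add, h.1, h.2]⟩
  | smul c x _ hx =>
    obtain ⟨x', hx⟩ := hx
    exact ⟨c • x', hx.mono fun M h => by rw [map_smul, h]⟩

/-- The group inverse of `N`: it divides eigenvectors by their eigenvalues and vanishes on the
kernel. -/
def inv (hN : IsNumberOp N) : V →ₗ[k] V where
  toFun x := (hN.exists_eventually x).choose
  map_add' x y := by
    -- One large M computes all three values by the same polynomial in N, which is a linear map.
    obtain ⟨M, h1, h2, h3⟩ := ((hN.exists_eventually (x + y)).choose_spec.and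
      ((hN.exists_eventually x).choose_spec.and (hN.exists_eventually y).choose_spec)).exists
    rw [← h1, ← h2, ← h3, map_add]
  map_smul' c x := by
    obtain ⟨M, h1, h2⟩ := ((hN.exists_eventually (c • x)).choose_spec.and
      (hN.exists_eventually x).choose_spec).exists
    rw [← h1, ← h2, map_smul, RingHom.id_apply]

lemma inv_eventually (hN : IsNumberOp N) (x : V) :
    ∀ᶠ M in Filter.atTop, Polynomial.aeval N (invPoly k M) x = hN.inv x :=
  (hN.exists_eventually x).choose_spec

lemma inv_apply (hN : IsNumberOp N) {m : ℕ} {x : V} (hx : N x = (m : k) • x) :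
    hN.inv x = invNat k m • x := by
  obtain ⟨M, h1, h2⟩ := ((hN.inv_eventually x).and (Filter.eventually_gt_atTop m)).exists
  rw [← h1, aeval_apply_eigenvector hx, eval_invPoly h2]

/-- On each element the inverse acts as a polynomial in N. This is what gives the homotopies their
degree and makes them respect filtrations. -/
lemma inv_mem (hN : IsNumberOp N) {S : Submodule k V} (h : ∀ x ∈ S, N x ∈ S) {x : V} (hx : x ∈ S) :
    hN.inv x ∈ S := by
  obtain ⟨M, h1⟩ := (hN.inv_eventually x).exists
  rw [← h1]
  exact aeval_apply_mem h _ hx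

/-- An intertwiner sends m-eigenvectors to m-eigenvectors, and both inverses act there as 1/m. All
naturality statements about homotopies are deduced from this. -/
lemma map_inv (hN : IsNumberOp N) {N' : W →ₗ[k] W} (hN' : IsNumberOp N') {φ : V →ₗ[k] W}
    (h : ∀ x, φ (N x) = N' (φ x)) (x : V) : φ (hN.inv x) = hN'.inv (φ x) := by
  have : φ ∘ₗ hN.inv = hN'.inv ∘ₗ φ := hN.ext fun m x hx => by
    rw [LinearMap.comp_apply, LinearMap.comp_apply, hN.inv_apply hx,
      hN'.inv_apply (m := m) (by rw [← h, hx, map_smul]), map_smul]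
  exact LinearMap.congr_fun this x

/-- A scalar multiple of an intertwiner intertwines the inverses. -/
lemma inv_comm (hN : IsNumberOp N) {D : V →ₗ[k] V} (h : ∀ x, D (N x) = N (D x)) (x : V) :
    D (hN.inv x) = hN.inv (D x) :=
  hN.map_inv hN h x

end IsNumberOp

end numberOp

end

noncomputable section

open DGMod

/-! ### Derivations of tensor products -/

section koszul

variable {ι : Type} [Fintype ι] [DecidableEq ι] {α β : Type} [LinearOrder α] [LinearOrder β]

/-- Changing one degree by `e` changes the sign by `e` times the number of odd degrees moved
past. -/
lemma kos_update_add {a : ι → α} {b : ι → β} (ha : a.Injective) (hb : b.Injective)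
    (p : ι → ℤ) (i : ι) (e : ℤ) :
    ((kos a b p + e * ∑ j, (if b j < b i then p j else 0) : ℤ) : ZMod 2) =
      (e * (∑ j, (if a j < a i then p j else 0)) +
        kos a b (Function.update p i (p i + e)) : ℤ) := by
  -- Only the pairs that contain i are affected; each contributes e times the degree of its other
  -- member.
  have key : kos a b (Function.update p i (p i + e)) - kos a b p =
      e * ∑ j, ((if a i < a j ∧ b j < b i then p j else 0) +
        (if a j < a i ∧ b i < b j then p j else 0)) := by
    have : ∀ x y, ((if a x < a y ∧ b y < b x then Function.update p i (p i + e) x *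
          Function.update p i (p i + e) y else 0) -
        (if a x < a y ∧ b y < b x then p x * p y else 0)) =
        (if x = i then (if a i < a y ∧ b y < b i then e * p y else 0) else 0) +
        (if y = i then (if a x < a i ∧ b i < b x then e * p x else 0) else 0) := by
      intro x y
      by_cases hx : x = i
      · subst hx
        by_cases hy : y = x
        · subst hy
          simp
        · simp only [hy, Function.update_self, Function.update_of_ne hy, if_true, if_false,
            add_zero]
          split_ifs <;> ring
      · by_cases hy : y = i
        · subst hy
          simp only [hx, Function.update_self, Function.update_of_ne hx, if_true, if_false,
            zero_add]
          split_ifs <;> ring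
        · simp [hx, hy]
    simp only [kos, ← Finset.sum_sub_distrib, this]
    simp only [Finset.sum_add_distrib, Finset.sum_ite_eq', Finset.mem_univ, if_true]
    rw [Finset.sum_comm]
    simp [mul_add, Finset.mul_sum]
  -- Modulo 2, a pair i, j is in opposite orders exactly when j precedes i in one order but not in
  -- the other.
  have key2 : ((kos a b (Function.update p i (p i + e)) - kos a b p : ℤ) : ZMod 2) =
      (e * ((∑ j, (if a j < a i then p j else 0)) +
        ∑ j, (if b j < b i then p j else 0)) : ℤ) := by
    rw [key, ← Finset.sum_add_distrib, Int.cast_mul, Int.cast_mul, Int.cast_sum, Int.cast_sum]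
    congr 1
    refine Finset.sum_congr rfl fun j _ => ?_
    have e2 : (2 : ZMod 2) = 0 := rfl
    rcases eq_or_ne i j with rfl | hij
    · simp
    rcases lt_or_gt_of_ne (ha.ne hij) with h1 | h1 <;>
      rcases lt_or_gt_of_ne (hb.ne hij) with h2 | h2 <;>
      simp [h1, h2, h1.not_gt, h2.not_gt] <;> ring_nf <;> simp [e2]
  have e2 : (2 : ZMod 2) = 0 := rfl
  push_cast at key2 ⊢
  linear_combination -key2 -
    (e * ∑ j, (if a j < a i then (p j : ZMod 2) else 0)) * e2

end koszul

section der

open PiTensorProduct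

variable {k : Type u} [CommRing k] {n : ℕ} {M N : Fin n → DGMod k}

/-- The operator `1 ⊗ ⋯ ⊗ θ ⊗ ⋯ ⊗ 1` with `θ` of degree `e` in position `i`, with Koszul signs. -/
def place (M : Fin n → DGMod k) (e : ℤ) (i : Fin n) (θ : M i →ₗ[k] M i) :
    (⨂[k] i, M i) →ₗ[k] ⨂[k] i, M i :=
  PiTensorProduct.map (Function.update (fun j => if j < i then (M j).sgn e else LinearMap.id) i θ)

/-- The derivation `∑ 1 ⊗ ⋯ ⊗ θ i ⊗ ⋯ ⊗ 1` of degree `e`, with Koszul signs. -/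
def der (M : Fin n → DGMod k) (e : ℤ) (θ : ∀ i, M i →ₗ[k] M i) :
    (⨂[k] i, M i) →ₗ[k] ⨂[k] i, M i :=
  ∑ i, place M e i (θ i)

lemma place_tprod (e : ℤ) (i : Fin n) (θ : M i →ₗ[k] M i) {α : Fin n → ℤ} {x : ∀ i, M i}
    (hx : ∀ i, x i ∈ (M i).gr (α i)) :
    place M e i θ (tprod k x) = sg k (e * ∑ j, if j < i then α j else 0) •
      tprod k (Function.update x i (θ (x i))) := by
  rw [place, PiTensorProduct.map_tprod]
  have : (fun j => (Function.update (fun j => if j < i then (M j).sgn e else LinearMap.id) i θ j)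
      (x j)) = fun j => (if j < i then sg k (e * α j) else 1) •
        Function.update x i (θ (x i)) j := by
    funext j
    rcases eq_or_ne j i with rfl | h
    · simp
    · by_cases h1 : j < i
      · simp [h, h1, (M j).sgn_mem e (hx j)]
      · simp [h, h1]
  rw [this, MultilinearMap.map_smul_univ, Finset.mul_sum, sg_sum]
  congr 1
  refine Finset.prod_congr rfl fun j _ => ?_
  split_ifs <;> simp

lemma der_tprod (e : ℤ) (θ : ∀ i, M i →ₗ[k] M i) {α : Fin n → ℤ} {x : ∀ i, M i}
    (hx : ∀ i, x i ∈ (M i).gr (α i)) :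
    der M e θ (tprod k x) = ∑ i, sg k (e * ∑ j, if j < i then α j else 0) •
      tprod k (Function.update x i (θ i (x i))) := by
  rw [der, LinearMap.sum_apply]
  exact Finset.sum_congr rfl fun i _ => place_tprod e i (θ i) hx

lemma sg_neg (n : ℤ) : sg k (-n) = sg k n :=
  sg_congr k (by push_cast; exact ZMod.neg_eq_self_mod_two _)

/-- Signs depend only on the parity of the degree, so `sgn (-1)` and `sgn 1` agree. Results about
derivations thus apply to the differential. -/
lemma tensD_eq_der : tensD M = der M (-1) fun i => (M i).d := by
  refine tens_ext fun α x hx => ?_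
  rw [tensD_tprod hx, der_tprod _ _ hx]
  refine Finset.sum_congr rfl fun i _ => ?_
  rw [neg_one_mul, sg_neg]

lemma update_mem_add {e : ℤ} {i : Fin n} {θ : M i →ₗ[k] M i} (hθ : IsDeg e θ) {α : Fin n → ℤ}
    {x : ∀ i, M i} (hx : ∀ i, x i ∈ (M i).gr (α i)) (j : Fin n) :
    Function.update x i (θ (x i)) j ∈ (M j).gr (Function.update α i (α i + e) j) := by
  rcases eq_or_ne j i with rfl | h
  · simpa using hθ _ _ (hx j)
  · simpa [h] using hx j

lemma der_isDeg {e : ℤ} {θ : ∀ i, M i →ₗ[k] M i} (hθ : ∀ i, IsDeg e (θ i)) :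
    IsDeg (A := tens M) (B := tens M) e (der M e θ) := by
  intro m z hz
  have : tensGr M m ≤ (tensGr M (m + e)).comap (der M e θ) := by
    refine tensGr_le fun α x hx h => ?_
    rw [Submodule.mem_comap, der_tprod _ _ hx]
    refine Submodule.sum_mem _ fun i _ => Submodule.smul_mem _ _ ?_
    refine tprod_mem (update_mem_add (hθ i) hx) ?_
    rw [Finset.sum_update_of_mem (Finset.mem_univ i), ← h,
      ← Finset.sum_sdiff (Finset.subset_univ {i})]
    simp
    ring
  exact this hz

/-- Sign bookkeeping for composites of derivations: a first operator in position i changes the sign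
of a second one in position j only if i precedes j. -/
lemma sum_update_lt (α : Fin n → ℤ) (e : ℤ) (i j : Fin n) :
    (∑ l, if l < j then Function.update α i (α i + e) l else 0) =
      (∑ l, if l < j then α l else 0) + if i < j then e else 0 := by
  have : ∀ l, (if l < j then Function.update α i (α i + e) l else 0) =
      (if l < j then α l else 0) + if i = l then (if i < j then e else 0) else 0 := by
    intro l
    rcases eq_or_ne i l with rfl | h
    · simp only [Function.update_self, if_true]
      split_ifs <;> simp
    · simp [Function.update_of_ne h.symm, h]
  simp only [this, Finset.sum_add_distrib, Finset.sum_ite_eq, Finset.mem_univ, if_true]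

/-- The graded commutator of two derivations is a derivation. -/
lemma der_comm {e e' : ℤ} {θ θ' : ∀ i, M i →ₗ[k] M i} (hθ : ∀ i, IsDeg e (θ i))
    (hθ' : ∀ i, IsDeg e' (θ' i)) (z : ⨂[k] i, M i) :
    der M e θ (der M e' θ' z) - sg k (e * e') • der M e' θ' (der M e θ z) =
      der M (e + e') (fun i => θ i ∘ₗ θ' i - sg k (e * e') • θ' i ∘ₗ θ i) z := by
  have : der M e θ ∘ₗ der M e' θ' - sg k (e * e') • der M e' θ' ∘ₗ der M e θ =
      der M (e + e') (fun i => θ i ∘ₗ θ' i - sg k (e * e') • θ' i ∘ₗ θ i) := by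
    refine tens_ext fun α x hx => ?_
    rw [LinearMap.sub_apply, LinearMap.smul_apply, LinearMap.comp_apply, LinearMap.comp_apply,
      der_tprod _ _ hx, der_tprod _ _ hx, der_tprod _ _ hx, map_sum, map_sum]
    simp only [map_smul, der_tprod _ _ (update_mem_add (hθ _) hx),
      der_tprod _ _ (update_mem_add (hθ' _) hx), Finset.smul_sum]
    rw [Finset.sum_comm, ← Finset.sum_sub_distrib]
    refine Finset.sum_congr rfl fun i _ => ?_
    rw [← Finset.sum_sub_distrib, Finset.sum_eq_single i]
    · simp only [sum_update_lt, lt_irrefl, if_false, add_zero, Function.update_self,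
        Function.update_idem, LinearMap.sub_apply, LinearMap.smul_apply, LinearMap.comp_apply,
        smul_smul, add_mul, sg_add]
      rw [MultilinearMap.map_update_sub, MultilinearMap.map_update_smul, smul_sub, smul_smul]
      congr 2 <;> ring
    · intro j _ hj
      simp only [sum_update_lt, Function.update_of_ne hj, Function.update_of_ne hj.symm,
        smul_smul, Function.update_comm hj, ← sg_add]
      rw [← sub_smul]
      convert zero_smul k _ using 2
      rw [sub_eq_zero]
      refine sg_congr k ?_
      have e2 : (2 : ZMod 2) = 0 := rfl
      rcases lt_or_gt_of_ne hj with h | h <;> simp [h, h.not_gt]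
      · ring
      · linear_combination - (e * e' : ZMod 2) * e2
    · simp
  exact LinearMap.congr_fun this z

/-- The square of an odd derivation. -/
lemma der_der_self {e : ℤ} (he : Odd e) {θ : ∀ i, M i →ₗ[k] M i} (hθ : ∀ i, IsDeg e (θ i))
    (h : ∀ i x, θ i (θ i x) = 0) (z : ⨂[k] i, M i) : der M e θ (der M e θ z) = 0 := by
  have : der M e θ ∘ₗ der M e θ = 0 := by
    refine tens_ext fun α x hx => ?_
    rw [LinearMap.comp_apply, der_tprod _ _ hx, map_sum, LinearMap.zero_apply]
    simp only [map_smul, der_tprod _ _ (update_mem_add (hθ _) hx), Finset.smul_sum]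
    rw [← Fintype.sum_prod_type']
    -- The terms for (i, j) and (j, i) cancel because e is odd, and the diagonal terms vanish
    -- because each θ i squares to zero. Pairing the terms avoids the division by 2 that an argument
    -- through the commutator would need.
    refine Finset.sum_involution (fun x _ => x.swap) ?_ ?_ (by simp) (by simp)
    · rintro ⟨i, j⟩ -
      rcases eq_or_ne i j with rfl | hij
      · simp only [Prod.swap, Function.update_self, h, Function.update_idem]
        rw [MultilinearMap.map_update_zero]
        simp
      · simp only [Prod.swap, Function.update_of_ne hij, Function.update_of_ne hij.symm]
        rw [Function.update_comm hij, smul_smul, smul_smul, ← add_smul, ← sg_add, ← sg_add,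
          sg_succ_add, zero_smul]
        have e1 : (e : ZMod 2) = 1 := by
          obtain ⟨m, rfl⟩ := he
          have e2 : (2 : ZMod 2) = 0 := rfl
          push_cast
          linear_combination m * e2
        have e2 : (2 : ZMod 2) = 0 := rfl
        rw [sum_update_lt, sum_update_lt]
        rcases lt_or_gt_of_ne hij with h | h <;> simp [h, h.not_gt, e1]
        · ring
        · linear_combination -e2
    · rintro ⟨i, j⟩ - h1 h'
      obtain rfl : j = i := (Prod.ext_iff.1 h').1
      simp only [Function.update_self, h, Function.update_idem] at h1
      rw [MultilinearMap.map_update_zero] at h1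
      simp at h1
  exact LinearMap.congr_fun this z

lemma der_neg (e : ℤ) (θ : ∀ i, M i →ₗ[k] M i) (z : ⨂[k] i, M i) :
    der M e (fun i => -θ i) z = -der M e θ z := by
  have : der M e (fun i => -θ i) = -der M e θ := by
    refine tens_ext fun α x hx => ?_
    rw [LinearMap.neg_apply, der_tprod _ _ hx, der_tprod _ _ hx, ← Finset.sum_neg_distrib]
    refine Finset.sum_congr rfl fun i _ => ?_
    rw [LinearMap.neg_apply, MultilinearMap.map_update_neg, smul_neg]
  exact LinearMap.congr_fun this z

lemma tensMap_der (e : ℤ) (f : ∀ i, Mor (M i) (N i)) {θ : ∀ i, M i →ₗ[k] M i}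
    {θ' : ∀ i, N i →ₗ[k] N i} (h : ∀ i x, (f i).lin (θ i x) = θ' i ((f i).lin x))
    (z : ⨂[k] i, M i) : (tensMap f).lin (der M e θ z) = der N e θ' ((tensMap f).lin z) := by
  have : (tensMap f).lin ∘ₗ der M e θ = der N e θ' ∘ₗ (tensMap f).lin := by
    refine tens_ext fun α x hx => ?_
    simp only [LinearMap.comp_apply, der_tprod _ _ hx, map_sum, map_smul]
    simp only [tensMap, PiTensorProduct.map_tprod]
    rw [der_tprod _ _ fun i => (f i).mem (hx i)]
    refine Finset.sum_congr rfl fun i _ => ?_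
    congr 2
    funext j
    rcases eq_or_ne j i with rfl | hj
    · simp [h]
    · simp [hj]
  exact LinearMap.congr_fun this z

/-- The Koszul sign of the permutation absorbs the change in the number of factors that θ has to
pass; this is `kos_update_add`. The position and the operator are matched by the hypotheses `hj` and
`hh`, since the type of θ' depends on j and σ⁻¹ (σ i) need not be definitionally i. -/
lemma perm_place (e : ℤ) (i : Fin n) {θ : M i →ₗ[k] M i} (hθ : IsDeg e θ)
    (σ : Equiv.Perm (Fin n)) (j : Fin n) (θ' : M (σ.symm j) →ₗ[k] M (σ.symm j))
    (hj : σ.symm j = i) (hh : HEq θ' θ) (z : ⨂[k] i, M i) :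
    (perm M σ).lin (place M e i θ z) =
      place (fun i => M (σ.symm i)) e j θ' ((perm M σ).lin z) := by
  subst hj
  obtain rfl := eq_of_heq hh
  have : (perm M σ).lin ∘ₗ place M e (σ.symm j) θ' =
      place (fun i => M (σ.symm i)) e j θ' ∘ₗ (perm M σ).lin := by
    refine tens_ext fun α x hx => ?_
    rw [LinearMap.comp_apply, LinearMap.comp_apply, perm_tprod hx, map_smul,
      place_tprod (M := fun i => M (σ.symm i)) e j θ' (α := fun i => α (σ.symm i))
        (fun i => hx (σ.symm i)), place_tprod e _ θ' hx, map_smul,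
      perm_tprod (update_mem_add hθ hx), smul_smul, smul_smul]
    congr 1
    · rw [← sg_add, ← sg_add]
      refine sg_congr k ?_
      have := kos_update_add Function.injective_id σ.injective α (σ.symm j) e
      rw [← Equiv.sum_comp σ.symm] at this
      simpa using this.symm
    · congr 1
      funext l
      by_cases h : l = j
      · subst h
        simp
      · rw [Function.update_of_ne h, Function.update_of_ne (σ.symm.injective.ne h)]
  exact LinearMap.congr_fun this z

lemma perm_der (e : ℤ) {θ : ∀ i, M i →ₗ[k] M i} (hθ : ∀ i, IsDeg e (θ i))
    (σ : Equiv.Perm (Fin n)) (z : ⨂[k] i, M i) :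
    (perm M σ).lin (der M e θ z) =
      der (fun i => M (σ.symm i)) e (fun i => θ (σ.symm i)) ((perm M σ).lin z) := by
  rw [der, der, LinearMap.sum_apply, LinearMap.sum_apply, map_sum]
  refine (Fintype.sum_equiv σ.symm _ _ fun i => ?_).symm
  exact (perm_place e _ (hθ _) σ i (θ (σ.symm i)) rfl HEq.rfl z).symm

end der

end

/-! ### Degree bookkeeping and functoriality of Schur functors. -/

noncomputable section

open DGMod SymSeq

variable {k : Type u} [CommRing k]

namespace DGMod

lemma tw_eq_id (A : DGMod k) {c : ℤ → k} (h : ∀ i, c i = 1) (x : A) : A.tw c x = x := by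
  have : A.tw c = LinearMap.id := A.hom_ext fun i x hx => by rw [A.tw_mem c hx, h, one_smul]; rfl
  exact LinearMap.congr_fun this x

lemma sgn_zero (A : DGMod k) (x : A) : A.sgn 0 x = x :=
  A.tw_eq_id (fun i => by rw [zero_mul, sg_zero]) x

lemma sgn_sgn (A : DGMod k) (e : ℤ) (x : A) : A.sgn e (A.sgn e x) = x := by
  have : A.sgn e ∘ₗ A.sgn e = LinearMap.id := A.hom_ext fun i x hx => by
    rw [LinearMap.comp_apply, A.sgn_mem e hx, map_smul, A.sgn_mem e hx, smul_smul, ← sg_add,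
      sg_congr k (n := 0), sg_zero, one_smul]
    · rfl
    · have e2 : (2 : ZMod 2) = 0 := rfl
      push_cast
      linear_combination (e * i : ZMod 2) * e2
  exact LinearMap.congr_fun this x

lemma IsDeg.sgn_apply {A B : DGMod k} {s : ℤ} {θ : A →ₗ[k] B} (hθ : IsDeg s θ) (e : ℤ) (x : A) :
    B.sgn e (θ x) = sg k (e * s) • θ (A.sgn e x) := by
  have : B.sgn e ∘ₗ θ = sg k (e * s) • θ ∘ₗ A.sgn e := A.hom_ext fun i x hx => by
    rw [LinearMap.comp_apply, LinearMap.smul_apply, LinearMap.comp_apply, A.sgn_mem e hx,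
      B.sgn_mem e (hθ i x hx), map_smul, smul_smul, ← sg_add, mul_add, add_comm]
  exact LinearMap.congr_fun this x

lemma d_isDeg (A : DGMod k) : IsDeg (-1) A.d := fun _ _ hx => A.d_mem hx

lemma sgn_d (A : DGMod k) (x : A) : A.sgn 1 (A.d x) = -A.d (A.sgn 1 x) := by
  rw [A.d_isDeg.sgn_apply, one_mul, sg_neg, sg_one, neg_one_smul]

lemma Mor.isDeg {A B : DGMod k} (f : Mor A B) : IsDeg 0 f.lin := fun i x hx => by
  rw [add_zero]; exact f.mem hx

lemma Mor.sgn_apply {A B : DGMod k} (f : Mor A B) (e : ℤ) (x : A) :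
    f.lin (A.sgn e x) = B.sgn e (f.lin x) := f.tw_comm _ x

lemma isDeg_comp {A B E : DGMod k} {m n p : ℤ} {f : B →ₗ[k] E} {g : A →ₗ[k] B}
    (hf : IsDeg m f) (hg : IsDeg n g) (h : n + m = p) : IsDeg p (f ∘ₗ g) := fun i x hx => by
  have := hf _ _ (hg i x hx)
  rwa [add_assoc, h] at this

lemma isDeg_add {A B : DGMod k} {n : ℤ} {f g : A →ₗ[k] B} (hf : IsDeg n f) (hg : IsDeg n g) :
    IsDeg n (f + g) := fun i x hx => Submodule.add_mem _ (hf i x hx) (hg i x hx)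

lemma isDeg_neg {A B : DGMod k} {n : ℤ} {f : A →ₗ[k] B} (hf : IsDeg n f) :
    IsDeg n (-f) := fun i x hx => Submodule.neg_mem _ (hf i x hx)

/-- A homogeneous element of the quotient lifts to a homogeneous element of the direct sum, whose
components are homogeneous. So the degree of a map out of a glued complex can be checked on the
summands. -/
lemma glue_gr_le {ι J : Type} [DecidableEq ι] {M : ι → DGMod k} {N : J → DGMod k} {s t : J → ι}
    {a : ∀ j, Mor (N j) (M (s j))} {b : ∀ j, Mor (N j) (M (t j))} {V : Type*} [AddCommGroup V]
    [Module k V] (φ : glue M a b →ₗ[k] V) {m : ℤ} {S : Submodule k V}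
    (h : ∀ i, ∀ x ∈ (M i).gr m, φ ((glueι M a b i).lin x) ∈ S) {x : glue M a b}
    (hx : x ∈ (glue M a b).gr m) : φ x ∈ S := by
  classical
  obtain ⟨y, hy, rfl⟩ := hx
  have h1 : y = ∑ i ∈ DFinsupp.support y, DirectSum.of (fun i => (M i : Type u)) i (y i) :=
    (DirectSum.sum_support_of y).symm
  have h2 : φ ((quotπ fun j => ((dsumι M (s j)).comp (a j)).sub
      ((dsumι M (t j)).comp (b j))).lin y) ∈ S := by
    have h3 : ∀ ψ : dsum M →ₗ[k] V, ψ y = ∑ i ∈ DFinsupp.support y,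
        ψ (DirectSum.of (fun i => (M i : Type u)) i (y i)) := fun ψ => by
      conv_lhs => rw [h1]
      exact map_sum ψ _ _
    refine (h3 (φ ∘ₗ (quotπ _).lin)).symm ▸ ?_
    exact Submodule.sum_mem _ fun i _ => h i (y i) (hy i)
  exact h2

/-- Used with spanning sets of eigenvectors, whose tensor products are eigenvectors of the
derivation extension. -/
lemma span_tprod_eq_top {ι : Type} [Fintype ι] {M : ι → Type u} [∀ i, AddCommGroup (M i)]
    [∀ i, Module k (M i)] {S : ∀ i, Set (M i)} (hS : ∀ i, Submodule.span k (S i) = ⊤) :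
    Submodule.span k {z | ∃ x : ∀ i, M i, (∀ i, x i ∈ S i) ∧ PiTensorProduct.tprod k x = z} =
      ⊤ := by
  rw [← Submodule.ker_mkQ (Submodule.span k _), LinearMap.ker_eq_top]
  refine PiTensorProduct.ext_of_span_eq_top (γ := fun i => S i) (g := fun i z => z.1)
    (fun i => ?_) (fun j => ?_)
  · rw [Subtype.range_coe]; exact hS i
  · rw [LinearMap.zero_apply, Submodule.mkQ_apply, Submodule.Quotient.mk_eq_zero]
    exact Submodule.subset_span ⟨_, fun i => (j i).2, rfl⟩

end DGMod

section der

variable {n : ℕ} {M : Fin n → DGMod k}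

lemma der_zero (e : ℤ) (z : ⨂[k] i, M i) : der M e (fun _ => 0) z = 0 := by
  have : der M e (fun _ => 0) = 0 := tens_ext fun α x hx => by
    rw [der_tprod _ _ hx, LinearMap.zero_apply]
    refine Finset.sum_eq_zero fun i _ => ?_
    rw [LinearMap.zero_apply, MultilinearMap.map_update_zero, smul_zero]
  exact LinearMap.congr_fun this z

/-- In degree 0 the sign operators are identities, so no homogeneity is required, in contrast to
`der_tprod`. This matters because the eigenvectors of N are not assumed homogeneous. -/
lemma der_zero_tprod (θ : ∀ i, M i →ₗ[k] M i) (x : ∀ i, M i) :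
    der M 0 θ (PiTensorProduct.tprod k x) =
      ∑ i, PiTensorProduct.tprod k (Function.update x i (θ i (x i))) := by
  rw [der, LinearMap.sum_apply]
  refine Finset.sum_congr rfl fun i _ => ?_
  rw [place, PiTensorProduct.map_tprod]
  congr 1
  funext j
  rcases eq_or_ne j i with rfl | h
  · simp
  · simp only [Function.update_of_ne h]
    split_ifs
    · exact sgn_zero _ _
    · rfl

end der

namespace SymSeq

variable {O P : SymSeq k} {A B E : DGMod k}

lemma schur_ext {V : Type*} [AddCommGroup V] [Module k V] {f g : schur O A →ₗ[k] V}
    (h : ∀ n (o : O.obj n) (x : tpow A n),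
      f ((schurι O A n).lin (o ⊗ₜ x)) = g ((schurι O A n).lin (o ⊗ₜ x))) : f = g := by
  refine glue_ext fun n x => ?_
  have : f ∘ₗ (schurι O A n).lin = g ∘ₗ (schurι O A n).lin :=
    TensorProduct.ext' fun o x => h n o x
  exact LinearMap.congr_fun this x

lemma schur_gr_le {V : Type*} [AddCommGroup V] [Module k V] (φ : schur O A →ₗ[k] V) {m : ℤ}
    {S : Submodule k V} (h : ∀ n i j, i + j = m → ∀ o ∈ (O.obj n).gr i, ∀ x ∈ (tpow A n).gr j,
      φ ((schurι O A n).lin (o ⊗ₜ x)) ∈ S) {x : schur O A} (hx : x ∈ (schur O A).gr m) :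
    φ x ∈ S := by
  refine glue_gr_le φ (fun n x hx => ?_) hx
  have : tens2gr (O.obj n) (tpow A n) m ≤ S.comap (φ ∘ₗ (schurι O A n).lin) :=
    tens2gr_le _ _ fun i j hij o ho x hx => h n i j hij o ho x hx
  exact this hx

lemma schurThick_ι (deg : ℤ) (f : ∀ n, tpow A n →ₗ[k] tpow B n) (hf) (n : ℕ) (o : O.obj n)
    (x : tpow A n) : schurThick O deg f hf ((schurι O A n).lin (o ⊗ₜ x)) =
      (schurι O B n).lin ((O.obj n).sgn deg o ⊗ₜ f n x) :=
  schurLift_ι _ _ n (o ⊗ₜ x)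

lemma schurMap_ι (f : Mor A B) (n : ℕ) (o : O.obj n) (x : tpow A n) :
    schurMap O f ((schurι O A n).lin (o ⊗ₜ x)) =
      (schurι O B n).lin (o ⊗ₜ (tensMap fun _ => f).lin x) :=
  (schurThick_ι 0 _ _ n o x).trans (by rw [sgn_zero])

lemma schurι_mem {n : ℕ} {i j m : ℤ} {o : O.obj n} {x : tpow A n} (ho : o ∈ (O.obj n).gr i)
    (hx : x ∈ (tpow A n).gr j) (h : i + j = m) :
    (schurι O A n).lin (o ⊗ₜ x) ∈ (schur O A).gr m :=
  (schurι O A n).mem (tmul_mem _ _ ho hx h)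

lemma schur_d_ι (n : ℕ) (o : O.obj n) (x : tpow A n) :
    (schur O A).d ((schurι O A n).lin (o ⊗ₜ x)) =
      (schurι O A n).lin ((O.obj n).d o ⊗ₜ x) +
        (schurι O A n).lin ((O.obj n).sgn 1 o ⊗ₜ (tpow A n).d x) :=
  ((schurι O A n).comm (o ⊗ₜ x)).symm.trans (map_add (schurι O A n).lin _ _)

lemma schurThick_isDeg (deg : ℤ) (f : ∀ n, tpow A n →ₗ[k] tpow B n) (hf)
    (h : ∀ n, IsDeg deg (f n)) : IsDeg deg (schurThick O deg f hf) := by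
  intro m x hx
  refine schur_gr_le (schurThick O deg f hf) (fun n i j hij o ho x hx => ?_) hx
  rw [schurThick_ι]
  refine schurι_mem (i := i) ?_ (h n _ _ hx) (by omega)
  rw [sgn_mem _ _ ho]
  exact Submodule.smul_mem _ _ ho

/-- The Schur functor on morphisms of complexes, as a morphism of complexes. -/
def schurMor (O : SymSeq k) (f : Mor A B) : Mor (schur O A) (schur O B) where
  lin := schurMap O f
  mem := fun {i x} hx => by
    have := schurThick_isDeg (O := O) 0 (fun n => (tensMap fun _ : Fin n => f).lin)
      (fun _ σ x => (perm_tensMap (fun _ => f) σ x).symm) (fun n => Mor.isDeg _) i x hx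
    rwa [add_zero] at this
  comm := by
    have : schurMap O f ∘ₗ (schur O A).d = (schur O B).d ∘ₗ schurMap O f := by
      refine schur_ext fun n o x => ?_
      rw [LinearMap.comp_apply, LinearMap.comp_apply, schurMap_ι, schur_d_ι, map_add, schurMap_ι,
        schurMap_ι, schur_d_ι, Mor.comm]
    exact LinearMap.congr_fun this

lemma schurMap_comp (g : Mor B E) (f : Mor A B) (x : schur O A) :
    schurMap O (g.comp f) x = schurMap O g (schurMap O f x) := by
  have : schurMap O (g.comp f) = schurMap O g ∘ₗ schurMap O f := by
    refine schur_ext fun n o x => ?_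
    rw [LinearMap.comp_apply, schurMap_ι, schurMap_ι, schurMap_ι]
    have : (tensMap fun _ : Fin n => g.comp f).lin x =
        (tensMap fun _ : Fin n => g).lin ((tensMap fun _ : Fin n => f).lin x) :=
      LinearMap.congr_fun (PiTensorProduct.map_comp (fun _ : Fin n => g.lin)
        fun _ : Fin n => f.lin) x
    rw [this]
  exact LinearMap.congr_fun this x

end SymSeq

/-! ### Contractions up to division by a number operator -/

/-- Chain maps `f`, `g` with `fg = 1` and an operator `D` of degree `1` such that
`dD + Dd = -N`, where `N` is diagonalizable with eigenvalues in `ℕ` and with kernel the image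
of `g`. Dividing `D` by the eigenvalues of `N` gives a contraction. -/
structure NumberContraction (A B : DGMod k) where
  f : Mor A B
  g : Mor B A
  D : A →ₗ[k] A
  N : A →ₗ[k] A
  D_deg : IsDeg 1 D
  dD : ∀ x, A.d (D x) + D (A.d x) = -N x
  fg : ∀ y, f.lin (g.lin y) = y
  fD : ∀ x, f.lin (D x) = 0
  Dg : ∀ y, D (g.lin y) = 0
  DD : ∀ x, D (D x) = 0
  span_eq_top : Submodule.span k {x | ∃ m : ℕ, N x = (m : k) • x ∧
    (m = 0 → g.lin (f.lin x) = x)} = ⊤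

namespace NumberContraction

variable {A B : DGMod k} (L : NumberContraction A B)

/-- N is determined by D. Together with d² = 0, D² = 0 and fD = 0 this makes N of degree 0,
commuting with d and D, and annihilated by f, so that none of these has to be part of the structure.
-/
lemma N_eq : L.N = -(A.d ∘ₗ L.D + L.D ∘ₗ A.d) := by
  refine LinearMap.ext fun x => ?_
  rw [LinearMap.neg_apply, LinearMap.add_apply, LinearMap.comp_apply, LinearMap.comp_apply,
    L.dD, neg_neg]

lemma N_deg : IsDeg 0 L.N := by
  rw [N_eq]
  exact isDeg_neg (isDeg_add (isDeg_comp A.d_isDeg L.D_deg (by norm_num))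
    (isDeg_comp L.D_deg A.d_isDeg (by norm_num)))

lemma D_N (x : A) : L.D (L.N x) = L.N (L.D x) := by
  simp [N_eq, L.DD]

lemma d_N (x : A) : A.d (L.N x) = L.N (A.d x) := by
  simp [N_eq, A.d_d]

lemma f_N (x : A) : L.f.lin (L.N x) = 0 := by
  simp [N_eq, L.fD, L.f.comm]

lemma isNumberOp : IsNumberOp L.N := by
  refine eq_top_iff.2 (L.span_eq_top.symm.le.trans (Submodule.span_mono ?_))
  rintro x ⟨m, hx, -⟩
  exact ⟨m, hx⟩

/-- The contraction obtained by dividing `D` by the eigenvalues of `N`. -/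
def toContraction [Algebra ℚ k] : Contraction A B where
  f := L.f
  g := L.g
  h := L.isNumberOp.inv ∘ₗ L.D
  h_deg := by
    intro i x hx
    refine L.isNumberOp.inv_mem (fun y hy => ?_) (L.D_deg i x hx)
    have := L.N_deg _ y hy
    rwa [add_zero] at this
  homotopy := by
    have : A.d ∘ₗ L.isNumberOp.inv ∘ₗ L.D + L.isNumberOp.inv ∘ₗ L.D ∘ₗ A.d =
        L.g.lin ∘ₗ L.f.lin - LinearMap.id := by
      refine LinearMap.ext_on L.span_eq_top ?_
      rintro x ⟨m, hx, hx'⟩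
      -- The inverse of N commutes with d, so dh + hd is minus the inverse of N composed with N: it
      -- is 0 on the kernel of N and -1 on eigenvectors with nonzero eigenvalue.
      have h1 : A.d (L.isNumberOp.inv (L.D x)) + L.isNumberOp.inv (L.D (A.d x)) =
          -L.isNumberOp.inv (L.N x) := by
        rw [L.isNumberOp.inv_comm L.d_N, ← map_add, L.dD, map_neg]
      refine h1.trans ?_
      rw [hx, map_smul, L.isNumberOp.inv_apply hx, smul_smul, LinearMap.sub_apply,
        LinearMap.comp_apply, LinearMap.id_apply]
      rcases eq_or_ne m 0 with rfl | hm
      · simp [hx' rfl]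
      -- Here m f(x) = f(N x) = 0, and m is invertible in k. So gf - 1 is also -1 on x.
      · have h2 : L.f.lin x = 0 := by
          have := congrArg (invNat k m • ·) (L.f_N x)
          simpa [hx, smul_smul, invNat_mul hm] using this
        rw [mul_comm, invNat_mul hm, h2]
        simp
    exact LinearMap.congr_fun this
  fg := L.fg
  fh x := by
    have : L.f.lin ∘ₗ L.isNumberOp.inv ∘ₗ L.D = 0 := by
      refine L.isNumberOp.ext fun m x hx => ?_
      have h1 : L.N (L.D x) = (m : k) • L.D x := by rw [← L.D_N, hx, map_smul]
      rw [LinearMap.comp_apply, LinearMap.comp_apply, L.isNumberOp.inv_apply h1, map_smul, L.fD,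
        smul_zero]
      rfl
    exact LinearMap.congr_fun this x
  hh x := by
    rw [LinearMap.comp_apply, LinearMap.comp_apply, L.isNumberOp.inv_comm L.D_N, L.DD, map_zero,
      map_zero]
  hg y := by rw [LinearMap.comp_apply, L.Dg, map_zero]

/-- A tensor of eigenvectors has the sum of their eigenvalues as its eigenvalue. This is where
natural eigenvalues are essential: if the sum is zero then every eigenvalue is zero, so gf fixes
every factor and hence the tensor. -/
lemma tpow_span (n : ℕ) : Submodule.span k {z : tpow A n | ∃ m : ℕ,
    der (fun _ => A) 0 (fun _ => L.N) z = (m : k) • z ∧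
      (m = 0 → (tensMap fun _ => L.g).lin ((tensMap fun _ => L.f).lin z) = z)} = ⊤ := by
  refine eq_top_iff.2 ((span_tprod_eq_top fun _ : Fin n => L.span_eq_top).symm.le.trans
    (Submodule.span_mono ?_))
  rintro _ ⟨x, hx, rfl⟩
  choose m hm hm' using hx
  refine ⟨∑ i, m i, ?_, fun h => ?_⟩
  · rw [der_zero_tprod, Nat.cast_sum, Finset.sum_smul]
    refine Finset.sum_congr rfl fun i _ => ?_
    rw [hm, MultilinearMap.map_update_smul, Function.update_eq_self]
  · simp only [tensMap, PiTensorProduct.map_tprod]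
    congr 1
    funext i
    exact hm' i (by simpa using Finset.sum_eq_zero_iff.1 h i (Finset.mem_univ i))

/-- The differential of a tensor power is itself a derivation, so this is `der_comm` for d and D; as
both are odd, their graded commutator is dD + Dd. -/
lemma der_dD {n : ℕ} (x : tpow A n) : (tpow A n).d (der (fun _ => A) 1 (fun _ => L.D) x) +
    der (fun _ => A) 1 (fun _ => L.D) ((tpow A n).d x) =
      -der (fun _ => A) 0 (fun _ => L.N) x := by
  have h := der_comm (M := fun _ : Fin n => A) (e := -1) (e' := 1) (θ := fun _ => A.d)
    (θ' := fun _ => L.D) (fun _ => A.d_isDeg) (fun _ => L.D_deg) x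
  have h1 : sg k (-1 * 1) = -1 := by rw [mul_one, sg_neg, sg_one]
  have h2 : A.d ∘ₗ L.D - (-1 : k) • L.D ∘ₗ A.d = -L.N := by
    rw [N_eq, neg_neg, neg_one_smul, sub_neg_eq_add]
  rw [h1] at h
  simp only [h2, der_neg, ← tensD_eq_der] at h
  rw [neg_one_smul, sub_neg_eq_add] at h
  exact h

/-- Tensor powers, with `D` and `N` extended as derivations. -/
def tpow (n : ℕ) : NumberContraction (DGMod.tpow A n) (DGMod.tpow B n) where
  f := tensMap fun _ => L.f
  g := tensMap fun _ => L.g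
  D := der (fun _ => A) 1 fun _ => L.D
  N := der (fun _ => A) 0 fun _ => L.N
  D_deg := der_isDeg fun _ => L.D_deg
  dD := L.der_dD
  fg y := by
    have h := (PiTensorProduct.map_comp (fun _ : Fin n => L.f.lin) fun _ : Fin n => L.g.lin)
    have h' : (fun _ : Fin n => L.f.lin ∘ₗ L.g.lin) = fun _ => LinearMap.id := by
      funext _; exact LinearMap.ext L.fg
    rw [h', PiTensorProduct.map_id] at h
    exact (LinearMap.congr_fun h y).symm
  fD x := by
    refine (tensMap_der 1 (fun _ => L.f) (θ' := fun _ => 0) (fun i x => ?_) x).trans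
      (der_zero _ _)
    rw [L.fD, LinearMap.zero_apply]
  Dg y := by
    refine (tensMap_der 1 (fun _ => L.g) (θ := fun _ => 0) (fun i x => ?_) y).symm.trans ?_
    · rw [L.Dg, LinearMap.zero_apply, map_zero]
    · rw [der_zero, map_zero]
  DD x := der_der_self odd_one (fun _ => L.D_deg) (fun _ => L.DD) x
  span_eq_top := L.tpow_span n

lemma tpow_D_perm (n : ℕ) (σ : Equiv.Perm (Fin n)) (x : DGMod.tpow A n) :
    (L.tpow n).D ((perm (fun _ => A) σ).lin x) = (perm (fun _ => A) σ).lin ((L.tpow n).D x) :=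
  (perm_der (M := fun _ => A) 1 (fun _ => L.D_deg) σ x).symm

lemma tpow_N_perm (n : ℕ) (σ : Equiv.Perm (Fin n)) (x : DGMod.tpow A n) :
    (L.tpow n).N ((perm (fun _ => A) σ).lin x) = (perm (fun _ => A) σ).lin ((L.tpow n).N x) :=
  (perm_der (M := fun _ => A) 0 (fun _ => L.N_deg) σ x).symm

/-- The derivations D and N are equivariant by `perm_der`, and division by N inherits this through
`IsNumberOp.map_inv`. -/
lemma tpow_h_perm [Algebra ℚ k] (n : ℕ) (σ : Equiv.Perm (Fin n)) (x : DGMod.tpow A n) :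
    (L.tpow n).toContraction.h ((perm (fun _ => A) σ).lin x) =
      (perm (fun _ => A) σ).lin ((L.tpow n).toContraction.h x) := by
  refine (congrArg (L.tpow n).isNumberOp.inv (L.tpow_D_perm n σ x)).trans ?_
  exact ((L.tpow n).isNumberOp.map_inv (L.tpow n).isNumberOp
    (φ := (perm (fun _ => A) σ).lin) (fun x => (L.tpow_N_perm n σ x).symm) _).symm

/-- For fixed o, the map x ↦ [o ⊗ x] takes eigenvectors on the tensor power to eigenvectors on O[A]
with the same eigenvalue, and these classes span. -/
lemma schur_span (O : SymSeq k) : Submodule.span k {z : SymSeq.schur O A | ∃ m : ℕ,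
    schurThick O 0 (fun n => (L.tpow n).N) L.tpow_N_perm z = (m : k) • z ∧
      (m = 0 → (schurMor O L.g).lin ((schurMor O L.f).lin z) = z)} = ⊤ := by
  rw [← Submodule.ker_mkQ (Submodule.span k _), LinearMap.ker_eq_top]
  refine schur_ext fun n o x => ?_
  have hx : x ∈ Submodule.span k _ := ((L.tpow n).span_eq_top).symm.le (Submodule.mem_top (x := x))
  rw [LinearMap.zero_apply, Submodule.mkQ_apply, Submodule.Quotient.mk_eq_zero]
  refine Submodule.span_induction (p := fun x _ => (schurι O A n).lin (o ⊗ₜ x) ∈ _)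
    ?_ ?_ ?_ ?_ hx
  · rintro x ⟨m, hx, hx'⟩
    refine Submodule.subset_span ⟨m, ?_, fun h => ?_⟩
    · rw [schurThick_ι, sgn_zero, hx, TensorProduct.tmul_smul, map_smul]
    · refine (congrArg (schurMap O L.g) (schurMap_ι L.f n o x)).trans
        ((schurMap_ι L.g n o _).trans ?_)
      exact congrArg (fun y => (schurι O A n).lin (o ⊗ₜ y)) (hx' h)
  · rw [TensorProduct.tmul_zero, map_zero]; exact Submodule.zero_mem _
  · intro x y _ _ hx hy
    rw [TensorProduct.tmul_add, map_add]; exact Submodule.add_mem _ hx hy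
  · intro c x _ hx
    rw [TensorProduct.tmul_smul, map_smul]; exact Submodule.smul_mem _ _ hx

/-- The effect of a Schur functor. -/
def schur (O : SymSeq k) : NumberContraction (SymSeq.schur O A) (SymSeq.schur O B) where
  f := schurMor O L.f
  g := schurMor O L.g
  D := schurThick O 1 (fun n => (L.tpow n).D) L.tpow_D_perm
  N := schurThick O 0 (fun n => (L.tpow n).N) L.tpow_N_perm
  D_deg := schurThick_isDeg _ _ _ fun n => (L.tpow n).D_deg
  dD := by
    have : (SymSeq.schur O A).d ∘ₗ schurThick O 1 (fun n => (L.tpow n).D) L.tpow_D_perm +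
        schurThick O 1 (fun n => (L.tpow n).D) L.tpow_D_perm ∘ₗ (SymSeq.schur O A).d =
          -schurThick O 0 (fun n => (L.tpow n).N) L.tpow_N_perm := by
      refine schur_ext fun n o x => ?_
      have h1 := schurThick_ι 1 (fun n => (L.tpow n).D) L.tpow_D_perm n o x
      have h2 := schurThick_ι 1 (fun n => (L.tpow n).D) L.tpow_D_perm n ((O.obj n).d o) x
      have h3 := schurThick_ι 1 (fun n => (L.tpow n).D) L.tpow_D_perm n ((O.obj n).sgn 1 o)
        ((DGMod.tpow A n).d x)
      have h4 := schurThick_ι 0 (fun n => (L.tpow n).N) L.tpow_N_perm n o x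
      -- The two terms that contain d o cancel because `sgn 1` anticommutes with d. In the others
      -- `sgn 1` occurs twice, which leaves o ⊗ (dD + Dd) x.
      rw [LinearMap.add_apply, LinearMap.comp_apply, LinearMap.comp_apply, LinearMap.neg_apply,
        h1, h4, schur_d_ι, schur_d_ι, map_add, h2, h3, sgn_sgn, sgn_zero, sgn_d,
        TensorProduct.neg_tmul, map_neg]
      have h5 := congrArg (fun y => (schurι O A n).lin (o ⊗ₜ y)) ((L.tpow n).dD x)
      simp only [TensorProduct.tmul_add, TensorProduct.tmul_neg, map_add, map_neg] at h5
      rw [← h5]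
      abel
    exact LinearMap.congr_fun this
  fg := by
    have : schurMap O L.f ∘ₗ schurMap O L.g = LinearMap.id := by
      refine schur_ext fun n o x => ?_
      rw [LinearMap.comp_apply, schurMap_ι, schurMap_ι]
      exact congrArg (fun y => (schurι O B n).lin (o ⊗ₜ y)) ((L.tpow n).fg x)
    exact LinearMap.congr_fun this
  fD := by
    have : schurMap O L.f ∘ₗ schurThick O 1 (fun n => (L.tpow n).D) L.tpow_D_perm = 0 := by
      refine schur_ext fun n o x => ?_
      rw [LinearMap.comp_apply, schurThick_ι, schurMap_ι]
      refine (congrArg (fun y => (schurι O B n).lin ((O.obj n).sgn 1 o ⊗ₜ y))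
        ((L.tpow n).fD x)).trans ?_
      rw [TensorProduct.tmul_zero, map_zero]; rfl
    exact LinearMap.congr_fun this
  Dg := by
    have : schurThick O 1 (fun n => (L.tpow n).D) L.tpow_D_perm ∘ₗ schurMap O L.g = 0 := by
      refine schur_ext fun n o x => ?_
      rw [LinearMap.comp_apply, schurMap_ι, schurThick_ι]
      refine (congrArg (fun y => (schurι O A n).lin ((O.obj n).sgn 1 o ⊗ₜ y))
        ((L.tpow n).Dg x)).trans ?_
      rw [TensorProduct.tmul_zero, map_zero]; rfl
    exact LinearMap.congr_fun this
  DD := by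
    have : schurThick O 1 (fun n => (L.tpow n).D) L.tpow_D_perm ∘ₗ
        schurThick O 1 (fun n => (L.tpow n).D) L.tpow_D_perm = 0 := by
      refine schur_ext fun n o x => ?_
      rw [LinearMap.comp_apply, schurThick_ι, schurThick_ι, (L.tpow n).DD,
        TensorProduct.tmul_zero, map_zero]; rfl
    exact LinearMap.congr_fun this
  span_eq_top := L.schur_span O

/-- The homotopy on `O[A]` is induced by the homotopies on the tensor powers. -/
lemma schur_h [Algebra ℚ k] (O : SymSeq k) : (L.schur O).toContraction.h =
    schurThick O 1 (fun n => (L.tpow n).toContraction.h) L.tpow_h_perm := by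
  refine schur_ext fun n o x => ?_
  rw [schurThick_ι]
  refine (congrArg (L.schur O).isNumberOp.inv (schurThick_ι 1 _ L.tpow_D_perm n o x)).trans ?_
  -- The map y ↦ [±o ⊗ y] intertwines the two operators N, since N has degree 0 and produces no sign
  -- in passing o.
  refine ((L.tpow n).isNumberOp.map_inv (L.schur O).isNumberOp
    (φ := (schurι O A n).lin ∘ₗ TensorProduct.mk k _ _ ((O.obj n).sgn 1 o)) (fun y => ?_) _).symm
  refine Eq.symm ((schurThick_ι 0 _ L.tpow_N_perm n _ y).trans ?_)
  rw [sgn_zero]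
  rfl

end NumberContraction

namespace Contraction

variable {A B : DGMod k} (C : Contraction A B)

/-- A contraction as a `NumberContraction` with `N = 1 - gf`. -/
def toNumber : NumberContraction A B where
  f := C.f
  g := C.g
  D := C.h
  N := LinearMap.id - C.g.lin ∘ₗ C.f.lin
  D_deg := C.h_deg
  dD x := by simp [C.homotopy]
  fg := C.fg
  fD := C.fh
  Dg := C.hg
  DD := C.hh
  span_eq_top := by
    refine eq_top_iff.2 fun x _ => ?_
    -- Since fg = 1, the operator gf is idempotent; the two summands are eigenvectors of 1 - gf with
    -- eigenvalues 0 and 1.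
    have : x = C.g.lin (C.f.lin x) + (x - C.g.lin (C.f.lin x)) := by abel
    rw [this]
    exact Submodule.add_mem _ (Submodule.subset_span ⟨0, by simp [C.fg]⟩)
      (Submodule.subset_span ⟨1, by simp [C.fg]⟩)

end Contraction

end

noncomputable section

open DGMod SymSeq

variable {k : Type u} [CommRing k]

/-! ### The pseudo-derivation property -/

lemma Fin.append_update_castAdd {α : Type*} {p q : ℕ} (x : Fin p → α) (y : Fin q → α)
    (i : Fin p) (a : α) : Function.update (Fin.append x y) (Fin.castAdd q i) a =
      Fin.append (Function.update x i a) y := by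
  funext j
  refine Fin.addCases (fun j => ?_) (fun j => ?_) j
  · rcases eq_or_ne j i with rfl | h
    · simp
    · rw [Function.update_of_ne (by simpa using h)]
      simp [h]
  · rw [Function.update_of_ne (fun h => by have := congrArg Fin.val h; simp at this; omega)]
    simp

lemma Fin.append_update_natAdd {α : Type*} {p q : ℕ} (x : Fin p → α) (y : Fin q → α)
    (i : Fin q) (a : α) : Function.update (Fin.append x y) (Fin.natAdd p i) a =
      Fin.append x (Function.update y i a) := by
  funext j
  refine Fin.addCases (fun j => ?_) (fun j => ?_) j
  · rw [Function.update_of_ne (fun h => by have := congrArg Fin.val h; simp at this; omega)]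
    simp
  · rcases eq_or_ne j i with rfl | h
    · simp
    · rw [Function.update_of_ne (by simpa using h)]
      simp [h]

lemma mulEquiv_tprod {A : DGMod k} {p q : ℕ} (x : Fin p → A) (y : Fin q → A) :
    Thick.mulEquiv A p q (PiTensorProduct.tprod k x ⊗ₜ PiTensorProduct.tprod k y) =
      PiTensorProduct.tprod k (Fin.append x y) :=
  TensorPower.tprod_mul_tprod k x y

/-- The Leibniz rule for concatenation: the p + q positions split into the first p and the last q,
and an operator in one of the latter first has to pass x. It expresses D and N on A^{⊗(p+q)} through
those on the two factors. -/
lemma der_mulEquiv {A : DGMod k} (e : ℤ) (θ : A →ₗ[k] A) {p q : ℕ} (x : tpow A p)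
    (y : tpow A q) : der (fun _ => A) e (fun _ => θ) (Thick.mulEquiv A p q (x ⊗ₜ y)) =
      Thick.mulEquiv A p q (der (fun _ => A) e (fun _ => θ) x ⊗ₜ y +
        (tpow A p).sgn e x ⊗ₜ der (fun _ => A) e (fun _ => θ) y) := by
  have : der (fun _ => A) e (fun _ => θ) ∘ₗ (Thick.mulEquiv A p q).toLinearMap =
      (Thick.mulEquiv A p q).toLinearMap ∘ₗ
        (TensorProduct.map (der (fun _ => A) e (fun _ => θ)) LinearMap.id +
          TensorProduct.map ((tpow A p).sgn e) (der (fun _ => A) e (fun _ => θ))) := by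
    refine TensorProduct.ext (tens_ext fun α x hx => tens_ext fun β y hy => ?_)
    have hxy : ∀ j, Fin.append x y j ∈ A.gr (Fin.append α β j) := by
      intro j
      refine Fin.addCases (fun j => ?_) (fun j => ?_) j
      · simpa using hx j
      · simpa using hy j
    simp only [LinearMap.compr₂ₛₗ_apply, TensorProduct.mk_apply, LinearMap.comp_apply,
      LinearEquiv.coe_coe, LinearMap.add_apply, TensorProduct.map_tmul, LinearMap.id_apply,
      map_add]
    erw [mulEquiv_tprod]
    rw [der_tprod (M := fun _ => A) _ _ hxy, der_tprod (M := fun _ => A) _ _ hx,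
      der_tprod (M := fun _ => A) _ _ hy, (tpow A p).sgn_mem e (tprod_mem hx rfl),
      Fin.sum_univ_add, TensorProduct.sum_tmul, TensorProduct.tmul_sum, map_sum, map_sum]
    congr 1
    · refine Finset.sum_congr rfl fun i _ => ?_
      rw [Fin.append_update_castAdd, ← TensorProduct.smul_tmul', map_smul, mulEquiv_tprod,
        Fin.sum_univ_add]
      have h1 : ∀ j : Fin q, ¬ Fin.natAdd p j < Fin.castAdd q i := fun j h => by
        have := Fin.lt_def.1 h
        simp at this
        omega
      have h2 : ∀ j : Fin p, Fin.castAdd q j < Fin.castAdd q i ↔ j < i := fun j => Iff.rfl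
      simp [h1, h2]
    · refine Finset.sum_congr rfl fun i _ => ?_
      rw [Fin.append_update_natAdd, TensorProduct.tmul_smul, ← TensorProduct.smul_tmul',
        map_smul, map_smul, mulEquiv_tprod, Fin.sum_univ_add, smul_smul, ← sg_add, ← mul_add]
      have h1 : ∀ j : Fin p, Fin.castAdd q j < Fin.natAdd p i := fun j => by
        rw [Fin.lt_def]
        simp
        omega
      simp [h1, add_comm]
  exact LinearMap.congr_fun this (x ⊗ₜ y)

/-- The arithmetic behind the pseudo-derivation property. With the convention 1/0 = 0 the identity
can fail when just one of a, b vanishes; such cases are treated separately by the vanishing of D on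
the image of g. -/
lemma invNat_add_mul [Algebra ℚ k] {a b : ℕ} (ha : a ≠ 0) (hb : b ≠ 0) :
    invNat k (a + b) * (invNat k a + invNat k b) = invNat k a * invNat k b := by
  have ha' : (a : ℚ) ≠ 0 := by exact_mod_cast ha
  have hb' : (b : ℚ) ≠ 0 := by exact_mod_cast hb
  have hab : (a : ℚ) + b ≠ 0 := by positivity
  rw [invNat, invNat, invNat, ← map_add, ← map_mul, ← map_mul]
  congr 1
  push_cast
  field_simp
  ring

namespace NumberContraction

variable {A B : DGMod k} (L : NumberContraction A B)

lemma h_apply [Algebra ℚ k] {m : ℕ} {x : A} (hx : L.N x = (m : k) • x) :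
    L.toContraction.h x = invNat k m • L.D x :=
  L.isNumberOp.inv_apply (by rw [← L.D_N, hx, map_smul])

lemma sgn_D (x : A) : A.sgn 1 (L.D x) = -L.D (A.sgn 1 x) := by
  rw [L.D_deg.sgn_apply, one_mul, sg_one, neg_one_smul]

lemma N_sgn (x : A) : L.N (A.sgn 1 x) = A.sgn 1 (L.N x) := by
  rw [L.N_deg.sgn_apply, mul_zero, sg_zero, one_smul]

/-- By the Leibniz rule for N, the concatenation of x and y is an eigenvector with eigenvalue a + b,
so the homotopy is the Leibniz expansion of D divided by a + b. -/
lemma restrict_tmul [Algebra ℚ k] {p q a b : ℕ} {x : DGMod.tpow A p} {y : DGMod.tpow A q}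
    (hx : (L.tpow p).N x = (a : k) • x) (hy : (L.tpow q).N y = (b : k) • y) :
    Thick.restrict (fun n => (L.tpow n).toContraction.h) p q (x ⊗ₜ y) =
      invNat k (a + b) • ((L.tpow p).D x ⊗ₜ y + (DGMod.tpow A p).sgn 1 x ⊗ₜ (L.tpow q).D y) := by
  have h : (L.tpow (p + q)).N (Thick.mulEquiv A p q (x ⊗ₜ y)) =
      ((a + b : ℕ) : k) • Thick.mulEquiv A p q (x ⊗ₜ y) := by
    refine (der_mulEquiv 0 L.N x y).trans ?_
    rw [sgn_zero]
    refine (congrArg (Thick.mulEquiv A p q) (congrArg₂ (fun u v => u ⊗ₜ y + x ⊗ₜ v) hx hy)).trans ?_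
    rw [← TensorProduct.smul_tmul', TensorProduct.tmul_smul, ← add_smul, map_smul, Nat.cast_add]
  refine (congrArg (Thick.mulEquiv A p q).symm ((L.tpow (p + q)).h_apply h)).trans ?_
  rw [map_smul]
  refine congrArg _ ?_
  refine (congrArg (Thick.mulEquiv A p q).symm (der_mulEquiv 1 L.D x y)).trans ?_
  rw [LinearEquiv.symm_apply_apply]
  rfl

/-- It suffices to evaluate on x ⊗ y for eigenvectors with eigenvalues a and b. Dividing by a + b
for the total homotopy and by a or b for the partial ones, all terms with D applied twice to the
same factor vanish. Both composites then become (1/(a+b))(1/a + 1/b) times the same tensor, up to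
the sign in the statement. -/
lemma isPseudoDerivation [Algebra ℚ k] :
    Thick.IsPseudoDerivation fun n => (L.tpow n).toContraction.h := by
  intro p q
  suffices H : ∀ x ∈ {x | ∃ m : ℕ, (L.tpow p).N x = (m : k) • x ∧
      (m = 0 → (L.tpow p).g.lin ((L.tpow p).f.lin x) = x)},
      ∀ y ∈ {y | ∃ m : ℕ, (L.tpow q).N y = (m : k) • y ∧
        (m = 0 → (L.tpow q).g.lin ((L.tpow q).f.lin y) = y)},
      Thick.commutator (fun n => (L.tpow n).toContraction.h) p q
        (Thick.restrict (fun n => (L.tpow n).toContraction.h) p q (x ⊗ₜ y)) =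
          Thick.tensor (fun n => (L.tpow n).toContraction.h) p q (x ⊗ₜ y) ∧
      -Thick.restrict (fun n => (L.tpow n).toContraction.h) p q
        (Thick.commutator (fun n => (L.tpow n).toContraction.h) p q (x ⊗ₜ y)) =
          Thick.tensor (fun n => (L.tpow n).toContraction.h) p q (x ⊗ₜ y) by
    exact ⟨TensorProduct.ext (LinearMap.ext_on (L.tpow p).span_eq_top fun x hx =>
        LinearMap.ext_on (L.tpow q).span_eq_top fun y hy => (H x hx y hy).1),
      TensorProduct.ext (LinearMap.ext_on (L.tpow p).span_eq_top fun x hx =>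
        LinearMap.ext_on (L.tpow q).span_eq_top fun y hy => (H x hx y hy).2)⟩
  rintro x ⟨a, hx, hx0⟩ y ⟨b, hy, hy0⟩
  set sx := (DGMod.tpow A p).sgn 1 x with hsx
  have hDx : (L.tpow p).N ((L.tpow p).D x) = (a : k) • (L.tpow p).D x := by
    rw [← D_N, hx, map_smul]
  have hDy : (L.tpow q).N ((L.tpow q).D y) = (b : k) • (L.tpow q).D y := by
    rw [← D_N, hy, map_smul]
  have hs : (L.tpow p).N sx = (a : k) • sx := by
    rw [hsx, N_sgn, hx, map_smul]
  have hsD : (DGMod.tpow A p).sgn 1 ((L.tpow p).D x) = -(L.tpow p).D sx := (L.tpow p).sgn_D x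
  have hT : Thick.tensor (fun n => (L.tpow n).toContraction.h) p q (x ⊗ₜ y) =
      (invNat k a * invNat k b) • (L.tpow p).D sx ⊗ₜ (L.tpow q).D y := by
    have : Thick.tensor (fun n => (L.tpow n).toContraction.h) p q (x ⊗ₜ y) =
      (L.tpow p).toContraction.h sx ⊗ₜ (L.tpow q).toContraction.h y := rfl
    rw [this, h_apply _ hs, h_apply _ hy, TensorProduct.smul_tmul_smul]
  have hC : ∀ (x : DGMod.tpow A p) (y : DGMod.tpow A q),
      Thick.commutator (fun n => (L.tpow n).toContraction.h) p q (x ⊗ₜ y) =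
        (L.tpow p).toContraction.h x ⊗ₜ y -
          (DGMod.tpow A p).sgn 1 x ⊗ₜ (L.tpow q).toContraction.h y := fun _ _ => rfl
  -- If a = 0 then x lies in the image of g, hence D x = 0 and both sides vanish; likewise for b =
  -- 0. Otherwise the scalars agree.
  have hI : (invNat k (a + b) * (invNat k a + invNat k b)) •
      (L.tpow p).D sx ⊗ₜ[k] (L.tpow q).D y =
        (invNat k a * invNat k b) • (L.tpow p).D sx ⊗ₜ[k] (L.tpow q).D y := by
    rcases eq_or_ne a 0 with rfl | ha
    · have : (L.tpow p).D sx = 0 := by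
        rw [← neg_eq_zero, ← hsD, ← hx0 rfl, Dg, map_zero]
      rw [this, TensorProduct.zero_tmul, smul_zero, smul_zero]
    rcases eq_or_ne b 0 with rfl | hb
    · have : (L.tpow q).D y = 0 := by rw [← hy0 rfl, Dg]
      rw [this, TensorProduct.tmul_zero, smul_zero, smul_zero]
    rw [invNat_add_mul ha hb]
  rw [hT, ← hI]
  constructor
  · rw [L.restrict_tmul hx hy, map_smul, map_add, hC, hC, h_apply _ hDx, h_apply _ hs,
      h_apply _ hy, h_apply _ hDy, DD, DD, hsD, mul_smul, add_smul]
    congr 1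
    simp only [smul_zero, TensorProduct.zero_tmul, TensorProduct.tmul_zero, zero_sub, sub_zero,
      TensorProduct.neg_tmul, TensorProduct.tmul_smul, ← TensorProduct.smul_tmul']
    module
  · rw [hC, h_apply _ hx, h_apply _ hy, map_sub, TensorProduct.tmul_smul,
      ← TensorProduct.smul_tmul', map_smul, map_smul, L.restrict_tmul hDx hy,
      L.restrict_tmul hs hDy, DD, DD, hsD, TensorProduct.zero_tmul, TensorProduct.tmul_zero,
      zero_add, add_zero, TensorProduct.neg_tmul]
    module

end NumberContraction

/-! ### The symmetrized tensor trick homotopy -/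

/-- Each permutation attains its maximum on S at exactly one element. Composition with a
transposition inside S shows that all elements of S are equally often the place of the maximum, so
each one accounts for n!/|S| permutations. -/
lemma card_perm_max {n : ℕ} (S : Finset (Fin n)) {i : Fin n} (hi : i ∈ S) :
    S.card * (Finset.univ.filter fun σ : Equiv.Perm (Fin n) => ∀ j ∈ S, σ j ≤ σ i).card =
      n.factorial := by
  have h1 : ∀ i' ∈ S, (Finset.univ.filter fun σ : Equiv.Perm (Fin n) => ∀ j ∈ S,
      σ j ≤ σ i').card = (Finset.univ.filter fun σ : Equiv.Perm (Fin n) => ∀ j ∈ S,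
      σ j ≤ σ i).card := by
    intro i' hi'
    have hmem : ∀ j ∈ S, Equiv.swap i i' j ∈ S := by
      intro j hj
      rw [Equiv.swap_apply_def]
      split_ifs <;> assumption
    refine Finset.card_bij' (fun σ _ => σ * Equiv.swap i i') (fun σ _ => σ * Equiv.swap i i')
      ?_ ?_ ?_ ?_
    · intro σ hσ
      simp only [Finset.mem_filter, Finset.mem_univ, true_and, Equiv.Perm.mul_apply,
        Equiv.swap_apply_left] at hσ ⊢
      exact fun j hj => hσ _ (hmem j hj)
    · intro σ hσ
      simp only [Finset.mem_filter, Finset.mem_univ, true_and, Equiv.Perm.mul_apply,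
        Equiv.swap_apply_right] at hσ ⊢
      exact fun j hj => hσ _ (hmem j hj)
    · intro σ _; rw [mul_assoc, Equiv.swap_mul_self, mul_one]
    · intro σ _; rw [mul_assoc, Equiv.swap_mul_self, mul_one]
  rw [← smul_eq_mul, ← Finset.sum_const, ← Finset.sum_congr rfl h1]
  simp only [Finset.card_filter]
  rw [Finset.sum_comm]
  have h2 : ∀ σ : Equiv.Perm (Fin n),
      ∑ i' ∈ S, (if ∀ j ∈ S, σ j ≤ σ i' then 1 else 0) = 1 := by
    intro σ
    obtain ⟨m, hm, hmax⟩ := S.exists_max_image σ ⟨i, hi⟩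
    rw [Finset.sum_eq_single_of_mem m hm, if_pos hmax]
    intro j hj hjm
    refine if_neg fun h => hjm ?_
    exact σ.injective (le_antisymm (hmax j hj) (h m hm))
  rw [Finset.sum_congr rfl fun σ _ => h2 σ]
  simp [Fintype.card_perm]

namespace Contraction

variable {A B : DGMod k} (C : Contraction A B)

/-- Each summand is factored as gf in the later positions followed by the signed placement of h. The
signs then sit only in `place`, and the remaining factor is a tensor product of morphisms. -/
lemma trick_eq (n : ℕ) (z : tpow A n) : C.trick n z = ∑ i, place (fun _ => A) 1 i C.h
    ((tensMap fun j => if i < j then C.g.comp C.f else Mor.id A).lin z) := by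
  rw [trick, LinearMap.sum_apply]
  refine Finset.sum_congr rfl fun i _ => ?_
  rw [place, tensMap]
  refine Eq.trans ?_ (LinearMap.congr_fun (PiTensorProduct.map_comp _ _) z)
  congr 2
  funext j
  rcases lt_trichotomy j i with h | rfl | h
  · rw [if_pos h, Function.update_of_ne h.ne, if_pos h, if_neg h.not_gt]
    rfl
  · simp only [lt_irrefl, if_false, if_true, Function.update_self]
    rfl
  · rw [if_neg h.not_gt, if_neg h.ne', Function.update_of_ne h.ne', if_neg h.not_gt, if_pos h]
    rfl

/-- Conjugation by σ compares positions by their images under σ: beside h in position i, the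
projection gf acts on those j that σ places after i. The Koszul signs of σ and σ⁻¹ cancel. -/
lemma perm_trick (n : ℕ) (σ : Equiv.Perm (Fin n)) (z : tpow A n) :
    (perm (fun _ => A) σ⁻¹).lin (C.trick n ((perm (fun _ => A) σ).lin z)) =
      ∑ i, place (fun _ => A) 1 i C.h
        ((tensMap fun j => if σ i < σ j then C.g.comp C.f else Mor.id A).lin z) := by
  have hinv : ∀ w : tpow A n, (perm (fun _ => A) σ⁻¹).lin ((perm (fun _ => A) σ).lin w) = w := by
    intro w
    have := perm_mul A σ⁻¹ σ w
    rw [inv_mul_cancel] at this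
    exact this.symm.trans (perm_one A w)
  rw [trick_eq, map_sum]
  refine (Fintype.sum_equiv σ _ _ fun i => ?_).symm
  have h1 := perm_tensMap (fun j => if σ i < σ j then C.g.comp C.f else Mor.id A) σ z
  simp only [Equiv.apply_symm_apply] at h1
  have h2 := perm_place (M := fun _ => A) 1 i C.h_deg σ (σ i) C.h (σ.symm_apply_apply i) HEq.rfl
    ((tensMap fun j => if σ i < σ j then C.g.comp C.f else Mor.id A).lin z)
  rw [h1] at h2
  exact (hinv _).symm.trans (congrArg (perm (fun _ => A) σ⁻¹).lin h2)

/-- Elements split into those fixed and those killed by `gf`. -/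
lemma span_fixed_or_killed : Submodule.span k {x : A | ∃ m : ℕ, m ≤ 1 ∧
    C.g.lin (C.f.lin x) = (1 - m : k) • x} = ⊤ := by
  refine eq_top_iff.2 fun x _ => ?_
  have : x = C.g.lin (C.f.lin x) + (x - C.g.lin (C.f.lin x)) := by abel
  rw [this]
  exact Submodule.add_mem _ (Submodule.subset_span ⟨0, by simp [C.fg]⟩)
    (Submodule.subset_span ⟨1, by simp [C.fg]⟩)

/-- The symmetrized tensor trick homotopy is obtained from the derivation `∑ 1 ⊗ h ⊗ 1` by
dividing by the eigenvalues of `∑ 1 ⊗ (1 - gf) ⊗ 1`. -/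
lemma symTrick_eq [Algebra ℚ k] (n : ℕ) :
    C.symTrick n = (C.toNumber.tpow n).toContraction.h := by
  refine LinearMap.ext_on (span_tprod_eq_top fun _ : Fin n => C.span_fixed_or_killed) ?_
  rintro _ ⟨x, hx, rfl⟩
  choose m hm hx using hx
  classical
  -- S is the set of factors killed by gf; all other factors are fixed by gf.
  set S : Finset (Fin n) := Finset.univ.filter fun i => m i = 1 with hS
  have hmem : ∀ i, i ∈ S ↔ m i = 1 := fun i => by simp [hS]
  have hfix : ∀ i, i ∉ S → C.g.lin (C.f.lin (x i)) = x i := fun i hi => by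
    have h0 : m i = 0 := by
      have := hm i
      have := (hmem i).not.1 hi
      omega
    simpa [h0] using hx i
  have hkill : ∀ i, i ∈ S → C.g.lin (C.f.lin (x i)) = 0 := fun i hi => by
    simpa [(hmem i).1 hi] using hx i
  have hN : (C.toNumber.tpow n).N (PiTensorProduct.tprod k x) =
      (S.card : k) • PiTensorProduct.tprod k x := by
    refine (der_zero_tprod (M := fun _ => A) _ x).trans ?_
    have : ∀ i, PiTensorProduct.tprod k (Function.update x i (C.toNumber.N (x i))) =
        if i ∈ S then PiTensorProduct.tprod k x else 0 := by
      intro i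
      have h1 : C.toNumber.N (x i) = x i - C.g.lin (C.f.lin (x i)) := rfl
      rw [h1]
      split_ifs with h
      · rw [hkill i h, sub_zero, Function.update_eq_self]
      · rw [hfix i h, sub_self, MultilinearMap.map_update_zero]
    rw [Finset.sum_congr rfl fun i _ => this i, Finset.sum_ite_mem, Finset.univ_inter,
      Finset.sum_const, Nat.cast_smul_eq_nsmul]
  rw [NumberContraction.h_apply _ hN]
  have hplace : ∀ i, i ∉ S → place (fun _ => A) 1 i C.h (PiTensorProduct.tprod k x) = 0 := by
    intro i hi
    rw [place, PiTensorProduct.map_tprod]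
    refine (PiTensorProduct.tprod k).map_coord_zero i ?_
    rw [Function.update_self, ← hfix i hi, C.hg]
  -- Applying gf after position σ i kills the tensor if some killed factor is moved there, and
  -- otherwise changes nothing.
  have htens : ∀ (σ : Equiv.Perm (Fin n)) (i : Fin n),
      (tensMap fun j => if σ i < σ j then C.g.comp C.f else Mor.id A).lin
        (PiTensorProduct.tprod k x) =
          if ∀ j ∈ S, σ j ≤ σ i then PiTensorProduct.tprod k x else 0 := by
    intro σ i
    rw [tensMap]
    refine (PiTensorProduct.map_tprod _ _).trans ?_
    split_ifs with h
    · congr 1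
      funext j
      split_ifs with hj
      · exact hfix j fun hjS => (h j hjS).not_gt hj
      · rfl
    · push Not at h
      obtain ⟨j, hj, hij⟩ := h
      refine (PiTensorProduct.tprod k).map_coord_zero j ?_
      rw [if_pos hij]
      exact hkill j hj
  -- For i ∈ S the coefficient n!/|S| counts the permutations for which σ i is maximal on σ(S). For
  -- i ∉ S the factor x i lies in the image of g, so h kills it.
  have hsum : ∀ i, ∑ σ : Equiv.Perm (Fin n), place (fun _ => A) 1 i C.h
      ((tensMap fun j => if σ i < σ j then C.g.comp C.f else Mor.id A).lin
        (PiTensorProduct.tprod k x)) =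
      (algebraMap ℚ k n.factorial * invNat k S.card) •
        place (fun _ => A) 1 i C.h (PiTensorProduct.tprod k x) := by
    intro i
    by_cases hi : i ∈ S
    · have h1 : ∀ σ : Equiv.Perm (Fin n), place (fun _ => A) 1 i C.h
          ((tensMap fun j => if σ i < σ j then C.g.comp C.f else Mor.id A).lin
            (PiTensorProduct.tprod k x)) = if ∀ j ∈ S, σ j ≤ σ i then
              place (fun _ => A) 1 i C.h (PiTensorProduct.tprod k x) else 0 := by
        intro σ
        rw [htens]
        split_ifs
        · rfl
        · exact map_zero _
      rw [Finset.sum_congr rfl fun σ _ => h1 σ, ← Finset.sum_filter, Finset.sum_const,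
        ← Nat.cast_smul_eq_nsmul k]
      congr 1
      rw [← card_perm_max S hi, natCast_eq_algebraMap, invNat, ← map_mul]
      congr 1
      have : (S.card : ℚ) ≠ 0 := by exact_mod_cast (Finset.card_pos.2 ⟨i, hi⟩).ne'
      push_cast
      field_simp
    · rw [hplace i hi, smul_zero]
      refine Finset.sum_eq_zero fun σ _ => ?_
      rw [htens]
      split_ifs
      · exact hplace i hi
      · exact map_zero _
  have hL : C.symTrick n (PiTensorProduct.tprod k x) =
      algebraMap ℚ k ((n.factorial : ℚ)⁻¹) • ∑ i, ∑ σ : Equiv.Perm (Fin n),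
        place (fun _ => A) 1 i C.h
          ((tensMap fun j => if σ i < σ j then C.g.comp C.f else Mor.id A).lin
            (PiTensorProduct.tprod k x)) := by
    rw [symTrick, LinearMap.smul_apply, LinearMap.sum_apply, Finset.sum_comm]
    congr 1
    exact Finset.sum_congr rfl fun σ _ => C.perm_trick n σ _
  rw [hL, Finset.sum_congr rfl fun i _ => hsum i, ← Finset.smul_sum, smul_smul, ← mul_assoc,
    ← map_mul, inv_mul_cancel₀ (by exact_mod_cast n.factorial_ne_zero), map_one, one_mul]
  congr 1
  exact (LinearMap.sum_apply _ _ _).symm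

end Contraction

end

noncomputable section

open DGMod SymSeq

variable {k : Type u} [CommRing k]

/-! ### Derivations and the distribution map -/

section distr

variable {n m : ℕ} {r : Fin n → ℕ} {X : Fin n → DGMod k} {Y : Fin m → DGMod k}
  {Z : Fin n → DGMod k}

/-- The total degree in front of slot c of block i after distributing: all earlier blocks, the head
of block i if c > 0, and the entries of block i before the slot. It is the exponent that an operator
in this slot picks up. -/
lemma sum_tgtKey_lt (e : (Σ i, Fin (r i)) ≃ Fin m) (p : Fin n ⊕ Fin m → ℤ) (i : Fin n) (c : ℕ) :
    (∑ w, if tgtKey e w < toLex (i, c) then p w else 0) =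
      (∑ i', if i' < i then p (.inl i') + ∑ j, p (.inr (e ⟨i', j⟩)) else 0) +
        ((if 0 < c then p (.inl i) else 0) +
          ∑ j : Fin (r i), if (j : ℕ) + 1 < c then p (.inr (e ⟨i, j⟩)) else 0) := by
  rw [← Equiv.sum_comp (flatE e), Fintype.sum_sigma]
  have h : ∀ i', (∑ a : Option (Fin (r i')), if tgtKey e (flatE e ⟨i', a⟩) < toLex (i, c) then
      p (flatE e ⟨i', a⟩) else 0) =
      (if i' < i then p (.inl i') + ∑ j, p (.inr (e ⟨i', j⟩)) else 0) +
        if i' = i then ((if 0 < c then p (.inl i') else 0) +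
          ∑ j : Fin (r i'), if (j : ℕ) + 1 < c then p (.inr (e ⟨i', j⟩)) else 0) else 0 := by
    intro i'
    simp only [tgtKey_flatE, Fintype.sum_option, Prod.Lex.toLex_lt_toLex]
    rcases lt_trichotomy i' i with h | rfl | h
    · simp [h, h.ne, flatE]
    · simp [flatE, optKey]
    · simp [h.not_gt, h.ne']
  simp only [h, Finset.sum_add_distrib, Finset.sum_ite_eq', Finset.mem_univ, if_true]

/-- The distribution map is compatible with derivations. -/
lemma distr_der {ε : ℤ} (e : (Σ i, Fin (r i)) ≃ Fin m)
    (g : ∀ i, X i →ₗ[k] (⨂[k] j, Y (e ⟨i, j⟩)) →ₗ[k] Z i)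
    (hg : ∀ i (a : ℤ) (b : Fin (r i) → ℤ) (x : X i) (y : ∀ j, Y (e ⟨i, j⟩)), x ∈ (X i).gr a →
      (∀ j, y j ∈ (Y (e ⟨i, j⟩)).gr (b j)) →
        g i x (PiTensorProduct.tprod k y) ∈ (Z i).gr (a + ∑ j, b j))
    {θX : ∀ i, X i →ₗ[k] X i} {θY : ∀ l, Y l →ₗ[k] Y l} {θZ : ∀ i, Z i →ₗ[k] Z i}
    (hX : ∀ i, IsDeg ε (θX i)) (hY : ∀ l, IsDeg ε (θY l))
    (h : ∀ i x y, θZ i (g i x y) = g i (θX i x) y +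
      g i ((X i).sgn ε x) (der (fun j => Y (e ⟨i, j⟩)) ε (fun j => θY (e ⟨i, j⟩)) y))
    (x : ⨂[k] i, X i) (y : ⨂[k] l, Y l) :
    der Z ε θZ (distr X Y e g x y) = distr X Y e g (der X ε θX x) y +
      distr X Y e g ((tens X).sgn ε x) (der Y ε θY y) := by
  have : (distr X Y e g).compr₂ (der Z ε θZ) = distr X Y e g ∘ₗ der X ε θX +
      (distr X Y e g).compl₂ (der Y ε θY) ∘ₗ (tens X).sgn ε := by
    refine distr_ext fun α β x y hx hy => ?_
    simp only [LinearMap.compr₂_apply, LinearMap.add_apply, LinearMap.comp_apply,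
      LinearMap.compl₂_apply]
    -- On homogeneous tensors both sides become sums over positions; the positions of the y's are
    -- grouped into blocks by e, so the two sides are compared block by block.
    rw [(tens X).sgn_mem ε (tprod_mem hx rfl), map_smul, LinearMap.smul_apply,
      distr_tprod e g hx hy,
      map_smul, der_tprod (M := Z) _ _ fun i => hg i _ _ _ _ (hx i) fun j => hy (e ⟨i, j⟩),
      der_tprod _ _ hx, der_tprod _ _ hy, map_sum, LinearMap.sum_apply, map_sum, Finset.smul_sum,
      Finset.smul_sum, ← Equiv.sum_comp e, Fintype.sum_sigma, ← Finset.sum_add_distrib]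
    refine Finset.sum_congr rfl fun i _ => ?_
    simp only [map_smul, LinearMap.smul_apply]
    rw [distr_tprod e g (update_mem_add (hX i) hx) hy, h, MultilinearMap.map_update_add, smul_add,
      smul_add, smul_smul, smul_smul, (X i).sgn_mem ε (hx i), map_smul, LinearMap.smul_apply,
      der_tprod (M := fun j => Y (e ⟨i, j⟩)) _ _ fun j => hy (e ⟨i, j⟩), map_sum,
      MultilinearMap.map_update_smul, MultilinearMap.map_update_sum]
    simp only [map_smul, MultilinearMap.map_update_smul, Finset.smul_sum, smul_smul]
    -- For an operator on the factor z, this trades passing the factors before z in the target order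
    -- for passing those before z in the source order.
    have key := fun z => kos_update_add srcKey_inj (tgtKey_inj e) (Sum.elim α β) z ε
    congr 1
    · have h1 : (fun i' => g i' (Function.update x i (θX i (x i)) i')
          (PiTensorProduct.tprod k fun j => y (e ⟨i', j⟩))) =
          Function.update (fun i' => g i' (x i') (PiTensorProduct.tprod k fun j => y (e ⟨i', j⟩)))
            i (g i (θX i (x i)) (PiTensorProduct.tprod k fun j => y (e ⟨i, j⟩))) := by
        funext i'
        rcases eq_or_ne i' i with rfl | hi
        · simp
        · simp [hi]
      rw [h1]
      refine congrArg (· • _) ?_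
      rw [← sg_add, ← sg_add]
      refine sg_congr k ?_
      have h2 := key (.inl i)
      -- The head of block i is preceded by the full earlier blocks in the target order, but only by
      -- the earlier x's in the source order.
      have h3 : (∑ w, if tgtKey e w < tgtKey e (.inl i) then Sum.elim α β w else 0) =
          ∑ i', if i' < i then α i' + ∑ j, β (e ⟨i', j⟩) else 0 := by
        have h6 : tgtKey e (.inl i) = toLex (i, 0) := rfl
        rw [h6, sum_tgtKey_lt e (Sum.elim α β) i 0]
        simp
      have h4 : (∑ w, if srcKey (w : Fin n ⊕ Fin m) < srcKey (.inl i) then Sum.elim α β w else 0) =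
          ∑ i', if i' < i then α i' else 0 := by
        rw [Fintype.sum_sum_type]
        simp [srcKey]
      have h5 : Function.update (Sum.elim α β) (.inl i) (Sum.elim α β (.inl i) + ε) =
          Sum.elim (Function.update α i (α i + ε)) β := by
        rw [Sum.update_elim_inl]; rfl
      rw [h3, h4, h5] at h2
      exact h2
    · refine Finset.sum_congr rfl fun j _ => ?_
      rw [distr_tprod e g hx (update_mem_add (hY (e ⟨i, j⟩)) hy), smul_smul]
      have h1 : (fun i' => g i' (x i') (PiTensorProduct.tprod k fun j' =>
          Function.update y (e ⟨i, j⟩) (θY (e ⟨i, j⟩) (y (e ⟨i, j⟩))) (e ⟨i', j'⟩))) =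
          Function.update (fun i' => g i' (x i') (PiTensorProduct.tprod k fun j => y (e ⟨i', j⟩)))
            i (g i (x i) (PiTensorProduct.tprod k (Function.update (fun j => y (e ⟨i, j⟩)) j
              (θY (e ⟨i, j⟩) (y (e ⟨i, j⟩)))))) := by
        funext i'
        rcases eq_or_ne i' i with rfl | hi
        · rw [Function.update_self]
          congr 2
          funext j'
          rcases eq_or_ne j' j with rfl | hj
          · simp
          · rw [Function.update_of_ne hj, Function.update_of_ne]
            intro h
            have := e.injective h
            simp at this
            exact hj this
        · rw [Function.update_of_ne hi]
          congr 2
          funext j'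
          rw [Function.update_of_ne]
          intro h
          exact hi (congrArg Sigma.fst (e.injective h))
      rw [h1]
      refine congrArg (· • _) ?_
      simp only [← sg_add]
      refine sg_congr k ?_
      have h2 := key (.inr (e ⟨i, j⟩))
      -- A y in block i is preceded in the target order also by the head of its block and by the
      -- earlier entries there; in the source order all x's precede it, which accounts for the sign
      -- operator on x.
      have h3 : (∑ w, if tgtKey e w < tgtKey e (.inr (e ⟨i, j⟩)) then Sum.elim α β w else 0) =
          (∑ i', if i' < i then α i' + ∑ j, β (e ⟨i', j⟩) else 0) +
            (α i + ∑ j', if j' < j then β (e ⟨i, j'⟩) else 0) := by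
        have h6 : tgtKey e (.inr (e ⟨i, j⟩)) = toLex (i, (j : ℕ) + 1) := by
          simpa [flatE, optKey] using tgtKey_flatE e ⟨i, some j⟩
        have := sum_tgtKey_lt e (Sum.elim α β) i (j + 1)
        rw [h6, this]
        simp
      have h4 : (∑ w, if srcKey (w : Fin n ⊕ Fin m) < srcKey (.inr (e ⟨i, j⟩)) then
          Sum.elim α β w else 0) = (∑ i', α i') + ∑ l, if l < e ⟨i, j⟩ then β l else 0 := by
        rw [Fintype.sum_sum_type]
        simp [srcKey]
      have h5 : Function.update (Sum.elim α β) (.inr (e ⟨i, j⟩))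
          (Sum.elim α β (.inr (e ⟨i, j⟩)) + ε) =
          Sum.elim α (Function.update β (e ⟨i, j⟩) (β (e ⟨i, j⟩) + ε)) := by
        rw [Sum.update_elim_inr]; rfl
      rw [h3, h4, h5] at h2
      push_cast at h2 ⊢
      linear_combination h2
  exact LinearMap.congr_fun₂ this x y

/-- Naturality of the distribution map. -/
lemma distr_natural (e : (Σ i, Fin (r i)) ≃ Fin m) {X' : Fin n → DGMod k} {Y' : Fin m → DGMod k}
    {Z' : Fin n → DGMod k} (f : ∀ i, Mor (X i) (X' i)) (ρ : ∀ l, Mor (Y l) (Y' l))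
    (φ : ∀ i, Z i →ₗ[k] Z' i) (g : ∀ i, X i →ₗ[k] (⨂[k] j, Y (e ⟨i, j⟩)) →ₗ[k] Z i)
    (g' : ∀ i, X' i →ₗ[k] (⨂[k] j, Y' (e ⟨i, j⟩)) →ₗ[k] Z' i)
    (h : ∀ i x y, g' i ((f i).lin x) ((tensMap fun j => ρ (e ⟨i, j⟩)).lin y) = φ i (g i x y))
    (x : ⨂[k] i, X i) (y : ⨂[k] l, Y l) :
    distr X' Y' e g' ((tensMap f).lin x) ((tensMap ρ).lin y) =
      PiTensorProduct.map φ (distr X Y e g x y) := by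
  have : (distr X' Y' e g').compl₂ (tensMap ρ).lin ∘ₗ (tensMap f).lin =
      (distr X Y e g).compr₂ (PiTensorProduct.map φ) := by
    refine distr_ext fun α β x y hx hy => ?_
    rw [LinearMap.comp_apply, LinearMap.compl₂_apply, LinearMap.compr₂_apply,
      distr_tprod _ _ hx hy]
    simp only [tensMap, PiTensorProduct.map_tprod, map_smul]
    rw [distr_tprod _ _ (fun i => (f i).mem (hx i)) fun l => (ρ l).mem (hy l)]
    congr 2
    funext i
    rw [← h]
    simp only [tensMap, PiTensorProduct.map_tprod]
  exact LinearMap.congr_fun₂ this x y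

end distr

/-! ### The comparison map (O ∘ P)[A] → O[P[A]]: Leibniz operators and naturality. -/

namespace SymSeq

section comp

variable {O P : SymSeq k} {A B : DGMod k}

lemma schurComp_ι {m : ℕ} (c : CompIdx m) (o : O.obj c.n) (x : ⨂[k] i, P.obj (c.r i))
    (y : tpow A m) :
    schurComp O P A ((schurι (comp O P) A m).lin ((compι O P c).lin (o ⊗ₜ x) ⊗ₜ y)) =
      (schurι O (schur P A) c.n).lin (o ⊗ₜ schurDistr P A c x y) := by
  refine (schurLift_ι (O := comp O P) _ _ m _).trans ?_
  exact LinearMap.congr_fun (compLift_ι (schurCompAux O P A) schurCompAux_slide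
    schurCompAux_block c (o ⊗ₜ x)) y

lemma schur_comp_ext {V : Type*} [AddCommGroup V] [Module k V] {f g : schur (comp O P) A →ₗ[k] V}
    (h : ∀ m (c : CompIdx m) (o : O.obj c.n) (x : ⨂[k] i, P.obj (c.r i)) (y : tpow A m),
      f ((schurι (comp O P) A m).lin ((compι O P c).lin (o ⊗ₜ x) ⊗ₜ y)) =
        g ((schurι (comp O P) A m).lin ((compι O P c).lin (o ⊗ₜ x) ⊗ₜ y))) : f = g := by
  refine schur_ext (O := comp O P) fun m w y => ?_
  have : (f ∘ₗ (schurι (comp O P) A m).lin) ∘ₗ (TensorProduct.mk k _ (tpow A m)).flip y =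
      (g ∘ₗ (schurι (comp O P) A m).lin) ∘ₗ (TensorProduct.mk k _ (tpow A m)).flip y :=
    comp_ext fun c o x => h m c o x y
  exact LinearMap.congr_fun this w

lemma schurSeq_ι (φ : Hom O P) (n : ℕ) (o : O.obj n) (x : tpow A n) :
    schurSeq φ A ((schurι O A n).lin (o ⊗ₜ x)) =
      (schurι P A n).lin ((φ.app n).lin o ⊗ₜ x) :=
  schurLift_ι _ _ n (o ⊗ₜ x)

lemma compMap_ι {O' P' : SymSeq k} (φ : Hom O O') (ψ : Hom P P') {m : ℕ} (c : CompIdx m)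
    (o : O.obj c.n) (x : ⨂[k] i, P.obj (c.r i)) :
    compMap φ ψ m ((compι O P c).lin (o ⊗ₜ x)) = (compι O' P' c).lin
      ((φ.app c.n).lin o ⊗ₜ (tensMap fun i => ψ.app (c.r i)).lin x) :=
  compLift_ι _ _ _ c (o ⊗ₜ x)

lemma schurDistr_hom {m : ℕ} (c : CompIdx m) (i : Fin c.n) (a : ℤ) (b : Fin (c.r i) → ℤ)
    (x : P.obj (c.r i)) (y : Fin (c.r i) → A) (hx : x ∈ (P.obj (c.r i)).gr a)
    (hy : ∀ j, y j ∈ A.gr (b j)) :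
    TensorProduct.curry (schurι P A (c.r i)).lin x (PiTensorProduct.tprod k y) ∈
      (schur P A).gr (a + ∑ j, b j) :=
  schurι_mem hx (tprod_mem hy rfl) rfl

/-- `Θ` is the operator on `O[A]` induced by operators `ω` on `O` and `θ` on `A` of degree `e`
by the Leibniz rule. -/
def IsSchurDer (e : ℤ) (ω : ∀ n, O.obj n →ₗ[k] O.obj n) (θ : A →ₗ[k] A)
    (Θ : schur O A →ₗ[k] schur O A) : Prop :=
  ∀ n o x, Θ ((schurι O A n).lin (o ⊗ₜ x)) = (schurι O A n).lin (ω n o ⊗ₜ x) +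
    (schurι O A n).lin ((O.obj n).sgn e o ⊗ₜ der (fun _ => A) e (fun _ => θ) x)

lemma sgn_neg_one (A : DGMod k) : A.sgn (-1) = A.sgn 1 := by
  refine A.hom_ext fun i x hx => ?_
  rw [A.sgn_mem _ hx, A.sgn_mem _ hx, one_mul, neg_one_mul, sg_neg]

/-- The differential is a Leibniz operator with ω the differential of O, whereas the operators D and
N extended from A have ω = 0. Thus `schurComp_der` covers both the chain map property and the
compatibility with D and N. -/
lemma isSchurDer_d : IsSchurDer (-1) (fun n => (O.obj n).d) A.d (schur O A).d := by
  intro n o x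
  rw [schur_d_ι, sgn_neg_one]
  exact congrArg (fun y => _ + (schurι O A n).lin ((O.obj n).sgn 1 o ⊗ₜ y))
    (LinearMap.congr_fun tensD_eq_der x)

lemma isSchurDer_thick {deg : ℤ} {θ : A →ₗ[k] A} (hf) : IsSchurDer (O := O) deg (fun _ => 0) θ
    (schurThick O deg (fun n => der (fun _ : Fin n => A) deg fun _ => θ) hf) := by
  intro n o x
  rw [schurThick_ι, LinearMap.zero_apply, TensorProduct.zero_tmul, map_zero, zero_add]

lemma sgn_compι {m : ℕ} (e : ℤ) (c : CompIdx m) (o : O.obj c.n) (x : ⨂[k] i, P.obj (c.r i)) :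
    ((comp O P).obj m).sgn e ((compι O P c).lin (o ⊗ₜ x)) = (compι O P c).lin
      ((O.obj c.n).sgn e o ⊗ₜ (tens fun i => P.obj (c.r i)).sgn e x) := by
  refine ((compι O P c).sgn_apply e (o ⊗ₜ x)).symm.trans (congrArg _ ?_)
  have : (compM O P c).sgn e = TensorProduct.map ((O.obj c.n).sgn e)
      ((tens fun i => P.obj (c.r i)).sgn e) := by
    refine tens2_ext _ _ fun i j a ha b hb => ?_
    rw [(compM O P c).sgn_mem e (tmul_mem _ _ ha hb rfl), TensorProduct.map_tmul,
      (O.obj c.n).sgn_mem e ha, sgn_mem _ e hb, TensorProduct.smul_tmul_smul, mul_add, sg_add]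
  exact LinearMap.congr_fun this (o ⊗ₜ x)

/-- The comparison map `(O ∘ P)[A] → O[P[A]]` is compatible with derivations. -/
lemma schurComp_der {e : ℤ} {ωO : ∀ n, O.obj n →ₗ[k] O.obj n} {ωP : ∀ n, P.obj n →ₗ[k] P.obj n}
    {θ : A →ₗ[k] A} (hωP : ∀ n, IsDeg e (ωP n)) (hθ : IsDeg e θ)
    {ωOP : ∀ n, (comp O P).obj n →ₗ[k] (comp O P).obj n}
    (hω : ∀ m (c : CompIdx m) (o : O.obj c.n) (x : ⨂[k] i, P.obj (c.r i)),
      ωOP m ((compι O P c).lin (o ⊗ₜ x)) = (compι O P c).lin (ωO c.n o ⊗ₜ x) +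
        (compι O P c).lin ((O.obj c.n).sgn e o ⊗ₜ
          der (fun i => P.obj (c.r i)) e (fun i => ωP (c.r i)) x))
    {ΘP : schur P A →ₗ[k] schur P A} (hP : IsSchurDer e ωP θ ΘP)
    {ΘOP : schur (comp O P) A →ₗ[k] schur (comp O P) A}
    (hOP : IsSchurDer (O := comp O P) e ωOP θ ΘOP)
    {Θ : schur O (schur P A) →ₗ[k] schur O (schur P A)} (hΘ : IsSchurDer e ωO ΘP Θ)
    (w : schur (comp O P) A) : schurComp O P A (ΘOP w) = Θ (schurComp O P A w) := by
  have : schurComp O P A ∘ₗ ΘOP = Θ ∘ₗ schurComp O P A := by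
    refine schur_comp_ext fun m c o x y => ?_
    have h1 := distr_der (Z := fun _ => schur P A) (X := fun i => P.obj (c.r i))
      (Y := fun _ => A) (ε := e) c.e
      (fun i => TensorProduct.curry (schurι P A (c.r i)).lin) (schurDistr_hom c)
      (θX := fun i => ωP (c.r i)) (θY := fun _ => θ) (θZ := fun _ => ΘP)
      (fun i => hωP _) (fun _ => hθ) (fun i x y => hP (c.r i) x y) x y
    have h2 := (hOP m ((compι O P c).lin (o ⊗ₜ x)) y).trans (congrArg₂ (· + ·)
      ((congrArg (fun z : (comp O P).obj m => (schurι (comp O P) A m).lin (z ⊗ₜ y))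
        (hω m c o x)).trans ((congrArg (schurι (comp O P) A m).lin
          (TensorProduct.add_tmul _ _ _)).trans (map_add _ _ _)))
      (congrArg (fun z : (comp O P).obj m => (schurι (comp O P) A m).lin
        (z ⊗ₜ der (fun _ => A) e (fun _ => θ) y)) (sgn_compι e c o x)))
    refine (congrArg (schurComp O P A) h2).trans ?_
    rw [LinearMap.comp_apply, schurComp_ι, hΘ, map_add, map_add,
      schurComp_ι, schurComp_ι, schurComp_ι, add_assoc]
    congr 1
    rw [← map_add, ← TensorProduct.tmul_add]
    exact congrArg (fun z => (schurι O (schur P A) c.n).lin ((O.obj c.n).sgn e o ⊗ₜ z)) h1.symm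
  exact LinearMap.congr_fun this w

lemma schurComp_d (w : schur (comp O P) A) :
    schurComp O P A ((schur (comp O P) A).d w) =
      (schur O (schur P A)).d (schurComp O P A w) := by
  refine schurComp_der (fun n => (P.obj n).d_isDeg) A.d_isDeg (fun m c o x => ?_) isSchurDer_d
    (isSchurDer_d (O := comp O P)) isSchurDer_d w
  refine ((compι O P c).comm (o ⊗ₜ x)).symm.trans ((map_add (compι O P c).lin _ _).trans ?_)
  rw [sgn_neg_one]
  exact congrArg (fun y => _ + (compι O P c).lin ((O.obj c.n).sgn 1 o ⊗ₜ y))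
    (LinearMap.congr_fun tensD_eq_der x)

/-- The case in which nothing acts on the symmetric sequences. It is used for D with e = 1 and for N
with e = 0. -/
lemma schurComp_thick {e : ℤ} {θ : A →ₗ[k] A} (hθ : IsDeg e θ)
    {Θ : schur P A →ₗ[k] schur P A} (hf1) (hf2) (hf3)
    (hΘ : Θ = schurThick P e (fun n => der (fun _ : Fin n => A) e fun _ => θ) hf1)
    (w : schur (comp O P) A) :
    schurComp O P A (schurThick (comp O P) e (fun n => der (fun _ : Fin n => A) e fun _ => θ)
      hf2 w) = schurThick O e (fun n => der (fun _ : Fin n => schur P A) e fun _ => Θ) hf3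
        (schurComp O P A w) := by
  refine schurComp_der (ωO := fun _ => 0) (ωP := fun _ => 0) (ωOP := fun _ => 0)
    (fun n i x hx => Submodule.zero_mem _) hθ (fun m c o x => ?_)
    (hΘ ▸ isSchurDer_thick hf1) (isSchurDer_thick (O := comp O P) hf2) (isSchurDer_thick hf3) w
  rw [der_zero, LinearMap.zero_apply, TensorProduct.zero_tmul, TensorProduct.tmul_zero, map_zero,
    add_zero]
  rfl

lemma schurDistr_mem {m : ℕ} (c : CompIdx m) {i j l : ℤ} {x : ⨂[k] i, P.obj (c.r i)}
    {y : tpow A m} (hx : x ∈ (tens fun i => P.obj (c.r i)).gr i) (hy : y ∈ (tpow A m).gr j)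
    (h : i + j = l) : schurDistr P A c x y ∈ (tpow (schur P A) c.n).gr l := by
  have h1 : tensGr (fun i => P.obj (c.r i)) i ≤
      ((tpow (schur P A) c.n).gr l).comap ((schurDistr P A c).flip y) := by
    refine tensGr_le fun α x hx hα => ?_
    have h2 : tensGr (fun _ : Fin m => A) j ≤
        ((tpow (schur P A) c.n).gr l).comap (schurDistr P A c (PiTensorProduct.tprod k x)) := by
      refine tensGr_le fun β y hy hβ => ?_
      rw [Submodule.mem_comap, schurDistr, distr_tprod (Y := fun _ => A)
        (Z := fun _ => schur P A) _ _ hx hy]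
      refine Submodule.smul_mem _ _ (tprod_mem (M := fun _ => schur P A)
        (fun i => schurDistr_hom c i _ _ _ _ (hx i) fun j => hy _) ?_)
      rw [Finset.sum_add_distrib, hα, ← Fintype.sum_sigma', Equiv.sum_comp c.e β, hβ, h]
    exact h2 hy
  exact h1 hx

lemma comp_gr_le {V : Type*} [AddCommGroup V] [Module k V] {N : ℕ} (φ : compObj O P N →ₗ[k] V)
    {m : ℤ} {S : Submodule k V} (h : ∀ (c : CompIdx N) i j, i + j = m → ∀ o ∈ (O.obj c.n).gr i,
      ∀ x ∈ (tens fun i => P.obj (c.r i)).gr j, φ ((compι O P c).lin (o ⊗ₜ x)) ∈ S)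
    {x : compObj O P N} (hx : x ∈ (compObj O P N).gr m) : φ x ∈ S := by
  refine glue_gr_le φ (fun c x hx => ?_) hx
  have : tens2gr (O.obj c.n) (tens fun i => P.obj (c.r i)) m ≤
      S.comap (φ ∘ₗ (compι O P c).lin) :=
    tens2gr_le _ _ fun i j hij o ho x hx => h c i j hij o ho x hx
  exact this hx

variable (O P A) in
/-- The comparison map `(O ∘ P)[A] → O[P[A]]` as a morphism of complexes. -/
def schurCompMor : Mor (schur (comp O P) A) (schur O (schur P A)) where
  lin := schurComp O P A
  mem := fun {l x} hx => by
    refine schur_gr_le (O := comp O P) (schurComp O P A) (fun m i j hij w hw y hy => ?_) hx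
    let φ : (comp O P).obj m →ₗ[k] schur O (schur P A) :=
      (schurComp O P A ∘ₗ (schurι (comp O P) A m).lin) ∘ₗ (TensorProduct.mk k _ (tpow A m)).flip y
    refine comp_gr_le (O := O) (P := P) φ (m := i) (fun c a b hab o ho x hx => ?_) hw
    refine (schurComp_ι c o x y).symm ▸ ?_
    exact schurι_mem ho (schurDistr_mem c hx hy rfl) (by omega)
  comm := schurComp_d

variable (A) in
/-- The Schur functor on morphisms of symmetric sequences, as a morphism of complexes. -/
def schurSeqMor (φ : Hom O P) : Mor (schur O A) (schur P A) where
  lin := schurSeq φ A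
  mem := fun {l x} hx => by
    refine schur_gr_le (schurSeq φ A) (fun m i j hij o ho x hx => ?_) hx
    rw [schurSeq_ι]
    exact schurι_mem ((φ.app m).mem ho) hx hij
  comm := by
    have : schurSeq φ A ∘ₗ (schur O A).d = (schur P A).d ∘ₗ schurSeq φ A := by
      refine schur_ext fun n o x => ?_
      rw [LinearMap.comp_apply, LinearMap.comp_apply, schurSeq_ι, schur_d_ι, map_add, schurSeq_ι,
        schurSeq_ι, schur_d_ι, Mor.comm, Mor.sgn_apply]
    exact LinearMap.congr_fun this

lemma schurSeq_thick (φ : Hom O P) {e : ℤ} (f : ∀ n, tpow A n →ₗ[k] tpow B n) (hf)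
    (x : schur O A) :
    schurSeq φ B (schurThick O e f hf x) = schurThick P e f hf (schurSeq φ A x) := by
  have : schurSeq φ B ∘ₗ schurThick O e f hf = schurThick P e f hf ∘ₗ schurSeq φ A := by
    refine schur_ext fun n o x => ?_
    rw [LinearMap.comp_apply, LinearMap.comp_apply, schurThick_ι, schurSeq_ι, schurSeq_ι,
      schurThick_ι, Mor.sgn_apply]
  exact LinearMap.congr_fun this x

/-- Naturality of the comparison map in the complex. -/
lemma schurComp_natural (f : Mor A B) (w : schur (comp O P) A) :
    schurComp O P B (schurMap (comp O P) f w) =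
      schurMap O (schurMor P f) (schurComp O P A w) := by
  have : schurComp O P B ∘ₗ schurMap (comp O P) f =
      schurMap O (schurMor P f) ∘ₗ schurComp O P A := by
    refine schur_comp_ext fun m c o x y => ?_
    have h1 := schurMap_ι (O := comp O P) f m ((compι O P c).lin (o ⊗ₜ x)) y
    rw [LinearMap.comp_apply, LinearMap.comp_apply, h1, schurComp_ι, schurComp_ι, schurMap_ι]
    refine congrArg (fun z => (schurι O (schur P B) c.n).lin (o ⊗ₜ z)) ?_
    exact distr_map (Y := fun _ => B) (Y' := fun _ => A) (Z := fun _ => schur P B)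
      (Z' := fun _ => schur P A) c.e (fun _ => f) (fun _ => schurMap P f) _ _
      (fun i x y => (schurMap_ι f _ x y).symm) x y
  exact LinearMap.congr_fun this w

/-- Naturality of the comparison map in the symmetric sequences. -/
lemma schurComp_compMap {O' P' : SymSeq k} (φ : Hom O O') (ψ : Hom P P') {m : ℕ}
    (w : compObj O P m) (y : tpow A m) :
    schurComp O' P' A ((schurι (comp O' P') A m).lin (compMap φ ψ m w ⊗ₜ y)) =
      schurSeq φ _ (schurMap O (schurSeqMor A ψ)
        (schurComp O P A ((schurι (comp O P) A m).lin (w ⊗ₜ y)))) := by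
  have : (schurComp O' P' A ∘ₗ (schurι (comp O' P') A m).lin) ∘ₗ
      (TensorProduct.mk k _ (tpow A m)).flip y ∘ₗ compMap φ ψ m =
      (schurSeq φ _ ∘ₗ schurMap O (schurSeqMor A ψ) ∘ₗ schurComp O P A ∘ₗ
        (schurι (comp O P) A m).lin) ∘ₗ (TensorProduct.mk k _ (tpow A m)).flip y := by
    refine comp_ext fun c o x => ?_
    have h1 : schurComp O' P' A ((schurι (comp O' P') A m).lin
        (compMap φ ψ m ((compι O P c).lin (o ⊗ₜ x)) ⊗ₜ y)) =
        schurSeq φ _ (schurMap O (schurSeqMor A ψ) (schurComp O P A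
          ((schurι (comp O P) A m).lin ((compι O P c).lin (o ⊗ₜ x) ⊗ₜ y)))) := by
      rw [compMap_ι, schurComp_ι, schurComp_ι, schurMap_ι, schurSeq_ι]
      refine congrArg (fun z => (schurι O' (schur P' A) c.n).lin ((φ.app c.n).lin o ⊗ₜ z)) ?_
      have := distr_natural (X := fun i => P.obj (c.r i)) (X' := fun i => P'.obj (c.r i))
        (Y := fun _ => A) (Y' := fun _ => A) (Z := fun _ => schur P A)
        (Z' := fun _ => schur P' A) c.e (fun i => ψ.app (c.r i)) (fun _ => Mor.id A)
        (fun _ => schurSeq ψ A) (fun i => TensorProduct.curry (schurι P A (c.r i)).lin)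
        (fun i => TensorProduct.curry (schurι P' A (c.r i)).lin)
        (fun i x y => by
          have h2 : (tensMap fun _ : Fin (c.r i) => Mor.id A).lin y = y :=
            LinearMap.congr_fun PiTensorProduct.map_id y
          refine (congrArg _ h2).trans ?_
          exact (schurSeq_ι ψ _ x y).symm) x y
      refine Eq.trans (congrArg _ ?_) this
      exact (LinearMap.congr_fun PiTensorProduct.map_id y).symm
    exact h1
  exact LinearMap.congr_fun this w

end comp

end SymSeq

end

noncomputable section

open DGMod SymSeq

variable {k : Type u} [CommRing k]

/-! ### Koszul signs of iterated distribution maps -/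

section signs

variable {n m N : ℕ} {r : Fin n → ℕ}

/-- The position of `l` after grouping according to `e`. -/
def blockKey (e : (Σ i, Fin (r i)) ≃ Fin m) (l : Fin m) : Fin n ×ₗ ℕ :=
  toLex ((e.symm l).1, (e.symm l).2.val)

lemma blockKey_apply (e : (Σ i, Fin (r i)) ≃ Fin m) (i : Fin n) (j : Fin (r i)) :
    blockKey e (e ⟨i, j⟩) = toLex (i, (j : ℕ)) := by
  rw [blockKey, Equiv.symm_apply_apply]

lemma blockKey_inj (e : (Σ i, Fin (r i)) ≃ Fin m) : Function.Injective (blockKey e) := by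
  have : Function.Injective (blockKey e ∘ e) := by
    rintro ⟨i, j⟩ ⟨i', j'⟩ h
    simp only [Function.comp, blockKey_apply, EmbeddingLike.apply_eq_iff_eq, Prod.mk.injEq] at h
    obtain ⟨rfl, h⟩ := h
    rw [Fin.ext h]
  exact (Function.Injective.of_comp_iff' _ e.bijective).1 this

/-- The sign exponent of the distribution map. -/
lemma kos_tgtKey (e : (Σ i, Fin (r i)) ≃ Fin m) (α : Fin n → ℤ) (β : Fin m → ℤ) :
    kos srcKey (tgtKey e) (Sum.elim α β) =
      (∑ i, α i * ∑ l, if (e.symm l).1 < i then β l else 0) + kos id (blockKey e) β := by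
  -- The inversions are sorted by type. Two x's are never inverted, and no y precedes an x in the
  -- source; x i is inverted with the y's of earlier blocks, and two y's are inverted exactly when
  -- the grouping inverts them.
  have h1 : ∀ i i' : Fin n, ¬ (srcKey (.inl i : Fin n ⊕ Fin m) < srcKey (.inl i') ∧
      tgtKey e (.inl i') < tgtKey e (.inl i)) := by
    rintro i i' ⟨h1, h2⟩
    rw [srcKey, srcKey, Sum.Lex.inl_lt_inl_iff] at h1
    simp only [tgtKey, Prod.Lex.toLex_lt_toLex, lt_irrefl, and_false, or_false] at h2
    exact lt_asymm h1 h2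
  have h2 : ∀ (l : Fin m) (i : Fin n), ¬ (srcKey (.inr l : Fin n ⊕ Fin m) < srcKey (.inl i) ∧
      tgtKey e (.inl i) < tgtKey e (.inr l)) := fun l i h => Sum.Lex.not_inr_lt_inl h.1
  have h3 : ∀ (i : Fin n) (l : Fin m), (srcKey (.inl i : Fin n ⊕ Fin m) < srcKey (.inr l) ∧
      tgtKey e (.inr l) < tgtKey e (.inl i)) ↔ (e.symm l).1 < i := by
    intro i l
    simp [srcKey, tgtKey, Prod.Lex.toLex_lt_toLex]
  have h4 : ∀ l l' : Fin m, (srcKey (.inr l : Fin n ⊕ Fin m) < srcKey (.inr l') ∧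
      tgtKey e (.inr l') < tgtKey e (.inr l)) ↔ (id l < id l' ∧
        blockKey e l' < blockKey e l) := by
    intro l l'
    simp [srcKey, tgtKey, blockKey, Prod.Lex.toLex_lt_toLex]
  simp only [kos, Fintype.sum_sum_type, Sum.elim_inl, Sum.elim_inr, h1, h2, h3, h4, if_false,
    Finset.sum_const_zero, zero_add, Finset.mul_sum, mul_ite, mul_zero]

/-- The Koszul exponent is quadratic in the degrees, and the last sum is its polarization. It is
needed when each moved item is a compound with its own degree and the total degree of its inputs. -/
lemma kos_add (b : Fin m → Fin n ×ₗ ℕ) (β γ : Fin m → ℤ) :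
    kos id b (fun l => β l + γ l) = kos id b β + kos id b γ +
      ∑ l, ∑ l', ((if l < l' ∧ b l' < b l then 1 else 0) +
        if l' < l ∧ b l < b l' then 1 else 0) * (β l * γ l') := by
  have h : ∑ l, ∑ l', (if l' < l ∧ b l < b l' then (1 : ℤ) else 0) * (β l * γ l') =
      ∑ l, ∑ l', (if l < l' ∧ b l' < b l then 1 else 0) * (β l' * γ l) := Finset.sum_comm
  simp only [add_mul, Finset.sum_add_distrib]
  rw [h]
  simp only [kos, ← Finset.sum_add_distrib]
  refine Finset.sum_congr rfl fun l _ => Finset.sum_congr rfl fun l' _ => ?_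
  simp only [id]
  split_ifs <;> ring

/-- The equivalence lists the blocks one after another, so the position of an element is the total
size of the earlier blocks plus its index in its own block. -/
lemma finSigmaFinEquiv_lt {r : Fin n → ℕ} {a b : Σ i, Fin (r i)}
    (h : toLex (a.1, (a.2 : ℕ)) < toLex (b.1, (b.2 : ℕ))) :
    finSigmaFinEquiv a < finSigmaFinEquiv b := by
  obtain ⟨i, j⟩ := a
  obtain ⟨i', j'⟩ := b
  rw [Fin.lt_def, finSigmaFinEquiv_apply, finSigmaFinEquiv_apply]
  rw [Prod.Lex.toLex_lt_toLex] at h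
  dsimp only at h ⊢
  have hsum : ∀ i : Fin n, ∑ x : Fin i.val, r (Fin.castLE i.2.le x) = ∑ x with x < i, r x := by
    intro i
    refine Finset.sum_bij (fun x _ => Fin.castLE i.2.le x) ?_ ?_ ?_ ?_
    · intro x _
      exact Finset.mem_filter.2 ⟨Finset.mem_univ _, x.2⟩
    · intro x _ y _ h
      simpa using h
    · intro y hy
      exact ⟨⟨y, (Finset.mem_filter.1 hy).2⟩, Finset.mem_univ _, rfl⟩
    · intro x _; rfl
  rw [hsum, hsum]
  rcases h with h | ⟨rfl, h⟩
  · have h1 : (∑ x with x < i, r x) + r i ≤ ∑ x with x < i', r x := by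
      have h2 : i ∉ Finset.univ.filter fun x => x < i := by simp
      rw [add_comm, ← Finset.sum_cons h2]
      refine Finset.sum_le_sum_of_subset fun x hx => ?_
      rw [Finset.mem_cons, Finset.mem_filter] at hx
      rw [Finset.mem_filter]
      exact ⟨Finset.mem_univ _, hx.elim (fun h' => h' ▸ h) fun h' => h'.2.trans h⟩
    have := j.2
    omega
  · omega

/-- Consecutive grouping inverts no pair, so the inner level of a reassociated composition
contributes no sign from moving its inputs among themselves. -/
lemma kos_finSigmaFinEquiv {r : Fin n → ℕ} (β : Fin (∑ i, r i) → ℤ) :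
    kos id (blockKey (finSigmaFinEquiv (n := r))) β = 0 := by
  refine Finset.sum_eq_zero fun l _ => Finset.sum_eq_zero fun l' _ => if_neg fun h => ?_
  have := finSigmaFinEquiv_lt h.2
  rw [Equiv.apply_symm_apply, Equiv.apply_symm_apply] at this
  exact lt_asymm h.1 this

/-- This supplies the hypothesis `hE` of the two-level sign lemmas for the indices that occur in the
associator. -/
lemma outer_e_apply (d : CompIdx N) (c : CompIdx d.n) (i : Fin c.n) (j : Fin (c.r i))
    (q : Fin (d.r (c.e ⟨i, j⟩))) : (d.outer c).e ⟨i, finSigmaFinEquiv ⟨j, q⟩⟩ =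
      d.e ⟨c.e ⟨i, j⟩, q⟩ :=
  congrArg (fun w => d.e ((Equiv.sigmaCongrLeft (β := fun l => Fin (d.r l)) c.e)
    ((Equiv.sigmaAssoc fun i j => Fin (d.r (c.e ⟨i, j⟩))).symm ⟨i, w⟩)))
    (Equiv.symm_apply_apply finSigmaFinEquiv _)

section twoLevels

variable {s : Fin m → ℕ} (e : (Σ i, Fin (r i)) ≃ Fin m) (d : (Σ l, Fin (s l)) ≃ Fin N)
  (E : (Σ i, Fin (∑ j, s (e ⟨i, j⟩))) ≃ Fin N)

lemma twoLevels_symm (hE : ∀ i j q, E ⟨i, finSigmaFinEquiv ⟨j, q⟩⟩ = d ⟨e ⟨i, j⟩, q⟩)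
    (i : Fin n) (j : Fin (r i)) (q : Fin (s (e ⟨i, j⟩))) :
    E.symm (d ⟨e ⟨i, j⟩, q⟩) = ⟨i, finSigmaFinEquiv ⟨j, q⟩⟩ := by
  rw [← hE, Equiv.symm_apply_apply]

lemma twoLevels_symm_fst (hE : ∀ i j q, E ⟨i, finSigmaFinEquiv ⟨j, q⟩⟩ = d ⟨e ⟨i, j⟩, q⟩)
    (l : Fin m) (q : Fin (s l)) :
    (E.symm (d ⟨l, q⟩)).1 = (e.symm l).1 := by
  obtain ⟨⟨i, j⟩, rfl⟩ := e.surjective l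
  rw [twoLevels_symm e d E hE, Equiv.symm_apply_apply]

/-- The merged grouping sorts first by the position of the sub-block under e and then within the
sub-block. One implication suffices: the orders are total and the keys injective, so the converse
follows by trichotomy. -/
lemma blockKey_twoLevels_lt (hE : ∀ i j q, E ⟨i, finSigmaFinEquiv ⟨j, q⟩⟩ = d ⟨e ⟨i, j⟩, q⟩)
    (z z' : Σ l, Fin (s l)) :
    blockKey E (d z) < blockKey E (d z') ↔
      toLex (blockKey e z.1, (z.2 : ℕ)) < toLex (blockKey e z'.1, (z'.2 : ℕ)) := by
  have key : ∀ z z' : Σ l, Fin (s l),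
      toLex (blockKey e z.1, (z.2 : ℕ)) < toLex (blockKey e z'.1, (z'.2 : ℕ)) →
        blockKey E (d z) < blockKey E (d z') := by
    rintro ⟨l, q⟩ ⟨l', q'⟩
    obtain ⟨⟨i, j⟩, rfl⟩ := e.surjective l
    obtain ⟨⟨i', j'⟩, rfl⟩ := e.surjective l'
    intro h
    simp only [← hE, blockKey_apply]
    simp only [blockKey_apply, Prod.Lex.toLex_lt_toLex] at h ⊢
    rcases h with (h | ⟨rfl, h⟩) | ⟨h, h'⟩
    · exact Or.inl h
    · refine Or.inr ⟨rfl, finSigmaFinEquiv_lt ?_⟩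
      rw [Prod.Lex.toLex_lt_toLex]
      exact Or.inl h
    · simp only [EmbeddingLike.apply_eq_iff_eq, Prod.mk.injEq] at h
      obtain ⟨rfl, h⟩ := h
      obtain rfl := Fin.ext h
      refine Or.inr ⟨rfl, finSigmaFinEquiv_lt ?_⟩
      rw [Prod.Lex.toLex_lt_toLex]
      exact Or.inr ⟨rfl, h'⟩
  refine ⟨fun h => ?_, key z z'⟩
  rcases lt_trichotomy (toLex (blockKey e z.1, (z.2 : ℕ)))
    (toLex (blockKey e z'.1, (z'.2 : ℕ))) with h' | h' | h'
  · exact h'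
  · obtain ⟨l, q⟩ := z
    obtain ⟨l', q'⟩ := z'
    simp only [EmbeddingLike.apply_eq_iff_eq, Prod.mk.injEq] at h'
    obtain ⟨h1, h2⟩ := h'
    obtain rfl := blockKey_inj _ h1
    obtain rfl := Fin.ext h2
    exact absurd h (lt_irrefl _)
  · exact absurd h (lt_asymm (key z' z h'))

/-- Sorting by E amounts to sorting by d and then permuting whole sub-blocks by e. Signs multiply
under composition, and moving blocks only involves their total degrees. -/
lemma kos_twoLevels (hE : ∀ i j q, E ⟨i, finSigmaFinEquiv ⟨j, q⟩⟩ = d ⟨e ⟨i, j⟩, q⟩)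
    (γ : Fin N → ℤ) :
    ((kos id (blockKey E) γ : ℤ) : ZMod 2) =
      (kos id (blockKey d) γ + kos id (blockKey e) fun l => ∑ q, γ (d ⟨l, q⟩) : ℤ) := by
  rw [← kos_trans Function.injective_id (blockKey_inj d) (blockKey_inj E) γ]
  congr 2
  rw [← kos_equiv d]
  refine Eq.trans ?_ (kos_block_out (κ := fun l => Fin (s l)) Function.injective_id
    (blockKey_inj e) (fun z => z.2) (γ ∘ d))
  refine kos_congr (fun z z' => ?_) (fun z z' => blockKey_twoLevels_lt e d E hE z z') _
  obtain ⟨l, q⟩ := z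
  obtain ⟨l', q'⟩ := z'
  rw [Function.comp_apply, Function.comp_apply, blockKey_apply, blockKey_apply]
  rfl

/-- The signs of the two ways to distribute factors over two levels of blocks agree. -/
lemma kos_assoc (hE : ∀ i j q, E ⟨i, finSigmaFinEquiv ⟨j, q⟩⟩ = d ⟨e ⟨i, j⟩, q⟩)
    (α : Fin n → ℤ) (β : Fin m → ℤ) (γ : Fin N → ℤ) :
    ((kos srcKey (tgtKey e) (Sum.elim α β) +
      kos srcKey (tgtKey E) (Sum.elim (fun i => α i + ∑ j, β (e ⟨i, j⟩)) γ) +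
      ∑ i, kos srcKey (tgtKey (finSigmaFinEquiv (n := fun j => s (e ⟨i, j⟩))))
        (Sum.elim (fun j => β (e ⟨i, j⟩)) fun q => γ (E ⟨i, q⟩)) : ℤ) : ZMod 2) =
    (kos srcKey (tgtKey d) (Sum.elim β γ) +
      kos srcKey (tgtKey e) (Sum.elim α fun l => β l + ∑ q, γ (d ⟨l, q⟩)) : ℤ) := by
  -- Γ l is the total degree of the inputs in sub-block l. Apart from the sorting by d, which is
  -- common to both sides, only these totals enter.
  obtain ⟨Γ, hΓ⟩ : ∃ Γ : Fin m → ℤ, ∀ l, ∑ q, γ (d ⟨l, q⟩) = Γ l := ⟨_, fun _ => rfl⟩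
  have hK := kos_twoLevels e d E hE γ
  simp only [hΓ] at hK ⊢
  have hD := kos_add (blockKey e) β Γ
  have hA : ∀ i, (∑ p, if (E.symm p).1 < i then γ p else 0) =
      ∑ l, if (e.symm l).1 < i then Γ l else 0 := by
    intro i
    rw [← Equiv.sum_comp d, Fintype.sum_sigma]
    refine Finset.sum_congr rfl fun l _ => ?_
    simp only [twoLevels_symm_fst e d E hE]
    split_ifs
    · exact hΓ _
    · exact Finset.sum_const_zero
  have hC : ∀ l, (∑ p, if (d.symm p).1 < l then γ p else 0) =
      ∑ l', if l' < l then Γ l' else 0 := by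
    intro l
    rw [← Equiv.sum_comp d, Fintype.sum_sigma]
    refine Finset.sum_congr rfl fun l' _ => ?_
    simp only [Equiv.symm_apply_apply]
    split_ifs
    · exact hΓ _
    · exact Finset.sum_const_zero
  have hI : ∀ (i : Fin n) (j : Fin (r i)),
      (∑ q, if (finSigmaFinEquiv.symm q).1 < j then γ (E ⟨i, q⟩) else 0) =
      ∑ j', if j' < j then Γ (e ⟨i, j'⟩) else 0 := by
    intro i j
    rw [← Equiv.sum_comp finSigmaFinEquiv, Fintype.sum_sigma]
    refine Finset.sum_congr rfl fun j' _ => ?_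
    simp only [Equiv.symm_apply_apply, hE]
    split_ifs
    · exact hΓ _
    · exact Finset.sum_const_zero
  have hsnd : ∀ i (j : Fin (r i)), ((e.symm (e ⟨i, j⟩)).2 : ℕ) = j := by
    intro i j
    rw [Equiv.symm_apply_apply]
  -- When the levels are merged, the middle factor l passes the inputs of sub-block l' if l' lies in
  -- an earlier outer block (outer sign) or earlier in the same block (inner sign). Together this
  -- says that l' precedes l in the order of e.
  have hB : (∑ i, (∑ j, β (e ⟨i, j⟩)) * ∑ l, if (e.symm l).1 < i then Γ l else 0) +
      ∑ i, ∑ j, β (e ⟨i, j⟩) * ∑ j', (if j' < j then Γ (e ⟨i, j'⟩) else 0) =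
      ∑ l, ∑ l', (if blockKey e l' < blockKey e l then 1 else 0) * (β l * Γ l') := by
    rw [← Equiv.sum_comp e, Fintype.sum_sigma, ← Finset.sum_add_distrib]
    refine Finset.sum_congr rfl fun i _ => ?_
    rw [Finset.sum_mul, ← Finset.sum_add_distrib]
    refine Finset.sum_congr rfl fun j _ => ?_
    have h1 : ∑ j', (if j' < j then Γ (e ⟨i, j'⟩) else 0) =
        ∑ l, if (e.symm l).1 = i ∧ (e.symm l).2.val < j.val then Γ l else 0 := by
      rw [← Equiv.sum_comp e, Fintype.sum_sigma, Finset.sum_eq_single i]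
      · simp [hsnd]
      · intro i' _ hi
        simp [hi]
      · simp
    rw [h1, ← mul_add, ← Finset.sum_add_distrib, Finset.mul_sum]
    refine Finset.sum_congr rfl fun l _ => ?_
    simp only [blockKey, Prod.Lex.toLex_lt_toLex, hsnd]
    by_cases h2 : (e.symm l).1 < i
    · simp [h2, h2.ne]
    · simp [h2]
  -- When the levels are treated successively, the factor l first passes the inputs of all l' < l,
  -- and then the grouping of compounds adds the polarization term for inverted pairs. Modulo 2 both
  -- counts say that l' precedes l in the order of e.
  have hF : ((∑ l, ∑ l', (if blockKey e l' < blockKey e l then 1 else 0) *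
      (β l * Γ l') : ℤ) : ZMod 2) = (∑ l, β l * (∑ l', if l' < l then Γ l' else 0) +
      ∑ l, ∑ l', ((if l < l' ∧ blockKey e l' < blockKey e l then 1 else 0) +
        if l' < l ∧ blockKey e l < blockKey e l' then 1 else 0) * (β l * Γ l') : ℤ) := by
    simp only [Finset.mul_sum, ← Finset.sum_add_distrib, Int.cast_sum]
    refine Finset.sum_congr rfl fun l _ => Finset.sum_congr rfl fun l' _ => ?_
    have e2 : (2 : ZMod 2) = 0 := rfl
    rcases eq_or_ne l l' with rfl | h
    · simp
    rcases lt_or_gt_of_ne h with h1 | h1 <;>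
      rcases lt_or_gt_of_ne ((blockKey_inj e).ne h) with h2 | h2 <;>
      simp [h1, h2, h1.not_gt, h2.not_gt]
    linear_combination - (β l * Γ l' : ZMod 2) * e2
  simp only [kos_tgtKey, hA, hC, hI, kos_finSigmaFinEquiv, add_zero, hD, add_mul,
    Finset.sum_add_distrib]
  have hG : (∑ i, α i * ∑ l, if (e.symm l).1 < i then β l + Γ l else 0) =
      (∑ i, α i * ∑ l, if (e.symm l).1 < i then β l else 0) +
        ∑ i, α i * ∑ l, if (e.symm l).1 < i then Γ l else 0 := by
    rw [← Finset.sum_add_distrib]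
    refine Finset.sum_congr rfl fun i _ => ?_
    rw [← mul_add, ← Finset.sum_add_distrib]
    congr 1
    refine Finset.sum_congr rfl fun l _ => ?_
    split_ifs <;> simp
  rw [hG]
  have hB' := congrArg (Int.cast : ℤ → ZMod 2) hB
  simp only [add_mul, Finset.sum_add_distrib] at hF
  rw [Int.cast_add] at hB'
  rw [Int.cast_add] at hF hK
  simp only [Int.cast_add] at hF ⊢
  linear_combination hB' + hF + hK

end twoLevels

end signs

end

/-! ### Associativity of the distribution maps. -/

noncomputable section

open DGMod SymSeq

variable {k : Type u} [CommRing k]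

namespace SymSeq

variable {O P Q : SymSeq k} {A B : DGMod k} {m N : ℕ}

lemma schurDistr_tprod (c : CompIdx m) {α : Fin c.n → ℤ} {β : Fin m → ℤ}
    {x : ∀ i, P.obj (c.r i)} {y : Fin m → A} (hx : ∀ i, x i ∈ (P.obj (c.r i)).gr (α i))
    (hy : ∀ l, y l ∈ A.gr (β l)) :
    schurDistr P A c (PiTensorProduct.tprod k x) (PiTensorProduct.tprod k y) =
      sg k (kos srcKey (tgtKey c.e) (Sum.elim α β)) • PiTensorProduct.tprod k fun i =>
        (schurι P A (c.r i)).lin (x i ⊗ₜ PiTensorProduct.tprod k fun j => y (c.e ⟨i, j⟩)) :=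
  distr_tprod (Y := fun _ => A) (Z := fun _ => schur P A) c.e _ hx hy

/-- Distributing over two levels of blocks at once or one after the other. -/
lemma schurDistr_assoc (d : CompIdx N) (c : CompIdx d.n) (x : ⨂[k] i, P.obj (c.r i))
    (y : ⨂[k] l, Q.obj (d.r l)) (z : tpow A N) :
    PiTensorProduct.map (fun _ => schurComp P Q A)
        (schurDistr (comp P Q) A (d.outer c) (assocDistr P Q d c x y) z) =
      schurDistr P (schur Q A) c x (schurDistr Q A d y z) := by
  let S : (⨂[k] i, compObj P Q (d.inR c i)) →ₗ[k] tpow A N →ₗ[k]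
    tpow (schur (comp P Q) A) c.n := schurDistr (comp P Q) A (d.outer c)
  let T : tpow (schur (comp P Q) A) c.n →ₗ[k] tpow (schur P (schur Q A)) c.n :=
    PiTensorProduct.map fun _ => schurComp P Q A
  -- On homogeneous pure tensors both sides are the same tensor up to sign, and the signs are
  -- compared by `kos_assoc`. The equality is then extended by linearity in z, y and x in turn.
  have key : ∀ (α : Fin c.n → ℤ) (x : ∀ i, P.obj (c.r i)),
      (∀ i, x i ∈ (P.obj (c.r i)).gr (α i)) → ∀ (β : Fin d.n → ℤ) (y : ∀ l, Q.obj (d.r l)),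
      (∀ l, y l ∈ (Q.obj (d.r l)).gr (β l)) → ∀ (γ : Fin N → ℤ) (z : Fin N → A),
      (∀ p, z p ∈ A.gr (γ p)) →
      T (S (assocDistr P Q d c (PiTensorProduct.tprod k x) (PiTensorProduct.tprod k y))
        (PiTensorProduct.tprod k z)) =
      schurDistr P (schur Q A) c (PiTensorProduct.tprod k x)
        (schurDistr Q A d (PiTensorProduct.tprod k y) (PiTensorProduct.tprod k z)) := by
    intro α x hx β y hy γ z hz
    have h1 : assocDistr P Q d c (PiTensorProduct.tprod k x) (PiTensorProduct.tprod k y) =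
        sg k (kos srcKey (tgtKey c.e) (Sum.elim α β)) • PiTensorProduct.tprod k fun i =>
          (compι P Q (d.inner c i)).lin
            (x i ⊗ₜ PiTensorProduct.tprod k fun j => y (c.e ⟨i, j⟩)) :=
      distr_tprod (Z := fun i => compObj P Q (d.inR c i)) c.e _ hx hy
    have h2 : ∀ i, (compι P Q (d.inner c i)).lin
        (x i ⊗ₜ PiTensorProduct.tprod k fun j => y (c.e ⟨i, j⟩)) ∈
          ((comp P Q).obj (d.inR c i)).gr (α i + ∑ j, β (c.e ⟨i, j⟩)) := fun i =>
      (compι P Q (d.inner c i)).mem (tmul_mem _ _ (hx i) (tprod_mem (fun j => hy _) rfl) rfl)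
    have h3 := schurDistr_tprod (P := comp P Q) (d.outer c) h2 hz
    have h4 := schurDistr_tprod d hy hz
    have h5 : ∀ l, (schurι Q A (d.r l)).lin (y l ⊗ₜ PiTensorProduct.tprod k fun q =>
        z (d.e ⟨l, q⟩)) ∈ (schur Q A).gr (β l + ∑ q, γ (d.e ⟨l, q⟩)) := fun l =>
      schurι_mem (hy l) (tprod_mem (fun q => hz _) rfl) rfl
    have h6 := schurDistr_tprod (A := schur Q A) c hx h5
    have h7 : ∀ i, schurComp P Q A ((schurι (comp P Q) A (d.inR c i)).lin
        ((compι P Q (d.inner c i)).lin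
          (x i ⊗ₜ PiTensorProduct.tprod k fun j => y (c.e ⟨i, j⟩)) ⊗ₜ
            PiTensorProduct.tprod k fun q => z ((d.outer c).e ⟨i, q⟩))) =
        sg k (kos srcKey (tgtKey (finSigmaFinEquiv (n := fun j => d.r (c.e ⟨i, j⟩))))
          (Sum.elim (fun j => β (c.e ⟨i, j⟩)) fun q => γ ((d.outer c).e ⟨i, q⟩))) •
        (schurι P (schur Q A) (c.r i)).lin (x i ⊗ₜ PiTensorProduct.tprod k fun j =>
          (schurι Q A (d.r (c.e ⟨i, j⟩))).lin (y (c.e ⟨i, j⟩) ⊗ₜ PiTensorProduct.tprod k fun q =>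
            z (d.e ⟨c.e ⟨i, j⟩, q⟩))) := by
      intro i
      have h8 := schurDistr_tprod (P := Q) (A := A) (d.inner c i) (fun j => hy (c.e ⟨i, j⟩))
        (fun q => hz ((d.outer c).e ⟨i, q⟩))
      refine (schurComp_ι (O := P) (P := Q) (d.inner c i) _ _ _).trans ?_
      refine (congrArg (fun w => (schurι P (schur Q A) (c.r i)).lin (x i ⊗ₜ w)) h8).trans ?_
      rw [TensorProduct.tmul_smul, map_smul]
      refine congrArg (_ • ·) ?_
      refine congrArg (fun w => (schurι P (schur Q A) (c.r i)).lin
        (x i ⊗ₜ PiTensorProduct.tprod k w)) (funext fun j => ?_)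
      refine congrArg (fun w => (schurι Q A (d.r (c.e ⟨i, j⟩))).lin
        (y (c.e ⟨i, j⟩) ⊗ₜ PiTensorProduct.tprod k w)) (funext fun q => ?_)
      exact congrArg z (outer_e_apply d c i j q)
    have h9 := kos_assoc (s := d.r) c.e d.e (d.outer c).e (outer_e_apply d c) α β γ
    have h10 := (congrArg (fun w => T (S w (PiTensorProduct.tprod k z))) h1).trans
      ((map_smul (T ∘ₗ S.flip (PiTensorProduct.tprod k z)) _ _).trans
        (congrArg (_ • ·) ((congrArg T h3).trans ((map_smul T _ _).trans
          (congrArg (_ • ·) ((PiTensorProduct.map_tprod _ _).trans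
            (congrArg (PiTensorProduct.tprod k) (funext h7))))))))
    refine h10.trans ?_
    rw [h4, map_smul, h6, MultilinearMap.map_smul_univ, smul_smul, smul_smul, smul_smul,
      ← sg_sum, ← sg_add, ← sg_add, ← sg_add, sg_congr k h9]
  have hz : ∀ (α : Fin c.n → ℤ) (x : ∀ i, P.obj (c.r i)),
       (∀ i, x i ∈ (P.obj (c.r i)).gr (α i)) → ∀ (β : Fin d.n → ℤ) (y : ∀ l, Q.obj (d.r l)),
      (∀ l, y l ∈ (Q.obj (d.r l)).gr (β l)) → ∀ z : tpow A N,
      T (S (assocDistr P Q d c (PiTensorProduct.tprod k x) (PiTensorProduct.tprod k y)) z) =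
      schurDistr P (schur Q A) c (PiTensorProduct.tprod k x)
        (schurDistr Q A d (PiTensorProduct.tprod k y) z) := by
    intro α x hx β y hy z
    have : T ∘ₗ S (assocDistr P Q d c (PiTensorProduct.tprod k x) (PiTensorProduct.tprod k y)) =
        schurDistr P (schur Q A) c (PiTensorProduct.tprod k x) ∘ₗ
          schurDistr Q A d (PiTensorProduct.tprod k y) :=
      tens_ext (M := fun _ => A) fun γ z hz => key α x hx β y hy γ z hz
    exact LinearMap.congr_fun this z
  have hy : ∀ (α : Fin c.n → ℤ) (x : ∀ i, P.obj (c.r i)),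
       (∀ i, x i ∈ (P.obj (c.r i)).gr (α i)) → ∀ (y : ⨂[k] l, Q.obj (d.r l)) (z : tpow A N),
      T (S (assocDistr P Q d c (PiTensorProduct.tprod k x) y) z) =
      schurDistr P (schur Q A) c (PiTensorProduct.tprod k x) (schurDistr Q A d y z) := by
    intro α x hx y z
    have : T ∘ₗ S.flip z ∘ₗ assocDistr P Q d c (PiTensorProduct.tprod k x) =
        schurDistr P (schur Q A) c (PiTensorProduct.tprod k x) ∘ₗ (schurDistr Q A d).flip z :=
      tens_ext fun β y hy => hz α x hx β y hy z
    exact LinearMap.congr_fun this y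
  have : T ∘ₗ S.flip z ∘ₗ (assocDistr P Q d c).flip y =
      (schurDistr P (schur Q A) c).flip (schurDistr Q A d y z) :=
    tens_ext fun α x hx => hy α x hx y z
  exact LinearMap.congr_fun this x

end SymSeq

end

/-! ### The comonad C[-] and the cofree-type coalgebras. -/

noncomputable section

open DGMod SymSeq

variable {k : Type u} [CommRing k]

namespace DGMod

/-- The isomorphism `A ≅ A^{⊗1}`. -/
def ofOne (A : DGMod k) : A →ₗ[k] tpow A 1 :=
  (PiTensorProduct.subsingletonEquiv (R := k) (s := fun _ : Fin 1 => A) 0).symm.toLinearMap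

lemma ofOne_apply (A : DGMod k) (x : A) : A.ofOne x = PiTensorProduct.tprod k fun _ => x := by
  refine (LinearEquiv.symm_apply_eq _).2 ?_
  rw [PiTensorProduct.subsingletonEquiv_apply_tprod]

end DGMod

namespace SymSeq

variable {O P Q : SymSeq k} {A B : DGMod k} {m N : ℕ}

lemma assoc_ι (d : CompIdx N) (c : CompIdx d.n) (o : O.obj c.n) (x : ⨂[k] i, P.obj (c.r i))
    (y : ⨂[k] l, Q.obj (d.r l)) :
    assoc O P Q N ((compι (comp O P) Q d).lin ((compι O P c).lin (o ⊗ₜ x) ⊗ₜ y)) =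
      (compι O (comp P Q) (d.outer c)).lin (o ⊗ₜ assocDistr P Q d c x y) := by
  refine (compLift_ι (O := comp O P) _ _ _ d ((compι O P c).lin (o ⊗ₜ x) ⊗ₜ y)).trans ?_
  exact LinearMap.congr_fun (compLift_ι (assocAux O P Q d) (assocAux_slide d) (assocAux_block d) c
    (o ⊗ₜ x)) y

/-- The comparison maps are associative. -/
lemma schurComp_assoc (w : compObj (comp O P) Q N) (z : tpow A N) :
    schurMap O (schurCompMor P Q A) (schurComp O (comp P Q) A
      ((schurι (comp O (comp P Q)) A N).lin (assoc O P Q N w ⊗ₜ z))) =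
    schurComp O P (schur Q A) (schurComp (comp O P) Q A
      ((schurι (comp (comp O P) Q) A N).lin (w ⊗ₜ z))) := by
  have h : ∀ (d : CompIdx N) (c : CompIdx d.n) (o : O.obj c.n) (x : ⨂[k] i, P.obj (c.r i))
      (y : ⨂[k] l, Q.obj (d.r l)),
      schurMap O (schurCompMor P Q A) (schurComp O (comp P Q) A
        ((schurι (comp O (comp P Q)) A N).lin (assoc O P Q N
          ((compι (comp O P) Q d).lin ((compι O P c).lin (o ⊗ₜ x) ⊗ₜ y)) ⊗ₜ z))) =
      schurComp O P (schur Q A) (schurComp (comp O P) Q A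
        ((schurι (comp (comp O P) Q) A N).lin
          ((compι (comp O P) Q d).lin ((compι O P c).lin (o ⊗ₜ x) ⊗ₜ y) ⊗ₜ z))) := by
    intro d c o x y
    have h1 := schurComp_ι (O := comp O P) (A := A) d ((compι O P c).lin (o ⊗ₜ x)) y z
    have h2 := schurComp_ι (A := schur Q A) c o x (schurDistr Q A d y z)
    have h3 := schurComp_ι (O := O) (P := comp P Q) (A := A) (d.outer c) o
      (assocDistr P Q d c x y) z
    have h4 := schurMap_ι (O := O) (schurCompMor P Q A) c.n o
      (schurDistr (comp P Q) A (d.outer c) (assocDistr P Q d c x y) z)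
    rw [h1]
    refine Eq.trans ?_ h2.symm
    rw [assoc_ι]
    refine (congrArg (schurMap O (schurCompMor P Q A)) h3).trans (h4.trans ?_)
    exact congrArg (fun u => (schurι O (schur P (schur Q A)) c.n).lin (o ⊗ₜ u))
      (schurDistr_assoc d c x y z)
  -- With z fixed, both sides are linear in w, so they can be compared on generators of the outer
  -- and then of the inner composition product.
  let L : compObj (comp O P) Q N →ₗ[k] schur O (schur P (schur Q A)) :=
    (schurMap O (schurCompMor P Q A) ∘ₗ schurComp O (comp P Q) A ∘ₗ
      (schurι (comp O (comp P Q)) A N).lin) ∘ₗ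
      (TensorProduct.mk k ((comp O (comp P Q)).obj N) (tpow A N)).flip z ∘ₗ assoc O P Q N
  let R : compObj (comp O P) Q N →ₗ[k] schur O (schur P (schur Q A)) :=
    (schurComp O P (schur Q A) ∘ₗ schurComp (comp O P) Q A ∘ₗ
      (schurι (comp (comp O P) Q) A N).lin) ∘ₗ
      (TensorProduct.mk k ((comp (comp O P) Q).obj N) (tpow A N)).flip z
  have : L = R := by
    refine comp_ext (O := comp O P) fun d o y => ?_
    have h5 : (L ∘ₗ (compι (comp O P) Q d).lin) ∘ₗ
        (TensorProduct.mk k (compObj O P d.n) (⨂[k] l, Q.obj (d.r l))).flip y =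
        (R ∘ₗ (compι (comp O P) Q d).lin) ∘ₗ
        (TensorProduct.mk k (compObj O P d.n) (⨂[k] l, Q.obj (d.r l))).flip y :=
      comp_ext fun c o x => h d c o x y
    exact LinearMap.congr_fun h5 o
  exact LinearMap.congr_fun this w

lemma schurMap_of_eq_id {f : Mor A A} (h : ∀ x, f.lin x = x) (x : schur O A) :
    schurMap O f x = x := by
  have : schurMap O f = LinearMap.id := by
    refine schur_ext fun n o x => ?_
    have h1 : f.lin = LinearMap.id := LinearMap.ext h
    have h2 : (tensMap fun _ : Fin n => f).lin x = x := by
      refine Eq.trans (b := PiTensorProduct.map (fun _ : Fin n => f.lin) x) rfl ?_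
      rw [h1, PiTensorProduct.map_id]; rfl
    rw [schurMap_ι, h2]
    rfl
  exact LinearMap.congr_fun this x

lemma schurSeq_id (x : schur O A) : schurSeq (Hom.id O) A x = x := by
  have : schurSeq (Hom.id O) A = LinearMap.id := schur_ext fun n o x => schurSeq_ι _ n o x
  exact LinearMap.congr_fun this x

/-- With a single block nothing is moved, so there is no sign. This is the shape that the left
counit law of a cooperad produces. -/
lemma schurDistr_unique (c : P.obj m) (y : tpow A m) :
    schurDistr P A ⟨1, fun _ => m, Equiv.uniqueSigma fun _ : Fin 1 => Fin m⟩
      (PiTensorProduct.tprod k fun _ => c) y =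
      PiTensorProduct.tprod k fun _ => (schurι P A m).lin (c ⊗ₜ y) := by
  -- A pure tensor with one factor is linear in that factor; writing it with `ofOne` makes this
  -- available and allows c to be taken homogeneous.
  have key : ∀ (a : ℤ) (c : P.obj m), c ∈ (P.obj m).gr a → ∀ (β : Fin m → ℤ) (y : Fin m → A),
      (∀ l, y l ∈ A.gr (β l)) → schurDistr P A
        ⟨1, fun _ => m, Equiv.uniqueSigma fun _ : Fin 1 => Fin m⟩
        (ofOne _ c) (PiTensorProduct.tprod k y) =
        ofOne _ ((schurι P A m).lin (c ⊗ₜ PiTensorProduct.tprod k y)) := by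
    intro a c hc β y hy
    have h := schurDistr_tprod (A := A) (P := P)
      ⟨1, fun _ => m, Equiv.uniqueSigma fun _ : Fin 1 => Fin m⟩
      (α := fun _ => a) (x := fun _ => c) (fun _ => hc) hy
    rw [ofOne_apply, ofOne_apply]
    refine h.trans ?_
    rw [kos_tgtKey]
    have h1 : kos id (blockKey (Equiv.uniqueSigma fun _ : Fin 1 => Fin m)) β = 0 := by
      refine Finset.sum_eq_zero fun l _ => Finset.sum_eq_zero fun l' _ => if_neg fun h => ?_
      have h2 := h.2
      simp only [blockKey, Prod.Lex.toLex_lt_toLex] at h2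
      rcases h2 with h2 | h2
      · exact absurd h2 (Subsingleton.elim _ _).not_lt
      · exact lt_asymm h.1 h2.2
    rw [h1, Fintype.sum_unique, Finset.sum_eq_zero, mul_zero, add_zero, sg_zero, one_smul]
    · refine congrArg (PiTensorProduct.tprod k) (funext fun i => ?_)
      obtain rfl := Subsingleton.elim (0 : Fin 1) i
      rfl
    · intro l _
      exact if_neg (Subsingleton.elim _ _).not_lt
  have h : ∀ y : tpow A m, (schurDistr P A
      ⟨1, fun _ => m, Equiv.uniqueSigma fun _ : Fin 1 => Fin m⟩).flip y ∘ₗ ofOne _ =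
      ofOne _ ∘ₗ (schurι P A m).lin ∘ₗ (TensorProduct.mk k (P.obj m) (tpow A m)).flip y := by
    intro y
    refine (P.obj m).hom_ext fun a c hc => ?_
    have : schurDistr P A ⟨1, fun _ => m, Equiv.uniqueSigma fun _ : Fin 1 => Fin m⟩
        (ofOne _ c) = ofOne _ ∘ₗ (schurι P A m).lin ∘ₗ TensorProduct.mk k (P.obj m) (tpow A m) c :=
      tens_ext (M := fun _ => A) fun β y hy => key a c hc β y hy
    exact LinearMap.congr_fun this y
  have := LinearMap.congr_fun (h y) c
  rw [LinearMap.comp_apply, LinearMap.comp_apply, ofOne_apply, ofOne_apply] at this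
  exact this

end SymSeq

namespace Cooperad

variable (C : Cooperad k) (A : DGMod k)

/-- The comultiplication of the comonad `C[-]` as a morphism of complexes. -/
def cofreeMor : Mor (schur C.toSymSeq A) (schur C.toSymSeq (schur C.toSymSeq A)) :=
  (schurCompMor C.toSymSeq C.toSymSeq A).comp (schurSeqMor A C.Δ)

lemma cofree_ι (m : ℕ) (c : C.obj m) (x : tpow A m) :
    C.cofree A ((schurι C.toSymSeq A m).lin (c ⊗ₜ x)) = schurComp C.toSymSeq C.toSymSeq A
      ((schurι (comp C.toSymSeq C.toSymSeq) A m).lin ((C.Δ.app m).lin c ⊗ₜ x)) :=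
  congrArg (schurComp C.toSymSeq C.toSymSeq A) (schurSeq_ι C.Δ m c x)

/-- Both sides come from the two iterated comultiplications of c by naturality of the comparison map
in the symmetric sequences. The coassociativity of the cooperad and `schurComp_assoc` identify them.
-/
lemma cofree_coassoc (x : schur C.toSymSeq A) :
    schurMap C.toSymSeq (C.cofreeMor A) (C.cofree A x) =
      C.cofree (schur C.toSymSeq A) (C.cofree A x) := by
  have : schurMap C.toSymSeq (C.cofreeMor A) ∘ₗ C.cofree A =
      C.cofree (schur C.toSymSeq A) ∘ₗ C.cofree A := by
    refine schur_ext fun m c x => ?_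
    have h1 := schurComp_compMap (A := A) (Hom.id C.toSymSeq) C.Δ ((C.Δ.app m).lin c) x
    have h2 := schurComp_compMap (A := A) C.Δ (Hom.id C.toSymSeq) ((C.Δ.app m).lin c) x
    have h3 := schurComp_assoc (A := A) (compMap (P := C.toSymSeq) (P' := C.toSymSeq) C.Δ
      (Hom.id C.toSymSeq) m ((C.Δ.app m).lin c)) x
    rw [C.coassoc] at h3
    rw [schurSeq_id] at h1
    rw [schurMap_of_eq_id (fun x => schurSeq_id x)] at h2
    rw [LinearMap.comp_apply, LinearMap.comp_apply, cofree_ι, cofreeMor, schurMap_comp]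
    refine (congrArg (schurMap C.toSymSeq (schurCompMor C.toSymSeq C.toSymSeq A)) h1.symm).trans ?_
    refine h3.trans ?_
    exact congrArg (schurComp C.toSymSeq C.toSymSeq (schur C.toSymSeq A)) h2
  exact LinearMap.congr_fun this x

lemma cofree_counit (x : schur C.toSymSeq A) :
    schurSeq C.ε (schur C.toSymSeq A) (C.cofree A x) = schurUnit (schur C.toSymSeq A) x := by
  -- U is `schurUnit` as a linear map, so that the identity can be checked on the classes of c ⊗ x.
  let U : schur C.toSymSeq A →ₗ[k] schur (unit k) (schur C.toSymSeq A) :=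
    (schurι (unit k) (schur C.toSymSeq A) 1).lin ∘ₗ
      TensorProduct.mk k ((unit k).obj 1) (tpow (schur C.toSymSeq A) 1) (unitOne k) ∘ₗ
      ofOne (schur C.toSymSeq A)
  have hU : ∀ x, U x = schurUnit (schur C.toSymSeq A) x := fun x =>
    congrArg (fun z => (schurι (unit k) (schur C.toSymSeq A) 1).lin (unitOne k ⊗ₜ z))
      (ofOne_apply _ x)
  have : schurSeq C.ε (schur C.toSymSeq A) ∘ₗ C.cofree A = U := by
    refine schur_ext fun m c x => ?_
    have h1 := schurComp_compMap (A := A) C.ε (Hom.id C.toSymSeq) ((C.Δ.app m).lin c) x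
    rw [schurMap_of_eq_id (fun x => schurSeq_id x), C.counit_left] at h1
    rw [hU, LinearMap.comp_apply, cofree_ι, ← h1]
    refine (schurComp_ι (O := unit k) _ _ _ _).trans ?_
    exact congrArg (fun z => (schurι (unit k) (schur C.toSymSeq A) 1).lin (unitOne k ⊗ₜ z))
      (schurDistr_unique c x)
  exact (LinearMap.congr_fun this x).trans (hU x)

lemma isCoalgebra_cofree : C.IsCoalgebra (schur C.toSymSeq A) (C.cofree A) where
  mem := (C.cofreeMor A).mem
  comm := (C.cofreeMor A).comm
  coassoc := C.cofree_coassoc A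
  counit := C.cofree_counit A

end Cooperad

end

noncomputable section

open DGMod SymSeq

variable {k : Type u} [CommRing k]

/-! ### The thick contraction of a number contraction -/

lemma der_ofOne {A : DGMod k} (e : ℤ) (θ : A →ₗ[k] A) (x : A) :
    der (fun _ => A) e (fun _ => θ) (A.ofOne x) = A.ofOne (θ x) := by
  rw [ofOne_apply, ofOne_apply, der, Fin.sum_univ_one, place, PiTensorProduct.map_tprod]
  refine congrArg (PiTensorProduct.tprod k) (funext fun i => ?_)
  obtain rfl := Subsingleton.elim (0 : Fin 1) i
  rw [Function.update_self]

lemma Thick.one_eq {A B : DGMod k} {f : Thick A B} {φ : A →ₗ[k] B}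
    (h : ∀ x, f 1 (A.ofOne x) = B.ofOne (φ x)) : f.one = φ :=
  LinearMap.ext fun x => (congrArg (PiTensorProduct.subsingletonEquiv (R := k)
    (s := fun _ : Fin 1 => B) 0) (h x)).trans (LinearEquiv.apply_symm_apply _ _)

lemma tensMap_ofOne {A B : DGMod k} (f : Mor A B) (x : A) :
    (tensMap fun _ : Fin 1 => f).lin (A.ofOne x) = B.ofOne (f.lin x) := by
  rw [ofOne_apply, ofOne_apply, tensMap]
  exact PiTensorProduct.map_tprod _ _

namespace NumberContraction

variable [Algebra ℚ k] {A B : DGMod k} (L : NumberContraction A B)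

/-- The contractions of the tensor powers. -/
def toThick : ThickContraction A B := ⟨fun n => (L.tpow n).toContraction⟩

lemma toThick_f_one : L.toThick.f.one = L.f.lin := Thick.one_eq (tensMap_ofOne L.f)

lemma toThick_g_one : L.toThick.g.one = L.g.lin := Thick.one_eq (tensMap_ofOne L.g)

/-- The isomorphism of A with its first tensor power intertwines D and N with their derivation
extensions, hence also the quotients. -/
lemma toThick_h_one : L.toThick.h.one = L.toContraction.h := by
  refine Thick.one_eq fun x => ?_
  refine (congrArg (L.tpow 1).isNumberOp.inv (der_ofOne 1 L.D x)).trans ?_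
  exact (L.isNumberOp.map_inv (L.tpow 1).isNumberOp (φ := A.ofOne)
    (fun x => (der_ofOne 0 L.N x).symm) _).symm

end NumberContraction

/-! ### Compatibility of the comultiplication with morphisms and Leibniz operators. -/

namespace Cooperad

variable (C : Cooperad k) {A B : DGMod k}

lemma cofree_natural (f : Mor A B) (x : schur C.toSymSeq A) :
    schurMap C.toSymSeq (schurMor C.toSymSeq f) (C.cofree A x) =
      C.cofree B (schurMap C.toSymSeq f x) := by
  refine (schurComp_natural f (schurSeq C.Δ A x)).symm.trans ?_
  exact congrArg (schurComp C.toSymSeq C.toSymSeq B) (schurSeq_thick C.Δ _ _ x).symm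

/-- The cooperad comultiplication acts on the coefficients only and so commutes with operators
extended from A. The comparison map then turns the extension of θ into the extension of Θ. -/
lemma cofree_der {e : ℤ} {θ : A →ₗ[k] A} (hθ : IsDeg e θ)
    {Θ : schur C.toSymSeq A →ₗ[k] schur C.toSymSeq A} (hf1) (hf3)
    (hΘ : Θ = schurThick C.toSymSeq e (fun n => der (fun _ : Fin n => A) e fun _ => θ) hf1)
    (x : schur C.toSymSeq A) :
    schurThick C.toSymSeq e (fun n => der (fun _ : Fin n => schur C.toSymSeq A) e fun _ => Θ) hf3
      (C.cofree A x) = C.cofree A (Θ x) := by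
  refine (schurComp_thick hθ hf1 hf1 hf3 hΘ (schurSeq C.Δ A x)).symm.trans ?_
  refine congrArg (schurComp C.toSymSeq C.toSymSeq A) ?_
  rw [hΘ]
  exact (schurSeq_thick C.Δ _ hf1 x).symm

end Cooperad

namespace NumberContraction

variable [Algebra ℚ k] {A B : DGMod k} (L : NumberContraction A B) (C : Cooperad k)

/-- The comultiplication intertwines D and N on C[A] with those on C[C[A]] by `cofree_der`, and
therefore the homotopies obtained by division. -/
lemma cofree_h (x : SymSeq.schur C.toSymSeq A) :
    ((L.schur C.toSymSeq).schur C.toSymSeq).toContraction.h (C.cofree A x) =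
      C.cofree A ((L.schur C.toSymSeq).toContraction.h x) := by
  have hD := C.cofree_der L.D_deg L.tpow_D_perm (L.schur C.toSymSeq).tpow_D_perm rfl x
  refine (congrArg ((L.schur C.toSymSeq).schur C.toSymSeq).isNumberOp.inv hD).trans ?_
  exact ((L.schur C.toSymSeq).isNumberOp.map_inv
    ((L.schur C.toSymSeq).schur C.toSymSeq).isNumberOp (φ := C.cofree A)
    (fun x => (C.cofree_der L.N_deg L.tpow_N_perm (L.schur C.toSymSeq).tpow_N_perm rfl x).symm)
    _).symm

lemma toThick_f_isMorphism : L.toThick.f.IsMorphism := fun n => by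
  rw [toThick_f_one]; rfl

lemma toThick_g_isMorphism : L.toThick.g.IsMorphism := fun n => by
  rw [toThick_g_one]; rfl

lemma isCoalgebraMap_f :
    (L.schur C.toSymSeq).toThick.f.IsCoalgebraMap C (C.cofree A) (C.cofree B) 0 := by
  refine ⟨fun n => Mor.isDeg _,
    fun n σ x => (perm_tensMap (fun _ => (L.schur C.toSymSeq).f) σ x).symm, fun x => ?_⟩
  rw [toThick_f_one]
  exact C.cofree_natural L.f x

lemma isCoalgebraMap_g :
    (L.schur C.toSymSeq).toThick.g.IsCoalgebraMap C (C.cofree B) (C.cofree A) 0 := by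
  refine ⟨fun n => Mor.isDeg _,
    fun n σ x => (perm_tensMap (fun _ => (L.schur C.toSymSeq).g) σ x).symm, fun x => ?_⟩
  rw [toThick_g_one]
  exact C.cofree_natural L.g x

/-- By `schur_h`, the map that C[-] induces from the homotopies on the tensor powers of C[A] is the
homotopy of the number contraction on C[C[A]]. The claim thus becomes `cofree_h`. -/
lemma isCoalgebraMap_h :
    (L.schur C.toSymSeq).toThick.h.IsCoalgebraMap C (C.cofree A) (C.cofree A) 1 := by
  refine ⟨fun n => ((L.schur C.toSymSeq).tpow n).toContraction.h_deg,
    (L.schur C.toSymSeq).tpow_h_perm, fun x => ?_⟩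
  rw [toThick_h_one, ← cofree_h, schur_h]
  rfl

end NumberContraction

/-! ### Filtrations -/

section filtrations

variable {A B : DGMod k} {F : ℤ → Submodule k A} {G : ℤ → Submodule k B} {n : ℕ}

lemma tprod_mem_inducedFil {i : Fin n → ℤ} {a : Fin n → A} (h : ∀ j, a j ∈ F (i j)) :
    PiTensorProduct.tprod k a ∈ inducedFil F n (∑ j, i j) :=
  Submodule.subset_span ⟨i, a, h, rfl, rfl⟩

lemma preserves_inducedFil {V : Type u} [AddCommGroup V] [Module k V] {H : ℤ → Submodule k V}
    {φ : tpow A n →ₗ[k] V} (h : ∀ (i : Fin n → ℤ) (a : Fin n → A), (∀ j, a j ∈ F (i j)) →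
      φ (PiTensorProduct.tprod k a) ∈ H (∑ j, i j)) : Preserves (inducedFil F n) H φ := by
  intro p
  have : inducedFil F n p ≤ (H p).comap φ := by
    refine Submodule.span_le.2 ?_
    rintro _ ⟨i, a, ha, rfl, rfl⟩
    exact h i a ha
  exact this

lemma preserves_map {φ : Fin n → A →ₗ[k] B} (h : ∀ j, Preserves F G (φ j)) :
    Preserves (inducedFil F n) (inducedFil G n) (PiTensorProduct.map φ) := by
  refine preserves_inducedFil fun i a ha => ?_
  rw [PiTensorProduct.map_tprod]
  exact tprod_mem_inducedFil fun j => h j _ _ (ha j)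

/-- The sign operators appear as tensor factors of the summands, so they have to respect the
filtration as well. -/
lemma preserves_der {e : ℤ} (hF : Preserves F F (A.sgn e)) {θ : A →ₗ[k] A}
    (hθ : Preserves F F θ) : Preserves (inducedFil F n) (inducedFil F n)
      (der (fun _ : Fin n => A) e fun _ => θ) := by
  intro p x hx
  rw [der, LinearMap.sum_apply]
  refine Submodule.sum_mem _ fun i _ => preserves_map (fun j => ?_) p x hx
  rcases eq_or_ne j i with rfl | h
  · rwa [Function.update_self]
  · rw [Function.update_of_ne h]
    split_ifs
    · exact hF
    · exact fun _ _ h => h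

namespace NumberContraction

variable [Algebra ℚ k] (L : NumberContraction A B)

/-- Each filtration level is stable under N, hence under its inverse. -/
lemma preserves_h (hD : Preserves F F L.D) (hN : Preserves F F L.N) :
    Preserves F F L.toContraction.h :=
  fun p x hx => L.isNumberOp.inv_mem (hN p) (hD p x hx)

lemma isFilteredContraction (hF : IsDGFiltration A F) (hG : IsDGFiltration B G)
    (hf : Preserves F G L.f.lin) (hg : Preserves G F L.g.lin) (hD : Preserves F F L.D)
    (hN : Preserves F F L.N) : IsFilteredContraction L.toContraction F G where
  left := hF
  right := hG
  f_mem := hf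
  g_mem := hg
  h_mem := L.preserves_h hD hN

lemma preserves_toThick (hF : ∀ e, Preserves F F (A.sgn e)) (hf : Preserves F G L.f.lin)
    (hg : Preserves G F L.g.lin) (hD : Preserves F F L.D) (hN : Preserves F F L.N) :
    Preserves (inducedFil F n) (inducedFil G n) (L.toThick.f n) ∧
      Preserves (inducedFil G n) (inducedFil F n) (L.toThick.g n) ∧
      Preserves (inducedFil F n) (inducedFil F n) (L.toThick.h n) :=
  ⟨preserves_map fun _ => hf, preserves_map fun _ => hg,
    (L.tpow n).preserves_h (preserves_der (hF 1) hD) (preserves_der (hF 0) hN)⟩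

end NumberContraction

variable {O : SymSeq k}

lemma preserves_weightFil {V : Type u} [AddCommGroup V] [Module k V] {H : ℤ → Submodule k V}
    {φ : schur O A →ₗ[k] V}
    (h : ∀ (p : ℤ) (n : ℕ), (n : ℤ) ≤ p → ∀ x, φ ((schurι O A n).lin x) ∈ H p) :
    Preserves (weightFil O A) H φ := by
  intro p
  have : weightFil O A p ≤ (H p).comap φ := by
    refine iSup₂_le fun n hn => ?_
    rintro _ ⟨x, rfl⟩
    exact h p n hn x
  exact this

lemma schurι_mem_weightFil {p : ℤ} {n : ℕ} (h : (n : ℤ) ≤ p) (x : schurM O A n) :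
    (schurι O A n).lin x ∈ weightFil O A p :=
  Submodule.mem_iSup_of_mem n (Submodule.mem_iSup_of_mem h ⟨x, rfl⟩)

/-- This covers both the sign operators and the projections to homogeneous components. -/
lemma preserves_tw (c : ℤ → k) : Preserves (weightFil O A) (weightFil O A) ((schur O A).tw c) :=
  preserves_weightFil fun p n h x => by
    rw [← Mor.tw_comm]
    exact schurι_mem_weightFil h _

lemma preserves_schurThick {e : ℤ} {f : ∀ n, tpow A n →ₗ[k] tpow B n} (hf) :
    Preserves (weightFil O A) (weightFil O B) (schurThick O e f hf) :=
  preserves_weightFil fun p n h x => by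
    have h1 : schurThick O e f hf ((schurι O A n).lin x) =
        (schurι O B n).lin (TensorProduct.map ((O.obj n).sgn e) (f n) x) := schurLift_ι _ _ n x
    rw [h1]
    exact schurι_mem_weightFil h _

lemma isDGFiltration_weightFil (O : SymSeq k) (A : DGMod k) :
    IsDGFiltration (schur O A) (weightFil O A) where
  mono p q h := iSup_mono fun n => iSup_mono' fun hn => ⟨hn.trans h, le_rfl⟩
  graded p n x hx := preserves_tw _ p x hx
  d_mem p x hx := preserves_weightFil (H := weightFil O A) (φ := (schur O A).d)
    (fun p n h x => by
      rw [← Mor.comm]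
      exact schurι_mem_weightFil h _) p x hx
  bounded_below := by
    -- Arities start at 0, so level -1 is an empty sum; level 0 already contains the arity 0 part.
    refine ⟨-1, eq_bot_iff.2 (iSup₂_le fun n hn => ?_)⟩
    omega
  exhaustive := by
    rw [← Submodule.ker_mkQ (⨆ p, weightFil O A p), LinearMap.ker_eq_top]
    refine schur_ext fun n o x => ?_
    rw [LinearMap.zero_apply, Submodule.mkQ_apply, Submodule.Quotient.mk_eq_zero]
    exact Submodule.mem_iSup_of_mem (n : ℤ) (schurι_mem_weightFil le_rfl _)

end filtrations

/-! ### The filtered contraction of C-coalgebras on C[A]. -/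

namespace NumberContraction

variable {A B : DGMod k} (L : NumberContraction A B) (C : Cooperad k)

lemma preserves_schur_f (O : SymSeq k) :
    Preserves (weightFil O A) (weightFil O B) (L.schur O).f.lin :=
  preserves_schurThick fun _ σ x => (perm_tensMap (fun _ => L.f) σ x).symm

lemma preserves_schur_g (O : SymSeq k) :
    Preserves (weightFil O B) (weightFil O A) (L.schur O).g.lin :=
  preserves_schurThick fun _ σ x => (perm_tensMap (fun _ => L.g) σ x).symm

lemma preserves_schur_D (O : SymSeq k) :
    Preserves (weightFil O A) (weightFil O A) (L.schur O).D :=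
  preserves_schurThick L.tpow_D_perm

lemma preserves_schur_N (O : SymSeq k) :
    Preserves (weightFil O A) (weightFil O A) (L.schur O).N :=
  preserves_schurThick L.tpow_N_perm

variable [Algebra ℚ k]

lemma isFilteredContraction_schur (O : SymSeq k) :
    IsFilteredContraction (L.schur O).toContraction (weightFil O A) (weightFil O B) :=
  (L.schur O).isFilteredContraction (isDGFiltration_weightFil O A) (isDGFiltration_weightFil O B)
    (L.preserves_schur_f O) (L.preserves_schur_g O) (L.preserves_schur_D O)
    (L.preserves_schur_N O)

lemma isCoalgebraContraction_schur :
    (L.schur C.toSymSeq).toThick.IsCoalgebraContraction C (C.cofree A) (C.cofree B) where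
  f_morphism := (L.schur C.toSymSeq).toThick_f_isMorphism
  g_morphism := (L.schur C.toSymSeq).toThick_g_isMorphism
  h_pseudoDerivation := (L.schur C.toSymSeq).isPseudoDerivation
  f_coalgebra := L.isCoalgebraMap_f C
  g_coalgebra := L.isCoalgebraMap_g C
  h_coalgebra := L.isCoalgebraMap_h C

lemma isFilteredCoalgebraContraction : IsFilteredCoalgebraContraction C (C.cofree A) (C.cofree B)
    (weightFil C.toSymSeq A) (weightFil C.toSymSeq B) (L.schur C.toSymSeq).toContraction where
  coalgebra_left := C.isCoalgebra_cofree A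
  coalgebra_right := C.isCoalgebra_cofree B
  filtered := L.isFilteredContraction_schur C.toSymSeq
  extension := ⟨(L.schur C.toSymSeq).toThick, (L.schur C.toSymSeq).toThick_f_one,
    (L.schur C.toSymSeq).toThick_g_one, (L.schur C.toSymSeq).toThick_h_one,
    L.isCoalgebraContraction_schur C, fun _ => (L.schur C.toSymSeq).preserves_toThick
      (fun _ => preserves_tw _) (L.preserves_schur_f _) (L.preserves_schur_g _)
      (L.preserves_schur_D _) (L.preserves_schur_N _)⟩

end NumberContraction

/-- The equivariance proof depends on the sequence of maps, so the two must be replaced together. -/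
lemma schurThick_congr {O : SymSeq k} {A B : DGMod k} {e : ℤ}
    {f f' : ∀ n, tpow A n →ₗ[k] tpow B n} (h : f = f') (hf) (hf') :
    schurThick O e f hf = schurThick O e f' hf' := by
  subst h
  rfl

end

theorem mainTheorem9 {k : Type u} [CommRing k] [Algebra ℚ k] (C : Cooperad k) {A B : DGMod k}
    (D : Contraction A B) :
    ∃ E : Contraction (SymSeq.schur C.toSymSeq A) (SymSeq.schur C.toSymSeq B),
      E.f.lin = SymSeq.schurMap C.toSymSeq D.f ∧
      E.g.lin = SymSeq.schurMap C.toSymSeq D.g ∧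
      E.h = SymSeq.schurThick C.toSymSeq 1 D.symTrick D.symTrick_symmetric ∧
      IsFilteredCoalgebraContraction C (C.cofree A) (C.cofree B)
        (weightFil C.toSymSeq A) (weightFil C.toSymSeq B) E := by
  -- The witness divides the Leibniz extension of h to C[A] by that of 1 - gf. It has the required f
  -- and g by definition; its homotopy is induced by those on the tensor powers, which are the
  -- symmetrized tensor trick homotopies.
  refine ⟨(D.toNumber.schur C.toSymSeq).toContraction, rfl, rfl, ?_,
    D.toNumber.isFilteredCoalgebraContraction C⟩
  exact (D.toNumber.schur_h C.toSymSeq).trans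
    (schurThick_congr (funext fun n => (D.symTrick_eq n).symm) _ _)
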